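/- **Theorem (Equivalent formulations of Hamiltonian field theories, II).** Let $\pi:E\to\Sigma$ be a smooth fibre bundle with typical fibre $Q$, where $\Sigma$, $Q$, $E$ are smooth manifolds (Hausdorff, second countable, without boundary) with $\dim\Sigma=n\ge 1$ and $\dim Q=N\ge 1$. For $y\in E$ let $V_y=\ker(\pi_*)_y\subset T_yE$, and let $\Lambda^n_kT_y^*E$ be the space of alternating $n$-forms on $T_yE$ that vanish as soon as $k+1$ of their arguments lie in $V_y$. Let $M(\pi)=\Lambda^n_1T^*E$ and $P(\pi)=\Lambda^n_1T^*E/\Lambda^n_0T^*E$, with projections $\mu:M(\pi)\to P(\pi)$, $\mathrm{pr}:M(\pi)\to E$ and $\tau:P(\pi)\to\Sigma$. Let $\theta$ be the canonical $n$-form on $M(\pi)$, $\theta_\eta(v_1,\dots,v_n)=\eta(\mathrm{pr}_*v_1,\dots,\mathrm{pr}_*v_n)$, and $\omega=-d\theta$. Let $\mathrm{vol}$ be a volume form on $\Sigma$ (which orients $\Sigma$), and let $\gamma$ be the $n$-vector field on $\Sigma$ with $\iota_\gamma\mathrm{vol}=1$, where contractions follow the convention $\iota_{u_1\wedge\dots\wedge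 u_n}\eta=\eta(u_1,\dots,u_n,\cdot)$. Let $h:P(\pi)\to M(\pi)$ be a Hamiltonian section, i.e. a smooth map with $\mu\circ h=\mathrm{id}$, and put $\theta_h=h^*\theta$. The map $\chi:P(\pi)\times\mathbb R\to M(\pi)$, $\chi(z,u)=h(z)+u\,\pi^*\mathrm{vol}$ (the pullback being taken at the base point of $z$ in $E$), is a bijection; let $H=-\mathrm{pr}_{\mathbb R}\circ\chi^{-1}:M(\pi)\to\mathbb R$ be the associated Hamiltonian function. Let $U\subset\Sigma$ be open, let $\tilde\Psi:U\to P(\pi)$ be a smooth local section of $\tau$, and put $\Psi=h\circ\tilde\Psi$. Then the following are equivalent: 1. $\tilde\Psi$ is critical for the functional $\mathbb H[\tilde\Psi]=\int_U\tilde\Psi^*\theta_h$, i.e. for every smooth $\tau$-vertical vector field $X$ on $P(\pi)$ with compact support contained in $\tau^{-1}(U)$, with flow $(\sigma_\varepsilon)_{\varepsilon\in\mathbb R}$, and every compact $K\subset U$ containing $\tau(\mathrm{supp}\,X)$, $$\frac{d}{d\varepsilon}\Big|_{\varepsilon=0}\int_K(\sigma_\varepsilon\circ\tilde\Psi)^*\theta_h=0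 ;$$ 2. $\iota_{(\Psi_*)_x(\gamma_x)}\,\omega_{\Psi(x)}=(-1)^n(dH)_{\Psi(x)}$ on $T_{\Psi(x)}M(\pi)$ for every $x\in U$. -/

import Mathlib

open scoped Manifold ContDiff Topology
open Set

namespace FieldTheory

noncomputable section

/-! ### Forms and multivectors on a vector space -/

section LinearAlgebra

variable {W W' W'' : Type*} [AddCommGroup W] [Module ℝ W] [TopologicalSpace W]
  [AddCommGroup W'] [Module ℝ W'] [TopologicalSpace W']
  [AddCommGroup W''] [Module ℝ W''] [TopologicalSpace W'']

/-- `Λⁿ_k W*` relative to a subspace `V` of `W`: the `n`-forms on `W` that vanish as soon as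
`k + 1` of their arguments lie in `V`. -/
def formsVanishing (V : Submodule ℝ W) (n k : ℕ) : Submodule ℝ (W [⋀^Fin n]→L[ℝ] ℝ) where
  carrier := {η | ∀ v : Fin n → W,
    (∃ s : Finset (Fin n), s.card = k + 1 ∧ ∀ i ∈ s, v i ∈ V) → η v = 0}
  add_mem' := by
    intro a b ha hb v hv
    simp [ha v hv, hb v hv]
  zero_mem' := by intro v _; rfl
  smul_mem' := by
    intro c a ha v hv
    simp [ha v hv]

theorem formsVanishing_comp {V : Submodule ℝ W} {V' : Submodule ℝ W'} (f : W' →L[ℝ] W)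
    (hf : ∀ v ∈ V', f v ∈ V) {n k : ℕ} {η : W [⋀^Fin n]→L[ℝ] ℝ}
    (hη : η ∈ formsVanishing V n k) :
    η.compContinuousLinearMap f ∈ formsVanishing V' n k := by
  rintro v ⟨s, hs, hv⟩
  exact hη (f ∘ v) ⟨s, hs, fun i hi => hf _ (hv i hi)⟩

/-- A form in `Λⁿ_0` only depends on its arguments modulo `V`. -/
theorem formsVanishing_zero_congr {V : Submodule ℝ W} {n : ℕ} {η : W [⋀^Fin n]→L[ℝ] ℝ}
    (hη : η ∈ formsVanishing V n 0) {v v' : Fin n → W} (h : ∀ i, v i - v' i ∈ V) :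
    η v = η v' := by
  classical
  have key : η ((fun i => v i - v' i) + v') =
      ∑ s : Finset (Fin n), η (s.piecewise (fun i => v i - v' i) v') :=
    η.toMultilinearMap.map_add_univ _ _
  have h0 : ((fun i => v i - v' i) + v') = v := by ext i; simp
  rw [h0, Finset.sum_eq_single (∅ : Finset (Fin n))] at key
  · simpa using key
  · intro s _ hs
    obtain ⟨i, hi⟩ := Finset.nonempty_iff_ne_empty.mpr hs
    refine hη _ ⟨{i}, by simp, ?_⟩
    intro j hj
    obtain rfl : j = i := by simpa using hj
    simpa [Finset.piecewise, hi] using h j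
  · simp

/-- Two elements of `Λⁿ_1 W*` are identified if their difference lies in `Λⁿ_0 W*`. -/
def momentumSetoid (V : Submodule ℝ W) (n : ℕ) : Setoid (formsVanishing V n 1) where
  r η η' := (η : W [⋀^Fin n]→L[ℝ] ℝ) - (η' : W [⋀^Fin n]→L[ℝ] ℝ) ∈ formsVanishing V n 0
  iseqv :=
    { refl := fun η => by simp
      symm := fun {η η'} h => by
        rw [← neg_sub]
        exact neg_mem h
      trans := fun {a b c} h h' => by
        rw [← sub_add_sub_cancel (a : W [⋀^Fin n]→L[ℝ] ℝ) b c]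
        exact add_mem h h' }

/-- The quotient `Λⁿ_1 W* / Λⁿ_0 W*`. -/
def Momenta (V : Submodule ℝ W) (n : ℕ) : Type _ := Quotient (momentumSetoid V n)

/-- The quotient map `Λⁿ_1 W* → Λⁿ_1 W* / Λⁿ_0 W*`. -/
def Momenta.mk {V : Submodule ℝ W} {n : ℕ} (η : formsVanishing V n 1) : Momenta V n :=
  Quotient.mk (momentumSetoid V n) η

theorem Momenta.mk_eq_mk {V : Submodule ℝ W} {n : ℕ} {η η' : formsVanishing V n 1} :
    Momenta.mk η = Momenta.mk η' ↔
      (η : W [⋀^Fin n]→L[ℝ] ℝ) - (η' : W [⋀^Fin n]→L[ℝ] ℝ) ∈ formsVanishing V n 0 :=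
  Quotient.eq (r := momentumSetoid V n)

theorem Momenta.mk_surjective {V : Submodule ℝ W} {n : ℕ} (m : Momenta V n) :
    ∃ η, Momenta.mk η = m := Quotient.exists_rep m

/-- Pullback of forms along a linear map that respects the distinguished subspaces. -/
def pullForms {V : Submodule ℝ W} {V' : Submodule ℝ W'} (f : W' →L[ℝ] W)
    (hf : ∀ v ∈ V', f v ∈ V) {n : ℕ} (η : formsVanishing V n 1) : formsVanishing V' n 1 :=
  ⟨(η : W [⋀^Fin n]→L[ℝ] ℝ).compContinuousLinearMap f, formsVanishing_comp f hf η.2⟩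

/-- The map induced by `pullForms` on the quotients `Λⁿ_1 / Λⁿ_0`. -/
def pullMomenta {V : Submodule ℝ W} {V' : Submodule ℝ W'} (f : W' →L[ℝ] W)
    (hf : ∀ v ∈ V', f v ∈ V) {n : ℕ} : Momenta V n → Momenta V' n :=
  Quotient.map (pullForms f hf) (fun _ _ h => formsVanishing_comp f hf h)

theorem pullMomenta_mk {V : Submodule ℝ W} {V' : Submodule ℝ W'} (f : W' →L[ℝ] W)
    (hf : ∀ v ∈ V', f v ∈ V) {n : ℕ} (η : formsVanishing V n 1) :
    pullMomenta f hf (Momenta.mk η) = Momenta.mk (pullForms f hf η) := rfl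

/-- The alternating map `u ↦ Ω(u₁, …, uₙ, w)`. -/
def fillLast {n : ℕ} (Ω : W [⋀^Fin (n + 1)]→L[ℝ] ℝ) (w : W) : W [⋀^Fin n]→ₗ[ℝ] ℝ where
  toFun u := Ω (Fin.snoc (α := fun _ => W) u w)
  map_update_add' := by
    intro inst u i x y
    have : inst = instDecidableEqFin n := Subsingleton.elim _ _
    subst this
    simp [Fin.snoc_update]
  map_update_smul' := by
    intro inst u i c x
    have : inst = instDecidableEqFin n := Subsingleton.elim _ _
    subst this
    simp [Fin.snoc_update]
  map_eq_zero_of_eq' := by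
    intro u i j hij hne
    exact Ω.map_eq_zero_of_eq _ (i := i.castSucc) (j := j.castSucc) (by simpa using hij)
      (fun hc => hne (Fin.castSucc_injective _ hc))

/-- The contraction `ι_Γ Ω` of an `(n+1)`-form with an `n`-vector, with the convention
`ι_{u₁ ∧ … ∧ uₙ} Ω = Ω(u₁, …, uₙ, ·)`, i.e. `ι_{u ∧ v} = ι_v ι_u`. -/
def contract {n : ℕ} (Γ : ⋀[ℝ]^n W) (Ω : W [⋀^Fin (n + 1)]→L[ℝ] ℝ) (w : W) : ℝ :=
  exteriorPower.alternatingMapLinearEquiv (fillLast Ω w) Γ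

/-- The full contraction `ι_Γ α` of an `n`-form with an `n`-vector, normalised by
`ι_{u₁ ∧ … ∧ uₙ} α = α(u₁, …, uₙ)`. -/
def pairing {n : ℕ} (Γ : ⋀[ℝ]^n W) (α : W [⋀^Fin n]→L[ℝ] ℝ) : ℝ :=
  exteriorPower.alternatingMapLinearEquiv α.toAlternatingMap Γ

theorem contract_ιMulti {n : ℕ} (u : Fin n → W) (Ω : W [⋀^Fin (n + 1)]→L[ℝ] ℝ) (w : W) :
    contract (exteriorPower.ιMulti ℝ n u) Ω w = Ω (Fin.snoc (α := fun _ => W) u w) := by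
  simp [contract, fillLast]

theorem pairing_ιMulti {n : ℕ} (u : Fin n → W) (α : W [⋀^Fin n]→L[ℝ] ℝ) :
    pairing (exteriorPower.ιMulti ℝ n u) α = α u := by
  simp [pairing]

/-- If `f : W → W'` is onto with kernel `V`, `n = dim W'` and `vol ≠ 0` is an `n`-form on `W'`,
then every element of `Λⁿ_0 W*` is a unique multiple of `f^* vol`. -/
theorem existsUnique_smul_pullback [FiniteDimensional ℝ W'] {n : ℕ}
    (hn : Module.finrank ℝ W' = n) (f : W →L[ℝ] W') (hf : Function.Surjective f)
    (vol : W' [⋀^Fin n]→L[ℝ] ℝ) (hvol : vol ≠ 0) {η : W [⋀^Fin n]→L[ℝ] ℝ}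
    (hη : η ∈ formsVanishing (LinearMap.ker (f : W →ₗ[ℝ] W')) n 0) :
    ∃! u : ℝ, η = u • vol.compContinuousLinearMap f := by
  obtain ⟨s, hs⟩ := LinearMap.exists_rightInverse_of_surjective (f : W →ₗ[ℝ] W')
    (LinearMap.range_eq_top.mpr hf)
  have hs' : ∀ x, f (s x) = x := fun x => LinearMap.congr_fun hs x
  let b := Module.finBasisOfFinrankEq ℝ W' hn
  have hvb : ∀ v, vol v = vol b * b.det v := fun v => by
    have := DFunLike.congr_fun (AlternatingMap.eq_smul_basis_det b vol.toAlternatingMap) v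
    simpa using this
  have hb0 : vol b ≠ 0 := by
    intro h0
    apply hvol
    ext v
    simp [hvb v, h0]
  have hηb : ∀ w, η w = η (fun i => s (b i)) * b.det (fun i => f (w i)) := fun w => by
    have h1 : η w = η (fun i => s (f (w i))) := formsVanishing_zero_congr hη (fun i => by
      simp [LinearMap.mem_ker, hs'])
    have h2 := DFunLike.congr_fun
      (AlternatingMap.eq_smul_basis_det b (η.toAlternatingMap.compLinearMap s))
      (fun i => f (w i))
    rw [h1]
    simpa using h2
  refine ⟨η (fun i => s (b i)) / vol b, ?_, ?_⟩
  · ext w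
    have : (vol.compContinuousLinearMap f) w = vol b * b.det (fun i => f (w i)) := hvb _
    simp only [ContinuousAlternatingMap.smul_apply, this, hηb w, smul_eq_mul]
    field_simp
  · intro u hu
    have h1 : η (fun i => s (b i)) = u * vol b := by
      rw [hu]
      simp only [ContinuousAlternatingMap.smul_apply, smul_eq_mul,
        ContinuousAlternatingMap.compContinuousLinearMap_apply]
      congr 2
      ext i
      simp [hs']
    rw [h1]
    field_simp

end LinearAlgebra

section Smoothness

theorem contDiffOn_of_separating {V X ι : Type*} [NormedAddCommGroup V] [NormedSpace ℝ V]
    [NormedAddCommGroup X] [NormedSpace ℝ X] [Fintype ι] (J : V → ι → ℝ)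
    (hadd : ∀ a b, J (a + b) = J a + J b) (hsmul : ∀ (r : ℝ) a, J (r • a) = r • J a)
    (hJ : Function.Injective J) {f : X → V} {s : Set X}
    (hf : ∀ i, ContDiffOn ℝ ∞ (fun x => J (f x) i) s) : ContDiffOn ℝ ∞ f s := by
  let J' : V →ₗ[ℝ] ι → ℝ := { toFun := J, map_add' := hadd, map_smul' := hsmul }
  have hJ' : Function.Injective J' := hJ
  have : FiniteDimensional ℝ V := FiniteDimensional.of_injective J' hJ'
  obtain ⟨g, hg⟩ := J'.exists_leftInverse_of_injective (LinearMap.ker_eq_bot_of_injective hJ')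
  have h1 : f = fun x => (LinearMap.toContinuousLinearMap g) (J (f x)) := by
    funext x
    exact (LinearMap.congr_fun hg (f x)).symm
  rw [h1]
  exact (LinearMap.toContinuousLinearMap g).contDiff.comp_contDiffOn
    (contDiffOn_pi.2 fun I => hf _)

theorem contDiffOn_of_forall_apply {W X : Type*} [NormedAddCommGroup W] [NormedSpace ℝ W]
    [FiniteDimensional ℝ W] [NormedAddCommGroup X] [NormedSpace ℝ X] {n : ℕ}
    {p : Submodule ℝ (W [⋀^Fin n]→L[ℝ] ℝ)} {f : X → p} {s : Set X}
    (hf : ∀ v : Fin n → W, ContDiffOn ℝ ∞ (fun x => (f x).1 v) s) : ContDiffOn ℝ ∞ f s := by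
  let b := Module.finBasis ℝ W
  refine contDiffOn_of_separating
    (fun (ζ : p) (I : Fin n → Fin (Module.finrank ℝ W)) => ζ.1 (fun i => b (I i)))
    (fun _ _ => rfl) (fun _ _ => rfl) ?_ (fun I => hf _)
  intro ζ ζ' h
  apply Subtype.ext
  apply ContinuousAlternatingMap.toContinuousMultilinearMap_injective
  apply ContinuousMultilinearMap.toMultilinearMap_injective
  exact Module.Basis.ext_multilinear (fun _ => b) fun I => congr_fun h I

theorem contDiff_coe_form {W : Type*} [NormedAddCommGroup W] [NormedSpace ℝ W] {n : ℕ}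
    {p : Submodule ℝ (W [⋀^Fin n]→L[ℝ] ℝ)} :
    ContDiff ℝ ∞ (fun ζ : p => (ζ : W [⋀^Fin n]→L[ℝ] ℝ)) :=
  IsBoundedLinearMap.contDiff
    { map_add := fun _ _ => rfl
      map_smul := fun _ _ => rfl
      bound := ⟨1, one_pos, fun x => by rw [one_mul]; exact le_rfl⟩ }

theorem contDiff_form_apply {W : Type*} [NormedAddCommGroup W] [NormedSpace ℝ W] {n : ℕ} :
    ContDiff ℝ ∞ (fun q : (W [⋀^Fin n]→L[ℝ] ℝ) × (Fin n → W) => q.1 q.2) := by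
  rw [contDiff_iff_contDiffAt]
  intro x
  exact (ContinuousLinearMap.analyticAt_uncurry_of_multilinear
    (ContinuousAlternatingMap.toContinuousMultilinearMapCLM ℝ :
      (W [⋀^Fin n]→L[ℝ] ℝ) →L[ℝ] _) (x := x)).contDiffAt

end Smoothness

/-! ### Fibre bundles and multiphase spaces -/

section Bundle

variable {A B G : Type*} [NormedAddCommGroup A] [NormedSpace ℝ A]
  [NormedAddCommGroup B] [NormedSpace ℝ B]
  [NormedAddCommGroup G] [NormedSpace ℝ G]
  {S Q E : Type*} [TopologicalSpace S] [ChartedSpace A S]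
  [TopologicalSpace Q] [ChartedSpace B Q] [TopologicalSpace E] [ChartedSpace G E]

variable (A B G S Q E) in
/-- A smooth fibre bundle `E → S` with typical fibre `Q`: a map that over a neighbourhood of every
point of `S` is trivialised by a diffeomorphism. Here `S`, `Q`, `E` are manifolds (without
boundary) modelled on `A`, `B`, `G`. -/
structure SmoothFibreBundle where
  /-- The bundle projection. -/
  proj : E → S
  exists_trivialization : ∀ x : S, ∃ t : Bundle.Trivialization Q proj, x ∈ t.baseSet ∧
    ContMDiffOn 𝓘(ℝ, G) (𝓘(ℝ, A).prod 𝓘(ℝ, B)) ∞ t t.source ∧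
    ContMDiffOn (𝓘(ℝ, A).prod 𝓘(ℝ, B)) 𝓘(ℝ, G) ∞ t.toOpenPartialHomeomorph.symm t.target

/-- The vertical subspace `V_y(π) = ker (π_*)_y` of `T_y E`. -/
def SmoothFibreBundle.vertical (π : SmoothFibreBundle A B G S Q E) (y : E) :
    Submodule ℝ (TangentSpace 𝓘(ℝ, G) y) :=
  LinearMap.ker (mfderiv 𝓘(ℝ, G) 𝓘(ℝ, A) π.proj y :
    TangentSpace 𝓘(ℝ, G) y →ₗ[ℝ] TangentSpace 𝓘(ℝ, A) (π.proj y))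

variable (A B) in
/-- The vertical subspace `0 × B` of the coordinate space `A × B`. -/
def modelVertical : Submodule ℝ (A × B) := LinearMap.ker (LinearMap.fst ℝ A B)

/-- Local coordinates `(x, q)` on the total space such that `x` are local coordinates on the
base. -/
structure AdaptedChart (π : SmoothFibreBundle A B G S Q E) where
  /-- The chart `(x, q)` of the total space. -/
  chart : OpenPartialHomeomorph E (A × B)
  /-- The chart `x` of the base. -/
  baseChart : OpenPartialHomeomorph S A
  contMDiffOn_chart : ContMDiffOn 𝓘(ℝ, G) 𝓘(ℝ, A × B) ∞ chart chart.source
  contMDiffOn_chart_symm : ContMDiffOn 𝓘(ℝ, A × B) 𝓘(ℝ, G) ∞ chart.symm chart.target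
  contMDiffOn_baseChart : ContMDiffOn 𝓘(ℝ, A) 𝓘(ℝ, A) ∞ baseChart baseChart.source
  contMDiffOn_baseChart_symm : ContMDiffOn 𝓘(ℝ, A) 𝓘(ℝ, A) ∞ baseChart.symm baseChart.target
  proj_mem : ∀ y ∈ chart.source, π.proj y ∈ baseChart.source
  baseChart_proj : ∀ y ∈ chart.source, baseChart (π.proj y) = (chart y).1

theorem exists_adaptedChart [IsManifold 𝓘(ℝ, A) ∞ S] [IsManifold 𝓘(ℝ, B) ∞ Q]
    (π : SmoothFibreBundle A B G S Q E) (y : E) :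
    ∃ c : AdaptedChart π, y ∈ c.chart.source := by
  obtain ⟨t, hx, ht, ht'⟩ := π.exists_trivialization (π.proj y)
  have hy : y ∈ t.source := t.mem_source.mpr hx
  let φ := chartAt A (π.proj y)
  let ψ := chartAt B (t y).2
  have hφ := contMDiffOn_chart (I := 𝓘(ℝ, A)) (n := ∞) (x := π.proj y)
  have hφ' := contMDiffOn_chart_symm (I := 𝓘(ℝ, A)) (n := ∞) (x := π.proj y)
  have hψ := contMDiffOn_chart (I := 𝓘(ℝ, B)) (n := ∞) (x := (t y).2)
  have hψ' := contMDiffOn_chart_symm (I := 𝓘(ℝ, B)) (n := ∞) (x := (t y).2)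
  let c := t.toOpenPartialHomeomorph.trans (φ.prod ψ)
  have hsrc : ∀ z, z ∈ c.source ↔ z ∈ t.source ∧ π.proj z ∈ φ.source ∧ (t z).2 ∈ ψ.source := by
    intro z
    constructor
    · rintro ⟨h1, h2⟩
      refine ⟨h1, ?_, h2.2⟩
      have h3 : (t z).1 ∈ φ.source := h2.1
      rwa [t.coe_fst h1] at h3
    · rintro ⟨h1, h2, h3⟩
      refine ⟨h1, ?_, h3⟩
      change (t z).1 ∈ φ.source
      rwa [t.coe_fst h1]
  refine ⟨⟨c, φ, ?_, ?_, hφ, hφ', fun z hz => ((hsrc z).1 hz).2.1, ?_⟩, ?_⟩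
  · rw [modelWithCornersSelf_prod, ← chartedSpaceSelf_prod]
    exact (hφ.prodMap hψ).comp (ht.mono fun z hz => hz.1) (fun z hz => hz.2)
  · rw [modelWithCornersSelf_prod, ← chartedSpaceSelf_prod]
    have hp := ht'.comp' (hφ'.prodMap hψ')
    refine hp.mono fun z hz => ⟨hz.1, hz.2⟩
  · intro z hz
    change φ (π.proj z) = φ (t z).1
    rw [t.coe_fst hz.1]
  · exact (hsrc y).2 ⟨hy, mem_chart_source A _, mem_chart_source B _⟩


namespace AdaptedChart

variable {π : SmoothFibreBundle A B G S Q E} (c : AdaptedChart π)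

/-- The derivative of the chart, `T_y E → A × B`. -/
def deriv (y : E) : TangentSpace 𝓘(ℝ, G) y →L[ℝ] A × B :=
  mfderiv 𝓘(ℝ, G) 𝓘(ℝ, A × B) c.chart y

/-- The derivative of the inverse chart, `A × B → T_y E`. -/
def derivSymm (y : E) : A × B →L[ℝ] TangentSpace 𝓘(ℝ, G) y :=
  mfderiv 𝓘(ℝ, A × B) 𝓘(ℝ, G) c.chart.symm (c.chart y)

theorem mdifferentiable : c.chart.MDifferentiable 𝓘(ℝ, G) 𝓘(ℝ, A × B) :=
  ⟨c.contMDiffOn_chart.mdifferentiableOn (by simp),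
    c.contMDiffOn_chart_symm.mdifferentiableOn (by simp)⟩

theorem baseChart_mdifferentiable : c.baseChart.MDifferentiable 𝓘(ℝ, A) 𝓘(ℝ, A) :=
  ⟨c.contMDiffOn_baseChart.mdifferentiableOn (by simp),
    c.contMDiffOn_baseChart_symm.mdifferentiableOn (by simp)⟩

theorem derivSymm_deriv {y : E} (hy : y ∈ c.chart.source) (v : TangentSpace 𝓘(ℝ, G) y) :
    c.derivSymm y (c.deriv y v) = v :=
  DFunLike.congr_fun (c.mdifferentiable.symm_comp_deriv hy) v

theorem deriv_derivSymm {y : E} (hy : y ∈ c.chart.source) (v : A × B) :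
    c.deriv y (c.derivSymm y v) = v := by
  have h := DFunLike.congr_fun (c.mdifferentiable.comp_symm_deriv (c.chart.map_source hy)) v
  rw [c.chart.left_inv hy] at h
  exact h

theorem baseChart_symm_fst {y : E} (hy : y ∈ c.chart.source) :
    c.baseChart.symm (c.chart y).1 = π.proj y := by
  rw [← c.baseChart_proj y hy, c.baseChart.left_inv (c.proj_mem y hy)]

theorem fst_mem {u : A × B} (hu : u ∈ c.chart.target) : u.1 ∈ c.baseChart.target := by
  have h := c.baseChart_proj _ (c.chart.map_target hu)
  rw [c.chart.right_inv hu] at h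
  rw [← h]
  exact c.baseChart.map_source (c.proj_mem _ (c.chart.map_target hu))

theorem mdifferentiableAt_proj {y : E} (hy : y ∈ c.chart.source) :
    MDifferentiableAt 𝓘(ℝ, G) 𝓘(ℝ, A) π.proj y := by
  have h1 : MDifferentiableAt 𝓘(ℝ, G) 𝓘(ℝ, A)
      (fun z => c.baseChart.symm (c.chart z).1) y := by
    have hf : MDifferentiableAt 𝓘(ℝ, G) 𝓘(ℝ, A) (fun z => (c.chart z).1) y := 
      (ContinuousLinearMap.fst ℝ A B).mdifferentiableAt.comp y (c.mdifferentiable.mdifferentiableAt hy)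
    exact (c.baseChart_mdifferentiable.mdifferentiableAt_symm
      (c.fst_mem (c.chart.map_source hy))).comp y hf
  refine h1.congr_of_eventuallyEq ?_
  filter_upwards [c.chart.open_source.mem_nhds hy] with z hz
  exact (c.baseChart_symm_fst hz).symm

theorem fst_deriv {y : E} (hy : y ∈ c.chart.source) (v : TangentSpace 𝓘(ℝ, G) y) :
    (c.deriv y v).1 = mfderiv 𝓘(ℝ, A) 𝓘(ℝ, A) c.baseChart (π.proj y)
      (mfderiv 𝓘(ℝ, G) 𝓘(ℝ, A) π.proj y v) := by
  have hb := c.baseChart_mdifferentiable.mdifferentiableAt (c.proj_mem y hy)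
  have h1 : HasMFDerivAt 𝓘(ℝ, G) 𝓘(ℝ, A) (c.baseChart ∘ π.proj) y
      ((mfderiv 𝓘(ℝ, A) 𝓘(ℝ, A) c.baseChart (π.proj y)).comp
        (mfderiv 𝓘(ℝ, G) 𝓘(ℝ, A) π.proj y)) :=
    hb.hasMFDerivAt.comp y (c.mdifferentiableAt_proj hy).hasMFDerivAt
  have h2 : HasMFDerivAt 𝓘(ℝ, G) 𝓘(ℝ, A) (fun z => (c.chart z).1) y
      ((ContinuousLinearMap.fst ℝ A B).comp (mfderiv 𝓘(ℝ, G) 𝓘(ℝ, A × B) c.chart y)) :=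
    (ContinuousLinearMap.fst ℝ A B).hasMFDerivAt.comp y
      (c.mdifferentiable.mdifferentiableAt hy).hasMFDerivAt
  have h3 : (fun z => (c.chart z).1) =ᶠ[𝓝 y] c.baseChart ∘ π.proj := by
    filter_upwards [c.chart.open_source.mem_nhds hy] with z hz
    exact (c.baseChart_proj z hz).symm
  have h4 := hasMFDerivAt_unique h2 (h1.congr_of_eventuallyEq h3)
  exact DFunLike.congr_fun h4 v

theorem deriv_mem {y : E} (hy : y ∈ c.chart.source) :
    ∀ v ∈ π.vertical y, c.deriv y v ∈ modelVertical A B := by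
  intro v hv
  have hv' : mfderiv 𝓘(ℝ, G) 𝓘(ℝ, A) π.proj y v = 0 := hv
  change (c.deriv y v).1 = 0
  rw [c.fst_deriv hy, hv']
  exact map_zero _

theorem derivSymm_mem {y : E} (hy : y ∈ c.chart.source) :
    ∀ w ∈ modelVertical A B, c.derivSymm y w ∈ π.vertical y := by
  intro w hw
  have hw' : w.1 = 0 := hw
  change mfderiv 𝓘(ℝ, G) 𝓘(ℝ, A) π.proj y (c.derivSymm y w) = 0
  apply c.baseChart_mdifferentiable.mfderiv_injective (c.proj_mem y hy)
  rw [← c.fst_deriv hy, c.deriv_derivSymm hy, hw']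
  exact (map_zero _).symm

theorem surjective_mfderiv_proj {y : E} (hy : y ∈ c.chart.source) :
    Function.Surjective (mfderiv 𝓘(ℝ, G) 𝓘(ℝ, A) π.proj y) := by
  intro a
  refine ⟨c.derivSymm y (mfderiv 𝓘(ℝ, A) 𝓘(ℝ, A) c.baseChart (π.proj y) a, 0), ?_⟩
  apply c.baseChart_mdifferentiable.mfderiv_injective (c.proj_mem y hy)
  rw [← c.fst_deriv hy, c.deriv_derivSymm hy]

end AdaptedChart

/-! ### The multiphase spaces -/

/-- The multiphase space `M(π) = Λⁿ_1 T^*E`: pairs of a point `y` of `E` and an `n`-form on `T_y E`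
that vanishes whenever two of its arguments are vertical. -/
@[ext]
structure MultiphaseSpace (π : SmoothFibreBundle A B G S Q E) (n : ℕ) where
  /-- The base point in `E`. -/
  pt : E
  /-- The `n`-form at the base point. -/
  cov : formsVanishing (π.vertical pt) n 1

/-- The restricted multiphase space `P(π) = Λⁿ_1 T^*E / Λⁿ_0 T^*E`. -/
@[ext]
structure RestrictedMultiphaseSpace (π : SmoothFibreBundle A B G S Q E) (n : ℕ) where
  /-- The base point in `E`. -/
  pt : E
  /-- The class of `n`-forms at the base point. -/
  cov : Momenta (π.vertical pt) n

variable (A B) in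
/-- The coordinate space of the fibres of `M(π)`, with elements `p dⁿx + ∑ pᵘ_a dq^a ∧ dⁿx_μ`. -/
abbrev FibreModel (n : ℕ) : Submodule ℝ ((A × B) [⋀^Fin n]→L[ℝ] ℝ) :=
  formsVanishing (modelVertical A B) n 1

variable (A B) in
/-- The coordinate space of the fibres of `P(π)`, with elements `∑ pᵘ_a dq^a ∧ dⁿx_μ`. -/
def RestrictedFibreModel (n : ℕ) : Submodule ℝ ((A × B) [⋀^Fin n]→L[ℝ] ℝ) where
  carrier := {ζ | ζ ∈ FibreModel A B n ∧ ∀ a : Fin n → A, ζ (fun i => (a i, (0 : B))) = 0}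
  add_mem' := fun ha hb => ⟨add_mem ha.1 hb.1, fun v => by simp [ha.2 v, hb.2 v]⟩
  zero_mem' := ⟨zero_mem _, fun _ => rfl⟩
  smul_mem' := fun c _ ha => ⟨Submodule.smul_mem _ c ha.1, fun v => by simp [ha.2 v]⟩

/-- The map `p dⁿx + ∑ pᵘ_a dq^a ∧ dⁿx_μ ↦ ∑ pᵘ_a dq^a ∧ dⁿx_μ`. -/
def dropHorizontalAux {n : ℕ} (ζ : FibreModel A B n) : RestrictedFibreModel A B n :=
  ⟨(ζ : (A × B) [⋀^Fin n]→L[ℝ] ℝ) - (ζ : (A × B) [⋀^Fin n]→L[ℝ] ℝ).compContinuousLinearMap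
      ((ContinuousLinearMap.inl ℝ A B).comp (ContinuousLinearMap.fst ℝ A B)),
    Submodule.sub_mem _ ζ.2 (formsVanishing_comp (V := modelVertical A B) _ (fun _ hv => hv) ζ.2),
    fun a => sub_self (ζ.1 (fun i => (a i, (0 : B))))⟩

theorem dropHorizontalAux_apply {n : ℕ} (ζ : FibreModel A B n) (v : Fin n → A × B) :
    (dropHorizontalAux ζ).1 v = ζ.1 v - ζ.1 (fun i => ((v i).1, (0 : B))) := rfl

/-- The coordinate map `[p dⁿx + ∑ pᵘ_a dq^a ∧ dⁿx_μ] ↦ ∑ pᵘ_a dq^a ∧ dⁿx_μ`. -/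
def dropHorizontal {n : ℕ} : Momenta (modelVertical A B) n → RestrictedFibreModel A B n :=
  Quotient.lift dropHorizontalAux (by
    intro ζ ζ' h
    apply Subtype.ext
    ext v
    have h1 := formsVanishing_zero_congr h (v := v) (v' := fun i => ((v i).1, (0 : B))) (fun i => by
      change (v i).1 - (v i).1 = 0
      simp)
    change ζ.1 v - ζ'.1 v = ζ.1 _ - ζ'.1 _ at h1
    rw [dropHorizontalAux_apply, dropHorizontalAux_apply]
    linarith)

theorem dropHorizontal_mk {n : ℕ} (ζ : FibreModel A B n) :
    dropHorizontal (Momenta.mk ζ) = dropHorizontalAux ζ := rfl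

/-- The map inverse to `dropHorizontal`. -/
def liftMomentum {n : ℕ} (ζ : RestrictedFibreModel A B n) : Momenta (modelVertical A B) n :=
  Momenta.mk ⟨ζ.1, ζ.2.1⟩

theorem dropHorizontal_liftMomentum {n : ℕ} (ζ : RestrictedFibreModel A B n) :
    dropHorizontal (liftMomentum ζ) = ζ := by
  apply Subtype.ext
  ext v
  change ζ.1 v - ζ.1 (fun i => ((v i).1, (0 : B))) = ζ.1 v
  rw [ζ.2.2, sub_zero]

theorem liftMomentum_dropHorizontal {n : ℕ} (m : Momenta (modelVertical A B) n) :
    liftMomentum (dropHorizontal m) = m := by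
  obtain ⟨ζ, rfl⟩ := Momenta.mk_surjective m
  refine Momenta.mk_eq_mk.2 ?_
  rintro v ⟨s, hs, hv⟩
  obtain ⟨i, rfl⟩ := Finset.card_eq_one.mp (by simpa using hs)
  have hi : (v i).1 = 0 := hv i (by simp)
  change ζ.1 v - ζ.1 (fun i => ((v i).1, (0 : B))) - ζ.1 v = 0
  rw [ζ.1.map_coord_zero (m := fun i => ((v i).1, (0 : B))) i (by simp [hi])]
  ring


theorem MultiphaseSpace.ext_apply {π : SmoothFibreBundle A B G S Q E} {n : ℕ}
    {m m' : MultiphaseSpace π n} (h : m.pt = m'.pt)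
    (h' : ∀ v : Fin n → G, m.cov.1 v = m'.cov.1 v) : m = m' := by
  obtain ⟨y, η⟩ := m
  obtain ⟨y', η'⟩ := m'
  obtain rfl : y = y' := h
  obtain rfl : η = η' := Subtype.ext (ContinuousAlternatingMap.ext h')
  rfl

theorem RestrictedMultiphaseSpace.ext_apply {π : SmoothFibreBundle A B G S Q E} {n : ℕ} {y y' : E}
    (h : y = y') {η : formsVanishing (π.vertical y) n 1} {η' : formsVanishing (π.vertical y') n 1}
    (h' : ∀ v : Fin n → G, η.1 v = η'.1 v) :
    (⟨y, Momenta.mk η⟩ : RestrictedMultiphaseSpace π n) = ⟨y', Momenta.mk η'⟩ := by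
  subst h
  obtain rfl : η = η' := Subtype.ext (ContinuousAlternatingMap.ext h')
  rfl

namespace AdaptedChart

variable {π : SmoothFibreBundle A B G S Q E} (c c' : AdaptedChart π)

open Classical in
/-- The coordinates `(x, q, pᵘ_a, p)` on `M(π)` induced by coordinates `(x, q)` on `E`. -/
def multiphaseChart (n : ℕ) : PartialEquiv (MultiphaseSpace π n) ((A × B) × FibreModel A B n) where
  toFun m := (c.chart m.pt,
    if h : m.pt ∈ c.chart.source then pullForms (c.derivSymm m.pt) (c.derivSymm_mem h) m.cov else 0)
  invFun u := ⟨c.chart.symm u.1,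
    if h : u.1 ∈ c.chart.target then
      pullForms (c.deriv (c.chart.symm u.1)) (c.deriv_mem (c.chart.map_target h)) u.2 else 0⟩
  source := {m | m.pt ∈ c.chart.source}
  target := c.chart.target ×ˢ univ
  map_source' m hm := ⟨c.chart.map_source hm, mem_univ _⟩
  map_target' u hu := c.chart.map_target hu.1
  left_inv' := by
    intro m hm
    have hm : m.pt ∈ c.chart.source := hm
    refine MultiphaseSpace.ext_apply (c.chart.left_inv hm) fun v => ?_
    simp only [hm, c.chart.map_source hm, dif_pos]
    change m.cov.1 (fun i => c.derivSymm m.pt (c.deriv (c.chart.symm (c.chart m.pt)) (v i))) = _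
    rw [c.chart.left_inv hm]
    congr 1
    funext i
    exact c.derivSymm_deriv hm (v i)
  right_inv' := by
    intro u hu
    have hu : u.1 ∈ c.chart.target := hu.1
    refine Prod.ext (c.chart.right_inv hu) (Subtype.ext (ContinuousAlternatingMap.ext fun v => ?_))
    simp only [hu, c.chart.map_target hu, dif_pos]
    change u.2.1 (fun i => c.deriv (c.chart.symm u.1) (c.derivSymm (c.chart.symm u.1) (v i))) = _
    congr 1
    funext i
    exact c.deriv_derivSymm (c.chart.map_target hu) (v i)

open Classical in
/-- The coordinates `(x, q, pᵘ_a)` on `P(π)` induced by coordinates `(x, q)` on `E`. -/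
def restrictedChart (n : ℕ) :
    PartialEquiv (RestrictedMultiphaseSpace π n) ((A × B) × RestrictedFibreModel A B n) where
  toFun m := (c.chart m.pt,
    if h : m.pt ∈ c.chart.source then
      dropHorizontal (pullMomenta (c.derivSymm m.pt) (c.derivSymm_mem h) m.cov) else 0)
  invFun u := ⟨c.chart.symm u.1,
    if h : u.1 ∈ c.chart.target then
      pullMomenta (c.deriv (c.chart.symm u.1)) (c.deriv_mem (c.chart.map_target h))
        (liftMomentum u.2) else Momenta.mk 0⟩
  source := {m | m.pt ∈ c.chart.source}
  target := c.chart.target ×ˢ univ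
  map_source' m hm := ⟨c.chart.map_source hm, mem_univ _⟩
  map_target' u hu := c.chart.map_target hu.1
  left_inv' := by
    rintro ⟨y, m⟩ hm
    obtain ⟨η, rfl⟩ := Momenta.mk_surjective m
    have hm : y ∈ c.chart.source := hm
    simp only [dif_pos hm, dif_pos (c.chart.map_source hm)]
    rw [liftMomentum_dropHorizontal, pullMomenta_mk, pullMomenta_mk]
    refine RestrictedMultiphaseSpace.ext_apply (c.chart.left_inv hm) fun v => ?_
    change η.1 (fun i => c.derivSymm y (c.deriv (c.chart.symm (c.chart y)) (v i))) = _
    rw [c.chart.left_inv hm]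
    congr 1
    funext i
    exact c.derivSymm_deriv hm (v i)
  right_inv' := by
    intro u hu
    have hu : u.1 ∈ c.chart.target := hu.1
    refine Prod.ext (c.chart.right_inv hu) ?_
    simp only [hu, c.chart.map_target hu, dif_pos]
    refine Eq.trans ?_ (dropHorizontal_liftMomentum u.2)
    change dropHorizontal (Momenta.mk _) = dropHorizontal (Momenta.mk _)
    refine congrArg (fun ζ => dropHorizontal (Momenta.mk ζ))
      (Subtype.ext (ContinuousAlternatingMap.ext fun v => ?_))
    change u.2.1 (fun i => c.deriv (c.chart.symm u.1) (c.derivSymm (c.chart.symm u.1) (v i))) = _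
    congr 1
    funext i
    exact c.deriv_derivSymm (c.chart.map_target hu) (v i)

theorem multiphaseChart_apply (n : ℕ) {m : MultiphaseSpace π n} (h : m.pt ∈ c.chart.source) :
    c.multiphaseChart n m =
      (c.chart m.pt, pullForms (c.derivSymm m.pt) (c.derivSymm_mem h) m.cov) := by
  simp only [multiphaseChart, dif_pos h]

theorem multiphaseChart_symm_apply (n : ℕ) {u : (A × B) × FibreModel A B n}
    (h : u.1 ∈ c.chart.target) :
    (c.multiphaseChart n).symm u = ⟨c.chart.symm u.1,
      pullForms (c.deriv (c.chart.symm u.1)) (c.deriv_mem (c.chart.map_target h)) u.2⟩ := by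
  change (c.multiphaseChart n).invFun u = _
  simp only [multiphaseChart, dif_pos h]

theorem restrictedChart_apply (n : ℕ) {m : RestrictedMultiphaseSpace π n}
    (h : m.pt ∈ c.chart.source) :
    c.restrictedChart n m = (c.chart m.pt,
      dropHorizontal (pullMomenta (c.derivSymm m.pt) (c.derivSymm_mem h) m.cov)) := by
  simp only [restrictedChart, dif_pos h]

theorem restrictedChart_symm_apply (n : ℕ) {u : (A × B) × RestrictedFibreModel A B n}
    (h : u.1 ∈ c.chart.target) :
    (c.restrictedChart n).symm u = ⟨c.chart.symm u.1,
      pullMomenta (c.deriv (c.chart.symm u.1)) (c.deriv_mem (c.chart.map_target h))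
        (liftMomentum u.2)⟩ := by
  change (c.restrictedChart n).invFun u = _
  simp only [restrictedChart, dif_pos h]

/-- The coordinate change `(x', q') ↦ (x, q)` is smooth. -/
theorem contDiffOn_transition :
    ContDiffOn ℝ ∞ (c'.chart ∘ c.chart.symm) (c.chart.symm.trans c'.chart).source :=
  (c'.contMDiffOn_chart.comp' c.contMDiffOn_chart_symm).contDiffOn

theorem deriv_comp_derivSymm {y : E} (hy : y ∈ c.chart.source) (hy' : y ∈ c'.chart.source) :
    (c.deriv y).comp (c'.derivSymm y) =
      fderiv ℝ (c.chart ∘ c'.chart.symm) (c'.chart y) := by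
  have hu := c'.chart.map_source hy'
  have h1 := (c'.mdifferentiable.mdifferentiableAt_symm hu).hasMFDerivAt
  have h2 : HasMFDerivAt 𝓘(ℝ, G) 𝓘(ℝ, A × B) c.chart (c'.chart.symm (c'.chart y))
      (c.deriv y) := by
    rw [c'.chart.left_inv hy']
    exact (c.mdifferentiable.mdifferentiableAt hy).hasMFDerivAt
  have h3 := HasMFDerivAt.comp (c'.chart y) h2 h1
  have h4 := h3.mfderiv
  rw [mfderiv_eq_fderiv] at h4
  exact h4.symm

/-- The derivative of the coordinate change `c' → c` at the point with `c`-coordinates `u`. -/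
def jacobian (u : A × B) : A × B →L[ℝ] A × B :=
  (c.deriv (c.chart.symm u)).comp (c'.derivSymm (c.chart.symm u))

theorem contDiffOn_jacobian :
    ContDiffOn ℝ ∞ (jacobian c c') (c.chart.symm.trans c'.chart).source := by
  have h1 : ContDiffOn ℝ ∞ (fderiv ℝ (c.chart ∘ c'.chart.symm)) (c'.chart.symm.trans c.chart).source :=
    (contDiffOn_transition c' c).fderiv_of_isOpen (c'.chart.symm.trans c.chart).open_source
      (by simp)
  refine (h1.comp (contDiffOn_transition c c') ?_).congr ?_
  · intro u hu
    refine ⟨c'.chart.map_source hu.2, ?_⟩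
    change c'.chart.symm (c'.chart (c.chart.symm u)) ∈ c.chart.source
    rw [c'.chart.left_inv (x := c.chart.symm u) hu.2]
    exact c.chart.map_target hu.1
  · intro u hu
    exact deriv_comp_derivSymm c c' (c.chart.map_target hu.1) hu.2

theorem contDiffOn_multiphaseChart (n : ℕ) [FiniteDimensional ℝ A] [FiniteDimensional ℝ B] :
    ContDiffOn ℝ ∞ ((c.multiphaseChart n).symm.trans (c'.multiphaseChart n))
      ((c.chart.symm.trans c'.chart).source ×ˢ univ) := by
  refine ContDiffOn.prodMk
    ((contDiffOn_transition c c').comp contDiff_fst.contDiffOn fun u hu => hu.1) ?_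
  refine contDiffOn_of_forall_apply fun v => ?_
  have h1 : ContDiffOn ℝ ∞ (fun u : (A × B) × FibreModel A B n =>
      u.2.1 (fun i => jacobian c c' u.1 (v i))) ((c.chart.symm.trans c'.chart).source ×ˢ univ) := by
    refine contDiff_form_apply.comp_contDiffOn (ContDiffOn.prodMk ?_ (contDiffOn_pi.2 fun i => ?_))
    · exact (contDiff_coe_form.comp contDiff_snd).contDiffOn
    · exact ((contDiffOn_jacobian c c').comp contDiff_fst.contDiffOn fun u hu => hu.1).clm_apply
        contDiffOn_const
  refine h1.congr ?_
  intro u hu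
  have hu1 : u.1 ∈ c.chart.target := hu.1.1
  have hu2 : c.chart.symm u.1 ∈ c'.chart.source := hu.1.2
  change ((c'.multiphaseChart n) ((c.multiphaseChart n).symm u)).2.1 v = _
  rw [c.multiphaseChart_symm_apply n hu1, c'.multiphaseChart_apply n hu2]
  rfl

theorem contDiffOn_restrictedChart (n : ℕ) [FiniteDimensional ℝ A] [FiniteDimensional ℝ B] :
    ContDiffOn ℝ ∞ ((c.restrictedChart n).symm.trans (c'.restrictedChart n))
      ((c.chart.symm.trans c'.chart).source ×ˢ univ) := by
  refine ContDiffOn.prodMk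
    ((contDiffOn_transition c c').comp contDiff_fst.contDiffOn fun u hu => hu.1) ?_
  refine contDiffOn_of_forall_apply fun v => ?_
  have h0 : ∀ v : Fin n → A × B, ContDiffOn ℝ ∞ (fun u : (A × B) × RestrictedFibreModel A B n =>
      u.2.1 (fun i => jacobian c c' u.1 (v i))) ((c.chart.symm.trans c'.chart).source ×ˢ univ) := by
    intro v
    refine contDiff_form_apply.comp_contDiffOn (ContDiffOn.prodMk ?_ (contDiffOn_pi.2 fun i => ?_))
    · exact (contDiff_coe_form.comp contDiff_snd).contDiffOn
    · exact ((contDiffOn_jacobian c c').comp contDiff_fst.contDiffOn fun u hu => hu.1).clm_apply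
        contDiffOn_const
  refine ((h0 v).sub (h0 fun i => ((v i).1, (0 : B)))).congr ?_
  intro u hu
  have hu1 : u.1 ∈ c.chart.target := hu.1.1
  have hu2 : c.chart.symm u.1 ∈ c'.chart.source := hu.1.2
  change ((c'.restrictedChart n) ((c.restrictedChart n).symm u)).2.1 v = _
  rw [c.restrictedChart_symm_apply n hu1, c'.restrictedChart_apply n hu2]
  rfl

end AdaptedChart

theorem multiphase_trans_source {π : SmoothFibreBundle A B G S Q E} (n : ℕ)
    (c c' : AdaptedChart π) :
    ((c.multiphaseChart n).symm.trans (c'.multiphaseChart n)).source =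
      (c.chart.symm.trans c'.chart).source ×ˢ univ := by
  ext u
  constructor
  · rintro ⟨h1, h2⟩
    exact ⟨⟨h1.1, h2⟩, mem_univ _⟩
  · rintro ⟨⟨h1, h2⟩, -⟩
    exact ⟨⟨h1, mem_univ _⟩, h2⟩

theorem restricted_trans_source {π : SmoothFibreBundle A B G S Q E} (n : ℕ)
    (c c' : AdaptedChart π) :
    ((c.restrictedChart n).symm.trans (c'.restrictedChart n)).source =
      (c.chart.symm.trans c'.chart).source ×ˢ univ := by
  ext u
  constructor
  · rintro ⟨h1, h2⟩
    exact ⟨⟨h1.1, h2⟩, mem_univ _⟩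
  · rintro ⟨⟨h1, h2⟩, -⟩
    exact ⟨⟨h1, mem_univ _⟩, h2⟩

/-- Adapted coordinates around a point of `E`. -/
def adaptedChartAt [IsManifold 𝓘(ℝ, A) ∞ S] [IsManifold 𝓘(ℝ, B) ∞ Q]
    (π : SmoothFibreBundle A B G S Q E) (y : E) : AdaptedChart π :=
  (exists_adaptedChart π y).choose

theorem mem_adaptedChartAt [IsManifold 𝓘(ℝ, A) ∞ S] [IsManifold 𝓘(ℝ, B) ∞ Q]
    (π : SmoothFibreBundle A B G S Q E) (y : E) : y ∈ (adaptedChartAt π y).chart.source :=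
  (exists_adaptedChart π y).choose_spec

section Manifolds

variable [FiniteDimensional ℝ A] [FiniteDimensional ℝ B]
  [IsManifold 𝓘(ℝ, A) ∞ S] [IsManifold 𝓘(ℝ, B) ∞ Q]
  (π : SmoothFibreBundle A B G S Q E) (n : ℕ)

/-- The atlas of `M(π)` by the coordinates `(x, q, pᵘ_a, p)`. -/
def multiphaseCore : ChartedSpaceCore ((A × B) × FibreModel A B n) (MultiphaseSpace π n) where
  atlas := range fun c : AdaptedChart π => c.multiphaseChart n
  chartAt m := (adaptedChartAt π m.pt).multiphaseChart n
  mem_chart_source m := mem_adaptedChartAt π m.pt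
  chart_mem_atlas m := mem_range_self _
  open_source := by
    rintro _ _ ⟨c, rfl⟩ ⟨c', rfl⟩
    rw [multiphase_trans_source]
    exact (c.chart.symm.trans c'.chart).open_source.prod isOpen_univ
  continuousOn_toFun := by
    rintro _ _ ⟨c, rfl⟩ ⟨c', rfl⟩
    rw [multiphase_trans_source]
    exact (c.contDiffOn_multiphaseChart c' n).continuousOn

/-- The atlas of `P(π)` by the coordinates `(x, q, pᵘ_a)`. -/
def restrictedCore : ChartedSpaceCore ((A × B) × RestrictedFibreModel A B n)
    (RestrictedMultiphaseSpace π n) where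
  atlas := range fun c : AdaptedChart π => c.restrictedChart n
  chartAt m := (adaptedChartAt π m.pt).restrictedChart n
  mem_chart_source m := mem_adaptedChartAt π m.pt
  chart_mem_atlas m := mem_range_self _
  open_source := by
    rintro _ _ ⟨c, rfl⟩ ⟨c', rfl⟩
    rw [restricted_trans_source]
    exact (c.chart.symm.trans c'.chart).open_source.prod isOpen_univ
  continuousOn_toFun := by
    rintro _ _ ⟨c, rfl⟩ ⟨c', rfl⟩
    rw [restricted_trans_source]
    exact (c.contDiffOn_restrictedChart c' n).continuousOn

instance : TopologicalSpace (MultiphaseSpace π n) := (multiphaseCore π n).toTopologicalSpace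

instance : ChartedSpace ((A × B) × FibreModel A B n) (MultiphaseSpace π n) :=
  (multiphaseCore π n).toChartedSpace

instance : TopologicalSpace (RestrictedMultiphaseSpace π n) :=
  (restrictedCore π n).toTopologicalSpace

instance : ChartedSpace ((A × B) × RestrictedFibreModel A B n) (RestrictedMultiphaseSpace π n) :=
  (restrictedCore π n).toChartedSpace

instance : IsManifold 𝓘(ℝ, (A × B) × FibreModel A B n) ∞ (MultiphaseSpace π n) := by
  refine isManifold_of_contDiffOn _ _ _ ?_
  rintro e e' he he'
  obtain ⟨_, ⟨c, rfl⟩, he⟩ := mem_iUnion₂.mp he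
  obtain ⟨_, ⟨c', rfl⟩, he'⟩ := mem_iUnion₂.mp he'
  obtain rfl := he
  obtain rfl := he'
  have h := c.contDiffOn_multiphaseChart c' n
  rw [← multiphase_trans_source] at h
  refine h.mono ?_
  rintro u ⟨hu, -⟩
  exact hu

instance : IsManifold 𝓘(ℝ, (A × B) × RestrictedFibreModel A B n) ∞
    (RestrictedMultiphaseSpace π n) := by
  refine isManifold_of_contDiffOn _ _ _ ?_
  rintro e e' he he'
  obtain ⟨_, ⟨c, rfl⟩, he⟩ := mem_iUnion₂.mp he
  obtain ⟨_, ⟨c', rfl⟩, he'⟩ := mem_iUnion₂.mp he'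
  obtain rfl := he
  obtain rfl := he'
  have h := c.contDiffOn_restrictedChart c' n
  rw [← restricted_trans_source] at h
  refine h.mono ?_
  rintro u ⟨hu, -⟩
  exact hu

instance : IsManifold 𝓘(ℝ, (A × B) × FibreModel A B n) 1 (MultiphaseSpace π n) :=
  IsManifold.of_le (n := ∞) (by simp)

instance : IsManifold 𝓘(ℝ, (A × B) × RestrictedFibreModel A B n) 1
    (RestrictedMultiphaseSpace π n) :=
  IsManifold.of_le (n := ∞) (by simp)

end Manifolds

end Bundle

/-! ### Differential forms on manifolds -/

section Forms

variable {V V' X Y : Type*} [NormedAddCommGroup V] [NormedSpace ℝ V]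
  [NormedAddCommGroup V'] [NormedSpace ℝ V'] [TopologicalSpace X] [ChartedSpace V X]
  [TopologicalSpace Y] [ChartedSpace V' Y] {k : ℕ}

variable (V X) in
/-- A (not necessarily smooth) differential `k`-form on a manifold `X` modelled on `V`. -/
abbrev DiffForm (k : ℕ) : Type _ := ∀ x : X, TangentSpace 𝓘(ℝ, V) x [⋀^Fin k]→L[ℝ] ℝ

/-- The pullback `f^* α`. -/
def DiffForm.pullback (f : X → Y) (α : DiffForm V' Y k) : DiffForm V X k := fun x =>
  (α (f x)).compContinuousLinearMap (mfderiv 𝓘(ℝ, V) 𝓘(ℝ, V') f x)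

/-- The coordinate expression of a form in a chart, as a form on the coordinate space. -/
def DiffForm.inChart (α : DiffForm V X k) (e : OpenPartialHomeomorph X V) :
    V → V [⋀^Fin k]→L[ℝ] ℝ := fun u =>
  (α (e.symm u)).compContinuousLinearMap (mfderiv 𝓘(ℝ, V) 𝓘(ℝ, V) e.symm u)

/-- Smoothness of a form: its coordinate expressions are smooth. -/
def DiffForm.Smooth (α : DiffForm V X k) : Prop :=
  ∀ e ∈ atlas V X, ContDiffOn ℝ ∞ (α.inChart e) e.target

/-- The exterior derivative, computed in the preferred chart at each point. -/
def DiffForm.d (α : DiffForm V X k) : DiffForm V X (k + 1) := fun x =>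
  (extDeriv (α.inChart (chartAt V x)) (chartAt V x x)).compContinuousLinearMap
    (mfderiv 𝓘(ℝ, V) 𝓘(ℝ, V) (chartAt V x) x)

/-- The differential `df` of a function, as a linear form on `T_x X`. -/
def differential (f : X → ℝ) (x : X) : TangentSpace 𝓘(ℝ, V) x →L[ℝ] ℝ :=
  mfderiv 𝓘(ℝ, V) 𝓘(ℝ, ℝ) f x

variable (V X) in
/-- A volume form on a manifold: a smooth nowhere vanishing form `vol` (of top degree). -/
structure VolumeForm (n : ℕ) where
  /-- The underlying form. -/
  form : DiffForm V X n
  smooth : form.Smooth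
  ne_zero : ∀ x, form x ≠ 0

end Forms

/-! ### Canonical forms, Hamiltonian sections and Hamiltonian functions -/

section Hamiltonian

variable {A B G : Type*} [NormedAddCommGroup A] [NormedSpace ℝ A]
  [NormedAddCommGroup B] [NormedSpace ℝ B]
  [NormedAddCommGroup G] [NormedSpace ℝ G]
  {S Q E : Type*} [TopologicalSpace S] [ChartedSpace A S]
  [TopologicalSpace Q] [ChartedSpace B Q] [TopologicalSpace E] [ChartedSpace G E]
  (π : SmoothFibreBundle A B G S Q E) (n : ℕ)

/-- The projection `μ : M(π) → P(π)`. -/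
def mu (m : MultiphaseSpace π n) : RestrictedMultiphaseSpace π n := ⟨m.pt, Momenta.mk m.cov⟩

/-- The projection `τ : P(π) → Σ`. -/
def tau (z : RestrictedMultiphaseSpace π n) : S := π.proj z.pt

variable {π n}

theorem pullback_vertical (y : E) (α : TangentSpace 𝓘(ℝ, A) (π.proj y) [⋀^Fin n]→L[ℝ] ℝ) (k : ℕ) :
    α.compContinuousLinearMap (mfderiv 𝓘(ℝ, G) 𝓘(ℝ, A) π.proj y) ∈
      formsVanishing (π.vertical y) n k := by
  rintro v ⟨s, hs, hv⟩
  obtain ⟨i, hi⟩ : s.Nonempty := Finset.card_pos.mp (by omega)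
  have h : mfderiv 𝓘(ℝ, G) 𝓘(ℝ, A) π.proj y (v i) = 0 := hv i hi
  exact α.map_coord_zero i h

/-- The affine action `η ↦ η + u π^*vol` on the fibres of `μ`. -/
def addVol (vol : VolumeForm A S n) (m : MultiphaseSpace π n) (u : ℝ) : MultiphaseSpace π n :=
  ⟨m.pt, m.cov + u • ⟨(vol.form (π.proj m.pt)).compContinuousLinearMap
    (mfderiv 𝓘(ℝ, G) 𝓘(ℝ, A) π.proj m.pt), pullback_vertical m.pt _ 1⟩⟩

theorem mu_addVol (vol : VolumeForm A S n) (m : MultiphaseSpace π n) (u : ℝ) :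
    mu π n (addVol vol m u) = mu π n m := by
  refine congrArg (RestrictedMultiphaseSpace.mk m.pt) (Momenta.mk_eq_mk.2 ?_)
  intro v hv
  have h := pullback_vertical m.pt (vol.form (π.proj m.pt)) 0 v hv
  change m.cov.1 v + u * _ - m.cov.1 v = 0
  rw [add_sub_cancel_left]
  exact mul_eq_zero_of_right u h

theorem existsUnique_addVol [FiniteDimensional ℝ A] [IsManifold 𝓘(ℝ, A) ∞ S]
    [IsManifold 𝓘(ℝ, B) ∞ Q] (hn : Module.finrank ℝ A = n)
    (vol : VolumeForm A S n) {m m' : MultiphaseSpace π n} (h : mu π n m = mu π n m') :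
    ∃! u : ℝ, addVol vol m u = m' := by
  obtain ⟨y, η⟩ := m
  obtain ⟨y', η'⟩ := m'
  have hy : y = y' := congrArg RestrictedMultiphaseSpace.pt h
  subst hy
  have hm : Momenta.mk η' = Momenta.mk η := by
    simp only [mu, RestrictedMultiphaseSpace.mk.injEq, heq_eq_eq, true_and] at h
    exact h.symm
  obtain ⟨u, hu, huniq⟩ := existsUnique_smul_pullback
    (W := TangentSpace 𝓘(ℝ, G) y) (W' := A) hn (mfderiv 𝓘(ℝ, G) 𝓘(ℝ, A) π.proj y)
    ((adaptedChartAt π y).surjective_mfderiv_proj (mem_adaptedChartAt π y))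
    (vol.form (π.proj y)) (vol.ne_zero _) (Momenta.mk_eq_mk.1 hm)
  refine ⟨u, ?_, ?_⟩
  · refine MultiphaseSpace.ext_apply rfl fun v => ?_
    have h1 := DFunLike.congr_fun hu v
    change η.1 v + u • _ = η'.1 v
    exact (sub_eq_iff_eq_add'.1 h1).symm
  · intro u' hu'
    apply huniq
    simp only [addVol, MultiphaseSpace.mk.injEq, heq_eq_eq, true_and] at hu'
    rw [← hu']
    exact add_sub_cancel_left _ _

variable [FiniteDimensional ℝ A] [FiniteDimensional ℝ B]
  [IsManifold 𝓘(ℝ, A) ∞ S] [IsManifold 𝓘(ℝ, B) ∞ Q]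

variable (π n) in
/-- The canonical `n`-form `θ` on `M(π) = Λⁿ_1 T^*E`:
`θ_η(u₁, …, uₙ) = η(pr_* u₁, …, pr_* uₙ)` with `pr : M(π) → E`. -/
def theta : DiffForm ((A × B) × FibreModel A B n) (MultiphaseSpace π n) n := fun m =>
  m.cov.1.compContinuousLinearMap
    (mfderiv 𝓘(ℝ, (A × B) × FibreModel A B n) 𝓘(ℝ, G) MultiphaseSpace.pt m)

variable (π n) in
/-- The canonical `(n+1)`-form `ω = -dθ` on `M(π)`. -/
def omega : DiffForm ((A × B) × FibreModel A B n) (MultiphaseSpace π n) (n + 1) := fun m =>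
  -(theta π n).d m

variable (π n) in
/-- A Hamiltonian section: a smooth map `h : P(π) → M(π)` with `μ ∘ h = id`. -/
structure HamiltonianSection where
  /-- The underlying map. -/
  toFun : RestrictedMultiphaseSpace π n → MultiphaseSpace π n
  contMDiff : ContMDiff 𝓘(ℝ, (A × B) × RestrictedFibreModel A B n)
    𝓘(ℝ, (A × B) × FibreModel A B n) ∞ toFun
  mu_comp : ∀ z, mu π n (toFun z) = z

/-- The form `θ_h = h^* θ` on `P(π)`. -/
def HamiltonianSection.theta (h : HamiltonianSection π n) :
    DiffForm ((A × B) × RestrictedFibreModel A B n) (RestrictedMultiphaseSpace π n) n :=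
  DiffForm.pullback h.toFun (FieldTheory.theta π n)

/-- The trivialisation `χ : P(π) × ℝ → M(π)`, `χ(z, u) = h(z) + u π^*vol`. -/
def HamiltonianSection.chi (h : HamiltonianSection π n) (vol : VolumeForm A S n)
    (q : RestrictedMultiphaseSpace π n × ℝ) : MultiphaseSpace π n := addVol vol (h.toFun q.1) q.2

theorem HamiltonianSection.chi_bijective (h : HamiltonianSection π n)
    (hn : Module.finrank ℝ A = n) (vol : VolumeForm A S n) : Function.Bijective (h.chi vol) := by
  constructor
  · rintro ⟨z, u⟩ ⟨z', u'⟩ hq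
    have hz := congrArg (mu π n) hq
    simp only [chi, mu_addVol, h.mu_comp] at hz
    subst hz
    have := (existsUnique_addVol hn vol (m := h.toFun z) (m' := h.chi vol (z, u))
      (mu_addVol vol _ _).symm).unique rfl hq.symm
    exact Prod.ext rfl this
  · intro m
    obtain ⟨u, hu, -⟩ := existsUnique_addVol hn vol (m := h.toFun (mu π n m)) (m' := m)
      (h.mu_comp _)
    exact ⟨(mu π n m, u), hu⟩

/-- The Hamiltonian function `H = -pr_ℝ ∘ χ⁻¹` on `M(π)` associated with a Hamiltonian section `h`
and a volume form on the base. -/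
def HamiltonianSection.hamiltonian (h : HamiltonianSection π n) (hn : Module.finrank ℝ A = n)
    (vol : VolumeForm A S n) (m : MultiphaseSpace π n) : ℝ :=
  -((Equiv.ofBijective _ (h.chi_bijective hn vol)).symm m).2

end Hamiltonian

/-! ### Integration and critical sections -/

section Critical

open MeasureTheory

variable {n N : ℕ} {S Q E : Type*} [TopologicalSpace S] [ChartedSpace (EuclideanSpace ℝ (Fin n)) S]
  [TopologicalSpace Q] [ChartedSpace (EuclideanSpace ℝ (Fin N)) Q]
  [TopologicalSpace E] [ChartedSpace (EuclideanSpace ℝ (Fin (n + N))) E]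

/-- The standard basis of `ℝⁿ`. -/
def stdFrame (n : ℕ) : Fin n → EuclideanSpace ℝ (Fin n) := fun i => EuclideanSpace.single i 1

/-- The measure `|vol|` on the domain of the chart at `x`: in coordinates it is
`|vol(∂₁, …, ∂ₙ)|` times Lebesgue measure. -/
def VolumeForm.chartMeasure [MeasurableSpace S] (vol : VolumeForm (EuclideanSpace ℝ (Fin n)) S n)
    (x : S) : Measure S :=
  Measure.map (chartAt (EuclideanSpace ℝ (Fin n)) x).symm
    ((volume.restrict (chartAt (EuclideanSpace ℝ (Fin n)) x).target).withDensity fun u =>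
      ENNReal.ofReal |vol.form.inChart (chartAt (EuclideanSpace ℝ (Fin n)) x) u (stdFrame n)|)

/-- The measure on the base induced by a volume form: the least measure that dominates the measures
`|vol|` on the chart domains. These agree on overlaps and the base is second countable, so it
restricts to the measure `|vol|` on each chart domain. -/
def VolumeForm.measure [MeasurableSpace S] (vol : VolumeForm (EuclideanSpace ℝ (Fin n)) S n) :
    Measure S := ⨆ x : S, vol.chartMeasure x

/-- The integral `∫_K α` of an `n`-form over a subset of an `n`-manifold, oriented by a volume form:
if `α = f vol`, it is the integral of `f` with respect to the measure induced by `vol`. -/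
def VolumeForm.integral [MeasurableSpace S] (vol : VolumeForm (EuclideanSpace ℝ (Fin n)) S n)
    (K : Set S) (α : DiffForm (EuclideanSpace ℝ (Fin n)) S n) : ℝ :=
  ∫ x in K, α x (stdFrame n) / vol.form x (stdFrame n) ∂vol.measure

variable [IsManifold 𝓘(ℝ, EuclideanSpace ℝ (Fin n)) ∞ S]
  [IsManifold 𝓘(ℝ, EuclideanSpace ℝ (Fin N)) ∞ Q]
  {π : SmoothFibreBundle (EuclideanSpace ℝ (Fin n)) (EuclideanSpace ℝ (Fin N))
    (EuclideanSpace ℝ (Fin (n + N))) S Q E}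

/-- The coordinate space of `M(π)`. -/
abbrev MultiphaseModel (n N : ℕ) : Type :=
  (EuclideanSpace ℝ (Fin n) × EuclideanSpace ℝ (Fin N)) ×
    FibreModel (EuclideanSpace ℝ (Fin n)) (EuclideanSpace ℝ (Fin N)) n

/-- The coordinate space of `P(π)`. -/
abbrev RestrictedModel (n N : ℕ) : Type :=
  (EuclideanSpace ℝ (Fin n) × EuclideanSpace ℝ (Fin N)) ×
    RestrictedFibreModel (EuclideanSpace ℝ (Fin n)) (EuclideanSpace ℝ (Fin N)) n

/-- The local section `Ψ` over `U` is critical for `ℍ[Ψ] = ∫ Ψ^* θ_h`: for every smooth vector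
field `X` on `P(π)` that is vertical over the base and compactly supported over `U`, with flow `σ`,
the derivative of `ε ↦ ℍ[σ_ε ∘ Ψ]` at `ε = 0` vanishes. Since `σ_ε ∘ Ψ` only differs from `Ψ` over
the projection of the support of `X`, the integral is taken over compact subsets `K` of `U` that
contain it; so the functional need not converge over `U`. -/
def IsCritical [MeasurableSpace S] (h : HamiltonianSection π n)
    (vol : VolumeForm (EuclideanSpace ℝ (Fin n)) S n) (U : Set S)
    (Ψ : S → RestrictedMultiphaseSpace π n) : Prop :=
  ∀ X : ∀ z : RestrictedMultiphaseSpace π n, TangentSpace 𝓘(ℝ, RestrictedModel n N) z,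
    ContMDiff 𝓘(ℝ, RestrictedModel n N) 𝓘(ℝ, RestrictedModel n N).tangent ∞
      (fun z => (⟨z, X z⟩ :
        TangentBundle 𝓘(ℝ, RestrictedModel n N) (RestrictedMultiphaseSpace π n))) →
    (∀ z, mfderiv 𝓘(ℝ, RestrictedModel n N) 𝓘(ℝ, EuclideanSpace ℝ (Fin n)) (tau π n) z (X z) = 0) →
    IsCompact (closure {z | X z ≠ 0}) →
    closure {z | X z ≠ 0} ⊆ tau π n ⁻¹' U →
    ∀ σ : ℝ → RestrictedMultiphaseSpace π n → RestrictedMultiphaseSpace π n,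
      ContMDiff (𝓘(ℝ, ℝ).prod 𝓘(ℝ, RestrictedModel n N)) 𝓘(ℝ, RestrictedModel n N) ∞
        (Function.uncurry σ) →
      (∀ z, σ 0 z = z) →
      (∀ z, IsMIntegralCurve (I := 𝓘(ℝ, RestrictedModel n N)) (fun t => σ t z) X) →
      ∀ K : Set S, IsCompact K → K ⊆ U → tau π n '' closure {z | X z ≠ 0} ⊆ K →
        HasDerivAt (fun ε : ℝ => vol.integral K (DiffForm.pullback (σ ε ∘ Ψ) h.theta)) 0 0

end Critical

end
end FieldTheory

open FieldTheory

/-! The equivalence passes through a third condition, on P(π) alone: `dθ_h(v, Ψ̃_*b₁, …, Ψ̃_*bₙ) =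
0` for every tangent vector v at every point of the section, where b is a frame of the base.

Field equation ⇔ third condition (pointwise linear algebra). By the definition of H, each η in M(π)
equals `h(μ(η)) - H(η) π^*vol`, hence `θ = μ^*θ_h - H p^*vol` with p : M(π) → Σ
(`theta_decomposition`). Along Ψ = h ∘ Ψ̃ the function H vanishes, so there `dθ = μ^*dθ_h - dH ∧
p^*vol`. Contract with Ψ_*γ: dH kills the vectors Ψ_*bᵢ because H ∘ Ψ = 0, and p ∘ Ψ = id turns
`p^*vol` into vol. What is left is `ι_{Ψ_*γ} dθ = (ι_{Ψ̃_*γ} dθ_h) ∘ μ_* - (-1)ⁿ dH`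
(`d_apply_of_decomposition`, `d_apply_of_section`). Since ω = -dθ, the field equation says that
`ι_{Ψ̃_*γ} dθ_h` vanishes on the image of μ_*, which is everything because h is a section of μ
(`field_equation_iff`).

Criticality ⇔ third condition (calculus of variations). Pull θ_h back along the deformation (ε, x) ↦
σ_ε(Ψ̃(x)), as one form on ℝ × Σ. Cartan's formula in the direction ∂_ε gives, at ε = 0, the
derivative `Ψ̃^*(ι_X dθ_h) + d Ψ̃^*(ι_X θ_h)`. The exact term has compact support and integrates to
zero by Stokes (`VolumeForm.integral_divergence`), so the derivative of the action is the integral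
of `Ψ̃^*(ι_X dθ_h)` (`hasDerivAt_integral_pullback_of_support`). The third condition therefore
implies criticality.

Conversely, take a compactly supported vertical flow, multiply its generator by a test function χ on
the base and apply the fundamental lemma of the calculus of variations: `ι_X dθ_h` vanishes on the
frame Ψ̃_*b for the generator X of the flow (`eq_zero_of_critical_flow`). For vectors tangent to the
section the condition is automatic, as n + 1 vectors of an n-dimensional space are dependent, and
these together with the vertical vectors span.

It remains to realise any vertical vector as the velocity of a compactly supported flow. No
differential equation is solved: in a chart, points are rotated about a centre in a plane, with an
angular speed that is a bump function of the distance to the centre (`exists_compactFlow_inner`).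
This needs fibres of dimension at least 2, which n, N ≥ 1 provide: N field directions and at least
one momentum direction. -/

namespace FieldTheory

noncomputable section

set_option linter.unusedSectionVars false

/-! ### Calculus of forms along maps -/

section LocalForms

variable {V V' X Y Z : Type*} [NormedAddCommGroup V] [NormedSpace ℝ V]
  [NormedAddCommGroup V'] [NormedSpace ℝ V'] [TopologicalSpace X] [ChartedSpace V X]
  [TopologicalSpace Y] [ChartedSpace V' Y] {k : ℕ} [NormedAddCommGroup Z] [NormedSpace ℝ Z]

/-- The pullback of a form along a map from a normed space, as a map into the space of forms. -/
def DiffForm.localForm (g : Z → X) (α : DiffForm V X k) : Z → Z [⋀^Fin k]→L[ℝ] ℝ :=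
  fun z => (α (g z)).compContinuousLinearMap (mfderiv 𝓘(ℝ, Z) 𝓘(ℝ, V) g z)

theorem DiffForm.localForm_apply (g : Z → X) (α : DiffForm V X k) (z : Z) (v : Fin k → Z) :
    α.localForm g z v = α (g z) (fun i => mfderiv 𝓘(ℝ, Z) 𝓘(ℝ, V) g z (v i)) := rfl

theorem DiffForm.pullback_apply (g : X → Y) (α : DiffForm V' Y k) (x : X)
    (v : Fin k → TangentSpace 𝓘(ℝ, V) x) :
    α.pullback g x v = α (g x) (fun i => mfderiv 𝓘(ℝ, V) 𝓘(ℝ, V') g x (v i)) := rfl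

/-- A form is smooth at a point if its expression in the preferred chart is. -/
def DiffForm.SmoothAt (α : DiffForm V X k) (x : X) : Prop :=
  ContDiffAt ℝ ∞ (α.inChart (chartAt V x)) (chartAt V x x)

theorem DiffForm.congr_base (α : DiffForm V X k) {x x' : X} (h : x = x') (v : Fin k → V) :
    α x v = α x' v := by
  subst h
  rfl

theorem DiffForm.localForm_congr {g g' : Z → X} {z : Z} (h : g =ᶠ[𝓝 z] g')
    (α : DiffForm V X k) : α.localForm g z = α.localForm g' z := by
  ext v
  rw [α.localForm_apply, α.localForm_apply, h.mfderiv_eq]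
  exact α.congr_base h.eq_of_nhds _

theorem DiffForm.localForm_pullback {g : Z → X} {f : X → Y} {z : Z} (α : DiffForm V' Y k)
    (hf : MDifferentiableAt 𝓘(ℝ, V) 𝓘(ℝ, V') f (g z))
    (hg : MDifferentiableAt 𝓘(ℝ, Z) 𝓘(ℝ, V) g z) :
    (α.pullback (V := V) f).localForm g z = α.localForm (f ∘ g) z := by
  ext v
  rw [localForm_apply, localForm_apply, pullback_apply, mfderiv_comp z hf hg]
  rfl

theorem DiffForm.localForm_comp {Z' : Type*} [NormedAddCommGroup Z'] [NormedSpace ℝ Z']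
    {g : Z → Z'} {f : Z' → X} {z : Z} (α : DiffForm V X k)
    (hf : MDifferentiableAt 𝓘(ℝ, Z') 𝓘(ℝ, V) f (g z))
    (hg : DifferentiableAt ℝ g z) :
    α.localForm (f ∘ g) z = (α.localForm f (g z)).compContinuousLinearMap (fderiv ℝ g z) := by
  ext v
  rw [localForm_apply, mfderiv_comp z hf hg.mdifferentiableAt, mfderiv_eq_fderiv]
  rfl

theorem DiffForm.inChart_eq_localForm (α : DiffForm V X k) (e : OpenPartialHomeomorph X V) :
    α.inChart e = α.localForm e.symm := rfl

variable [IsManifold 𝓘(ℝ, V) ∞ X]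

variable (V X) in
theorem isManifold_one_of_infty : IsManifold 𝓘(ℝ, V) 1 X := IsManifold.of_le (n := ∞) (by simp)

/-- Smoothness of order ∞ at a point yields a neighbourhood only for each finite order, and this
neighbourhood may depend on the order; hence the natural number m. -/
theorem eventually_contMDiffAt {g : Z → X} {z : Z} {m : ℕ}
    (hg : ContMDiffAt 𝓘(ℝ, Z) 𝓘(ℝ, V) ∞ g z) :
    ∀ᶠ z' in 𝓝 z, ContMDiffAt 𝓘(ℝ, Z) 𝓘(ℝ, V) m g z' := by
  have : IsManifold 𝓘(ℝ, V) m X := IsManifold.of_le (n := ∞) (by exact_mod_cast le_top)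
  exact (contMDiffAt_iff_contMDiffAt_nhds (by simp)).1 (hg.of_le (by exact_mod_cast le_top))

/-- The expression of a form along a map factors through its expression in a chart. -/
theorem DiffForm.localForm_eventuallyEq {g : Z → X} {z : Z} (α : DiffForm V X k)
    (hg : ContMDiffAt 𝓘(ℝ, Z) 𝓘(ℝ, V) ∞ g z) {x₀ : X} (hx : g z ∈ (chartAt V x₀).source) :
    α.localForm g =ᶠ[𝓝 z] fun z' =>
      (α.inChart (chartAt V x₀) (chartAt V x₀ (g z'))).compContinuousLinearMap
        (fderiv ℝ (chartAt V x₀ ∘ g) z') := by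
  have := isManifold_one_of_infty V X
  have hc := mdifferentiable_chart (I := 𝓘(ℝ, V)) x₀
  have h1 := eventually_contMDiffAt (m := 1) hg
  have h2 : ∀ᶠ z' in 𝓝 z, g z' ∈ (chartAt V x₀).source :=
    hg.continuousAt.eventually ((chartAt V x₀).open_source.mem_nhds hx)
  filter_upwards [h1, h2, h2.eventually_nhds] with z' h1 h2 h3
  have hg' : MDifferentiableAt 𝓘(ℝ, Z) 𝓘(ℝ, V) g z' := h1.mdifferentiableAt (by simp)
  have h4 : g =ᶠ[𝓝 z'] (chartAt V x₀).symm ∘ (chartAt V x₀ ∘ g) := by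
    filter_upwards [h3] with y hy
    exact ((chartAt V x₀).left_inv hy).symm
  rw [α.localForm_congr h4, DiffForm.localForm_comp]
  · rfl
  · exact hc.mdifferentiableAt_symm ((chartAt V x₀).map_source h2)
  · exact ((hc.mdifferentiableAt h2).comp z' hg').differentiableAt

theorem contDiffAt_chart_comp {g : Z → X} {z : Z}
    (hg : ContMDiffAt 𝓘(ℝ, Z) 𝓘(ℝ, V) ∞ g z) {x₀ : X} (hx : g z ∈ (chartAt V x₀).source) :
    ContDiffAt ℝ ∞ (chartAt V x₀ ∘ g) z := by
  have h := (contMDiffOn_chart (I := 𝓘(ℝ, V)) (n := ∞) (x := x₀)).contMDiffAt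
    ((chartAt V x₀).open_source.mem_nhds hx)
  exact (h.comp z hg).contDiffAt

theorem forms_basis_injective {ι : Type*} (b : Module.Basis ι ℝ V) :
    Function.Injective
      (fun (ζ : V [⋀^Fin k]→L[ℝ] ℝ) (I : Fin k → ι) => ζ (fun i => b (I i))) := by
  intro ζ ζ' h
  apply ContinuousAlternatingMap.toContinuousMultilinearMap_injective
  apply ContinuousMultilinearMap.toMultilinearMap_injective
  exact Module.Basis.ext_multilinear (fun _ => b) fun I => congr_fun h I

instance [FiniteDimensional ℝ V] : FiniteDimensional ℝ (V [⋀^Fin k]→L[ℝ] ℝ) := by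
  let b := Module.finBasis ℝ V
  let J : (V [⋀^Fin k]→L[ℝ] ℝ) →ₗ[ℝ] (Fin k → Fin (Module.finrank ℝ V)) → ℝ :=
    { toFun := fun ζ I => ζ (fun i => b (I i))
      map_add' := fun _ _ => rfl
      map_smul' := fun _ _ => rfl }
  exact FiniteDimensional.of_injective J (forms_basis_injective b)

/-- A form is determined by its values on basis vectors, which embeds the forms linearly into a
finite power of ℝ. A linear left inverse of this embedding is continuous, so smoothness can be
tested on values. -/
theorem contDiffAt_of_forall_apply [FiniteDimensional ℝ V] {f : Z → V [⋀^Fin k]→L[ℝ] ℝ} {z : Z}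
    (hf : ∀ v : Fin k → V, ContDiffAt ℝ ∞ (fun x => f x v) z) : ContDiffAt ℝ ∞ f z := by
  let b := Module.finBasis ℝ V
  let J : (V [⋀^Fin k]→L[ℝ] ℝ) →ₗ[ℝ] (Fin k → Fin (Module.finrank ℝ V)) → ℝ :=
    { toFun := fun ζ I => ζ (fun i => b (I i))
      map_add' := fun _ _ => rfl
      map_smul' := fun _ _ => rfl }
  obtain ⟨g, hg⟩ := J.exists_leftInverse_of_injective
    (LinearMap.ker_eq_bot_of_injective (forms_basis_injective b))
  have h1 : f = fun x => (LinearMap.toContinuousLinearMap g) (J (f x)) := by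
    funext x
    exact (LinearMap.congr_fun hg (f x)).symm
  rw [h1]
  exact (LinearMap.toContinuousLinearMap g).contDiff.contDiffAt.comp z
    (contDiffAt_pi.2 fun I => hf _)

theorem contDiffAt_form_apply {f : Z → V [⋀^Fin k]→L[ℝ] ℝ} {v : Fin k → Z → V} {z : Z}
    (hf : ContDiffAt ℝ ∞ f z) (hv : ∀ i, ContDiffAt ℝ ∞ (v i) z) :
    ContDiffAt ℝ ∞ (fun x => f x (fun i => v i x)) z :=
  contDiff_form_apply.contDiffAt.comp z (hf.prodMk (contDiffAt_pi.2 hv))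

theorem contDiffAt_compContinuousLinearMap [FiniteDimensional ℝ Z]
    {f : Z → V [⋀^Fin k]→L[ℝ] ℝ} {T : Z → Z →L[ℝ] V} {z : Z}
    (hf : ContDiffAt ℝ ∞ f z) (hT : ContDiffAt ℝ ∞ T z) :
    ContDiffAt ℝ ∞ (fun x => (f x).compContinuousLinearMap (T x)) z :=
  contDiffAt_of_forall_apply fun v =>
    contDiffAt_form_apply (v := fun i x => T x (v i)) hf fun _ => hT.clm_apply contDiffAt_const

theorem DiffForm.smoothAt_of_forall_apply [FiniteDimensional ℝ V] {α : DiffForm V X k} {x : X}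
    (hα : ∀ v : Fin k → V, ContDiffAt ℝ ∞ (fun u => α.inChart (chartAt V x) u v) (chartAt V x x)) :
    α.SmoothAt x :=
  contDiffAt_of_forall_apply hα

theorem DiffForm.contDiffAt_localForm [FiniteDimensional ℝ Z] {g : Z → X} {z : Z}
    {α : DiffForm V X k} (hα : α.SmoothAt (g z)) (hg : ContMDiffAt 𝓘(ℝ, Z) 𝓘(ℝ, V) ∞ g z) :
    ContDiffAt ℝ ∞ (α.localForm g) z := by
  have hx := mem_chart_source V (g z)
  have hc := contDiffAt_chart_comp hg hx
  refine ContDiffAt.congr_of_eventuallyEq ?_ (α.localForm_eventuallyEq hg hx)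
  refine contDiffAt_compContinuousLinearMap ?_ (hc.fderiv_right (by simp))
  exact ContDiffAt.comp (f := chartAt V (g z) ∘ g) z hα hc

/-- Near z the form along g is the pullback of a chart expression by the map `chartAt V (g z) ∘ g`
between normed spaces, where `extDeriv` is natural. Taking for g an inverse chart shows that d may
be computed in any chart, not only in the preferred chart of each point. -/
theorem DiffForm.extDeriv_localForm [FiniteDimensional ℝ Z] {g : Z → X} {z : Z}
    {α : DiffForm V X k} (hα : α.SmoothAt (g z)) (hg : ContMDiffAt 𝓘(ℝ, Z) 𝓘(ℝ, V) ∞ g z) :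
    extDeriv (α.localForm g) z = α.d.localForm g z := by
  have := isManifold_one_of_infty V X
  have hx := mem_chart_source V (g z)
  have hc := contDiffAt_chart_comp hg hx
  have hα' : DifferentiableAt ℝ (α.inChart (chartAt V (g z))) ((chartAt V (g z) ∘ g) z) :=
    ContDiffAt.differentiableAt hα (by simp)
  rw [(α.localForm_eventuallyEq hg hx).extDeriv_eq]
  refine (extDeriv_pullback (r := ∞) hα' hc (by
    simpa using WithTop.coe_le_coe.2 (le_top (a := (2 : ℕ∞))))).trans ?_
  ext v
  have hm := mfderiv_comp z ((mdifferentiable_chart (I := 𝓘(ℝ, V)) (g z)).mdifferentiableAt hx)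
    (hg.mdifferentiableAt (by simp))
  rw [mfderiv_eq_fderiv] at hm
  rw [hm]
  rfl

variable [IsManifold 𝓘(ℝ, V') ∞ Y]

theorem contMDiffAt_chart_symm (x : X) :
    ContMDiffAt 𝓘(ℝ, V) 𝓘(ℝ, V) ∞ (chartAt V x).symm (chartAt V x x) :=
  (contMDiffOn_chart_symm (I := 𝓘(ℝ, V)) (n := ∞) (x := x)).contMDiffAt
    ((chartAt V x).open_target.mem_nhds (mem_chart_target V x))

theorem DiffForm.localForm_pullback_eventuallyEq {g : Z → X} {f : X → Y} {z : Z}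
    (α : DiffForm V' Y k)
    (hf : ContMDiffAt 𝓘(ℝ, V) 𝓘(ℝ, V') ∞ f (g z)) (hg : ContMDiffAt 𝓘(ℝ, Z) 𝓘(ℝ, V) ∞ g z) :
    (α.pullback (V := V) f).localForm g =ᶠ[𝓝 z] α.localForm (f ∘ g) := by
  have := isManifold_one_of_infty V X
  have := isManifold_one_of_infty V' Y
  have h1 : ∀ᶠ x in 𝓝 (g z), ContMDiffAt 𝓘(ℝ, V) 𝓘(ℝ, V') 1 f x :=
    (contMDiffAt_iff_contMDiffAt_nhds (by simp)).1 (hf.of_le (by simp))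
  filter_upwards [hg.continuousAt.eventually h1, eventually_contMDiffAt (m := 1) hg] with z' h1 h2
  exact localForm_pullback α (h1.mdifferentiableAt (by simp)) (h2.mdifferentiableAt (by simp))

theorem DiffForm.SmoothAt.pullback [FiniteDimensional ℝ V] {f : X → Y} {x : X}
    {α : DiffForm V' Y k} (hα : α.SmoothAt (f x)) (hf : ContMDiffAt 𝓘(ℝ, V) 𝓘(ℝ, V') ∞ f x) :
    (α.pullback (V := V) f).SmoothAt x := by
  have hs := contMDiffAt_chart_symm (V := V) x
  have hl := (chartAt V x).left_inv (mem_chart_source V x)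
  have hf' : ContMDiffAt 𝓘(ℝ, V) 𝓘(ℝ, V') ∞ f ((chartAt V x).symm (chartAt V x x)) := by rwa [hl]
  refine ContDiffAt.congr_of_eventuallyEq ?_ (localForm_pullback_eventuallyEq α hf' hs)
  refine contDiffAt_localForm ?_ (hf'.comp _ hs)
  rwa [Function.comp_apply, hl]

/-- Both sides are read through the inverse chart at x, where `extDeriv_localForm` applies to the
composite of f with that inverse chart. -/
theorem DiffForm.d_pullback [FiniteDimensional ℝ V] {f : X → Y} {x : X}
    {α : DiffForm V' Y k} (hα : α.SmoothAt (f x)) (hf : ContMDiffAt 𝓘(ℝ, V) 𝓘(ℝ, V') ∞ f x)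
    (v : Fin (k + 1) → TangentSpace 𝓘(ℝ, V) x) :
    (α.pullback (V := V) f).d x v = α.d (f x) (fun i => mfderiv 𝓘(ℝ, V) 𝓘(ℝ, V') f x (v i)) := by
  have := isManifold_one_of_infty V X
  have hs := contMDiffAt_chart_symm (V := V) x
  have hx := mem_chart_source V x
  have hl := (chartAt V x).left_inv hx
  have hf' : ContMDiffAt 𝓘(ℝ, V) 𝓘(ℝ, V') ∞ f ((chartAt V x).symm (chartAt V x x)) := by rwa [hl]
  have h1 : extDeriv ((α.pullback (V := V) f).inChart (chartAt V x)) (chartAt V x x) =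
      α.d.localForm (f ∘ (chartAt V x).symm) (chartAt V x x) := by
    rw [← extDeriv_localForm (by rwa [Function.comp_apply, hl]) (hf'.comp _ hs)]
    exact (localForm_pullback_eventuallyEq α hf' hs).extDeriv_eq
  have h2 : f =ᶠ[𝓝 x] (f ∘ (chartAt V x).symm) ∘ chartAt V x := by
    filter_upwards [(chartAt V x).open_source.mem_nhds hx] with y hy
    simp [(chartAt V x).left_inv hy]
  rw [h2.mfderiv_eq, mfderiv_comp x ((hf'.comp _ hs).mdifferentiableAt (by simp))
    ((mdifferentiable_chart (I := 𝓘(ℝ, V)) x).mdifferentiableAt hx)]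
  change extDeriv ((α.pullback (V := V) f).inChart (chartAt V x)) (chartAt V x x) _ = _
  rw [h1]
  exact α.d.congr_base (congrArg f hl) _

end LocalForms

/-! ### Forms of top degree -/

section TopForms

variable {W W' : Type*} [AddCommGroup W] [Module ℝ W] [TopologicalSpace W]
  [AddCommGroup W'] [Module ℝ W'] [TopologicalSpace W'] {n : ℕ}

theorem top_form_apply (b : Module.Basis (Fin n) ℝ W) (α : W [⋀^Fin n]→L[ℝ] ℝ) (v : Fin n → W) :
    α v = α b * b.det v := by
  have := DFunLike.congr_fun (AlternatingMap.eq_smul_basis_det b α.toAlternatingMap) v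
  simpa using this

/-- Forms of top degree are proportional, so the ratio of two of them does not depend on the frame
on which it is evaluated. This makes the integrand of `VolumeForm.integral` computable in any chart.
-/
theorem top_form_mul (b : Module.Basis (Fin n) ℝ W) (α α' : W [⋀^Fin n]→L[ℝ] ℝ)
    (v w : Fin n → W) : α v * α' w = α w * α' v := by
  rw [top_form_apply b α v, top_form_apply b α w, top_form_apply b α' v, top_form_apply b α' w]
  ring

theorem top_form_ne_zero (b : Module.Basis (Fin n) ℝ W) {α : W [⋀^Fin n]→L[ℝ] ℝ} (hα : α ≠ 0) :
    α b ≠ 0 := by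
  intro h
  apply hα
  ext v
  rw [top_form_apply b, h, zero_mul]
  rfl

/-- More vectors than the dimension are linearly dependent. This settles the field equation in the
directions tangent to a section. -/
theorem form_eq_zero_of_finrank_lt (b : Module.Basis (Fin n) ℝ W) (α : W [⋀^Fin (n + 1)]→L[ℝ] ℝ)
    (v : Fin (n + 1) → W) : α v = 0 := by
  refine α.toAlternatingMap.map_linearDependent v fun h => ?_
  have := Module.Finite.of_basis b
  have h1 := h.fintype_card_le_finrank
  rw [Module.finrank_eq_card_basis b] at h1
  simp at h1

/-- The top exterior power is a line, so the normalisation determines Γ: it behaves as `b₁ ∧ … ∧ bₙ`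
divided by `vol b`. Contractions with the image of Γ thereby become evaluations on a frame. -/
theorem contract_map (b : Module.Basis (Fin n) ℝ W) {Γ : ⋀[ℝ]^n W} {vol : W [⋀^Fin n]→L[ℝ] ℝ}
    (hΓ : pairing Γ vol = 1) (L : W →ₗ[ℝ] W') (Ω : W' [⋀^Fin (n + 1)]→L[ℝ] ℝ) (w : W') :
    contract (exteriorPower.map n L Γ) Ω w =
      Ω (Fin.snoc (α := fun _ => W') (fun i => L (b i)) w) / vol b := by
  -- Since f = f(b) · det_b, every functional on the top power is a multiple of the pairing with
  -- det_b; applied to vol, this fixes the value of that pairing on Γ.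
  have key : ∀ f : W [⋀^Fin n]→ₗ[ℝ] ℝ, exteriorPower.alternatingMapLinearEquiv f Γ =
      f b * exteriorPower.alternatingMapLinearEquiv b.det Γ := by
    intro f
    conv_lhs => rw [AlternatingMap.eq_smul_basis_det b f]
    simp
  have h1 : contract (exteriorPower.map n L Γ) Ω w =
      exteriorPower.alternatingMapLinearEquiv ((fillLast Ω w).compLinearMap L) Γ := by
    have : (exteriorPower.alternatingMapLinearEquiv (fillLast Ω w)).comp (exteriorPower.map n L) =
        exteriorPower.alternatingMapLinearEquiv ((fillLast Ω w).compLinearMap L) := by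
      apply exteriorPower.linearMap_ext
      ext v
      simp
      rfl
    exact LinearMap.congr_fun this Γ
  have h2 : vol b * exteriorPower.alternatingMapLinearEquiv b.det Γ = 1 := by
    rw [← hΓ]
    exact (key vol.toAlternatingMap).symm
  have h3 : vol b ≠ 0 := left_ne_zero_of_mul_eq_one h2
  rw [h1, key, eq_div_iff h3, mul_assoc, mul_comm _ (vol b), h2, mul_one]
  rfl

/-- Moving the last argument of a form to the front. -/
theorem form_snoc_eq_cons (α : W [⋀^Fin (n + 1)]→L[ℝ] ℝ) (v : Fin n → W) (w : W) :
    α (Fin.snoc (α := fun _ => W) v w) = (-1) ^ n * α (Matrix.vecCons w v) := by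
  -- The cyclic rotation of n + 1 letters carries the first argument to the last place and has sign
  -- (-1)ⁿ.
  have h := α.toAlternatingMap.map_perm (Matrix.vecCons w v) (finRotate (n + 1))
  have h1 : (Matrix.vecCons w v ∘ finRotate (n + 1)) = Fin.snoc (α := fun _ => W) v w := by
    funext i
    refine Fin.lastCases ?_ (fun j => ?_) i
    · simp
    · simp
  rw [h1, sign_finRotate] at h
  simpa [Units.smul_def] using h

end TopForms

/-- The standard basis of `ℝⁿ`. -/
def stdBasis (n : ℕ) : Module.Basis (Fin n) ℝ (EuclideanSpace ℝ (Fin n)) :=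
  (EuclideanSpace.basisFun (Fin n) ℝ).toBasis

theorem coe_stdBasis (n : ℕ) : ⇑(stdBasis n) = stdFrame n := by
  funext i
  simp [stdBasis, stdFrame]

/-! ### Maps through a factor of a product model space -/

section Products

variable {W F V X : Type*} [NormedAddCommGroup W] [NormedSpace ℝ W]
  [NormedAddCommGroup F] [NormedSpace ℝ F] [NormedAddCommGroup V] [NormedSpace ℝ V]
  [TopologicalSpace X] [ChartedSpace V X]

theorem mfderiv_comp_fst {f : W → X} {u : W × F}
    (hf : MDifferentiableAt 𝓘(ℝ, W) 𝓘(ℝ, V) f u.1) (v : W × F) :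
    mfderiv 𝓘(ℝ, W × F) 𝓘(ℝ, V) (fun p : W × F => f p.1) u v =
      mfderiv 𝓘(ℝ, W) 𝓘(ℝ, V) f u.1 v.1 := by
  have h := hf.hasMFDerivAt.comp u (ContinuousLinearMap.fst ℝ W F).hasMFDerivAt
  exact DFunLike.congr_fun h.mfderiv v

theorem ContMDiffOn.fst_model {f : X → W × F} {s : Set X}
    (hf : ContMDiffOn 𝓘(ℝ, V) 𝓘(ℝ, W × F) ∞ f s) :
    ContMDiffOn 𝓘(ℝ, V) 𝓘(ℝ, W) ∞ (fun x => (f x).1) s :=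
  (ContinuousLinearMap.fst ℝ W F).contMDiff.comp_contMDiffOn hf

theorem contDiff_coe_form_snd_apply {n : ℕ} {p : Submodule ℝ (V [⋀^Fin n]→L[ℝ] ℝ)}
    (v : Fin n → V) : ContDiff ℝ ∞ (fun u : W × p => u.2.1 v) :=
  contDiff_form_apply.comp ((contDiff_coe_form.comp contDiff_snd).prodMk contDiff_const)

end Products

/-! ### Smoothness of the maps between the multiphase spaces -/

section BundleMaps

variable {A B G : Type*} [NormedAddCommGroup A] [NormedSpace ℝ A]
  [NormedAddCommGroup B] [NormedSpace ℝ B]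
  [NormedAddCommGroup G] [NormedSpace ℝ G]
  {S Q E : Type*} [TopologicalSpace S] [ChartedSpace A S]
  [TopologicalSpace Q] [ChartedSpace B Q] [TopologicalSpace E] [ChartedSpace G E]
  {π : SmoothFibreBundle A B G S Q E} {n : ℕ}

namespace AdaptedChart

/-- A bundle is not required to have a smooth projection; in adapted coordinates it is (x, q) ↦ x,
which is smooth. -/
theorem contMDiffOn_proj (c : AdaptedChart π) :
    ContMDiffOn 𝓘(ℝ, G) 𝓘(ℝ, A) ∞ π.proj c.chart.source := by
  have h1 : ContMDiffOn 𝓘(ℝ, G) 𝓘(ℝ, A) ∞ (fun z => (c.chart z).1) c.chart.source :=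
    (ContinuousLinearMap.fst ℝ A B).contMDiff.comp_contMDiffOn c.contMDiffOn_chart
  refine (c.contMDiffOn_baseChart_symm.comp h1 fun z hz => c.fst_mem (c.chart.map_source hz)).congr
    fun z hz => ?_
  exact (c.baseChart_symm_fst hz).symm

variable [FiniteDimensional ℝ A] [FiniteDimensional ℝ B]
  [IsManifold 𝓘(ℝ, A) ∞ S] [IsManifold 𝓘(ℝ, B) ∞ Q]

variable (n) in
/-- The coordinates on `M(π)` induced by adapted coordinates, as a chart. -/
def multiphaseHomeo (c : AdaptedChart π) :
    OpenPartialHomeomorph (MultiphaseSpace π n) ((A × B) × FibreModel A B n) :=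
  (multiphaseCore π n).openPartialHomeomorph (c.multiphaseChart n) (mem_range_self c)

variable (n) in
/-- The coordinates on `P(π)` induced by adapted coordinates, as a chart. -/
def restrictedHomeo (c : AdaptedChart π) :
    OpenPartialHomeomorph (RestrictedMultiphaseSpace π n) ((A × B) × RestrictedFibreModel A B n) :=
  (restrictedCore π n).openPartialHomeomorph (c.restrictedChart n) (mem_range_self c)

theorem multiphaseHomeo_mem_atlas (c : AdaptedChart π) :
    c.multiphaseHomeo n ∈ atlas ((A × B) × FibreModel A B n) (MultiphaseSpace π n) :=
  mem_iUnion₂.2 ⟨_, mem_range_self c, rfl⟩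

theorem restrictedHomeo_mem_atlas (c : AdaptedChart π) :
    c.restrictedHomeo n ∈
      atlas ((A × B) × RestrictedFibreModel A B n) (RestrictedMultiphaseSpace π n) :=
  mem_iUnion₂.2 ⟨_, mem_range_self c, rfl⟩

theorem contMDiffOn_multiphaseHomeo (c : AdaptedChart π) :
    ContMDiffOn 𝓘(ℝ, (A × B) × FibreModel A B n) 𝓘(ℝ, (A × B) × FibreModel A B n) ∞
      (c.multiphaseHomeo n) (c.multiphaseHomeo n).source :=
  contMDiffOn_of_mem_maximalAtlas
    (IsManifold.subset_maximalAtlas c.multiphaseHomeo_mem_atlas)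

theorem contMDiffOn_multiphaseHomeo_symm (c : AdaptedChart π) :
    ContMDiffOn 𝓘(ℝ, (A × B) × FibreModel A B n) 𝓘(ℝ, (A × B) × FibreModel A B n) ∞
      (c.multiphaseHomeo n).symm (c.multiphaseHomeo n).target :=
  contMDiffOn_symm_of_mem_maximalAtlas
    (IsManifold.subset_maximalAtlas c.multiphaseHomeo_mem_atlas)

theorem contMDiffOn_restrictedHomeo (c : AdaptedChart π) :
    ContMDiffOn 𝓘(ℝ, (A × B) × RestrictedFibreModel A B n)
      𝓘(ℝ, (A × B) × RestrictedFibreModel A B n) ∞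
      (c.restrictedHomeo n) (c.restrictedHomeo n).source :=
  contMDiffOn_of_mem_maximalAtlas
    (IsManifold.subset_maximalAtlas c.restrictedHomeo_mem_atlas)

theorem contMDiffOn_restrictedHomeo_symm (c : AdaptedChart π) :
    ContMDiffOn 𝓘(ℝ, (A × B) × RestrictedFibreModel A B n)
      𝓘(ℝ, (A × B) × RestrictedFibreModel A B n) ∞
      (c.restrictedHomeo n).symm (c.restrictedHomeo n).target :=
  contMDiffOn_symm_of_mem_maximalAtlas
    (IsManifold.subset_maximalAtlas c.restrictedHomeo_mem_atlas)

end AdaptedChart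

variable [FiniteDimensional ℝ A] [FiniteDimensional ℝ B]
  [IsManifold 𝓘(ℝ, A) ∞ S] [IsManifold 𝓘(ℝ, B) ∞ Q]

theorem contMDiff_proj : ContMDiff 𝓘(ℝ, G) 𝓘(ℝ, A) ∞ π.proj := fun y =>
  (adaptedChartAt π y).contMDiffOn_proj.contMDiffAt
    ((adaptedChartAt π y).chart.open_source.mem_nhds (mem_adaptedChartAt π y))

theorem contMDiff_multiphase_pt :
    ContMDiff 𝓘(ℝ, (A × B) × FibreModel A B n) 𝓘(ℝ, G) ∞
      (MultiphaseSpace.pt : MultiphaseSpace π n → E) := by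
  intro m
  let c := adaptedChartAt π m.pt
  have hm : m ∈ (c.multiphaseHomeo n).source := mem_adaptedChartAt π m.pt
  have h1 := ContMDiffOn.fst_model (c.contMDiffOn_multiphaseHomeo (n := n))
  refine ContMDiffOn.contMDiffAt ?_ ((c.multiphaseHomeo n).open_source.mem_nhds hm)
  refine (c.contMDiffOn_chart_symm.comp h1 fun z hz => c.chart.map_source hz).congr fun z hz => ?_
  exact (c.chart.left_inv hz).symm

theorem contMDiff_restricted_pt :
    ContMDiff 𝓘(ℝ, (A × B) × RestrictedFibreModel A B n) 𝓘(ℝ, G) ∞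
      (RestrictedMultiphaseSpace.pt : RestrictedMultiphaseSpace π n → E) := by
  intro m
  let c := adaptedChartAt π m.pt
  have hm : m ∈ (c.restrictedHomeo n).source := mem_adaptedChartAt π m.pt
  have h1 := ContMDiffOn.fst_model (c.contMDiffOn_restrictedHomeo (n := n))
  refine ContMDiffOn.contMDiffAt ?_ ((c.restrictedHomeo n).open_source.mem_nhds hm)
  refine (c.contMDiffOn_chart_symm.comp h1 fun z hz => c.chart.map_source hz).congr fun z hz => ?_
  exact (c.chart.left_inv hz).symm

theorem contMDiff_tau :
    ContMDiff 𝓘(ℝ, (A × B) × RestrictedFibreModel A B n) 𝓘(ℝ, A) ∞ (tau π n) :=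
  contMDiff_proj.comp contMDiff_restricted_pt

theorem contDiff_dropHorizontalAux :
    ContDiff ℝ ∞ (dropHorizontalAux : FibreModel A B n → RestrictedFibreModel A B n) := by
  rw [← contDiffOn_univ]
  refine contDiffOn_of_forall_apply fun v => ContDiff.contDiffOn ?_
  have h : ∀ v : Fin n → A × B, ContDiff ℝ ∞ fun ζ : FibreModel A B n => ζ.1 v := fun v =>
    contDiff_form_apply.comp (contDiff_coe_form.prodMk contDiff_const)
  exact (h v).sub (h _)

/-- In the charts of M(π) and P(π) induced by the same adapted chart, μ is the identity times the
linear map `dropHorizontalAux`. -/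
theorem contMDiff_mu :
    ContMDiff 𝓘(ℝ, (A × B) × FibreModel A B n) 𝓘(ℝ, (A × B) × RestrictedFibreModel A B n) ∞
      (mu π n) := by
  intro m
  let c := adaptedChartAt π m.pt
  have hm : m ∈ (c.multiphaseHomeo n).source := mem_adaptedChartAt π m.pt
  have h0 : ContDiff ℝ ∞ (fun u : (A × B) × FibreModel A B n => (u.1, dropHorizontalAux u.2)) :=
    contDiff_fst.prodMk (contDiff_dropHorizontalAux.comp contDiff_snd)
  have h1 := h0.contMDiff.comp_contMDiffOn (c.contMDiffOn_multiphaseHomeo (n := n))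
  refine ContMDiffOn.contMDiffAt ?_ ((c.multiphaseHomeo n).open_source.mem_nhds hm)
  have h2 : ∀ z ∈ (c.multiphaseHomeo n).source, c.restrictedHomeo n (mu π n z) =
      ((c.multiphaseHomeo n z).1, dropHorizontalAux (c.multiphaseHomeo n z).2) := by
    intro z hz
    refine (c.restrictedChart_apply n (m := mu π n z) hz).trans ?_
    have := c.multiphaseChart_apply n (m := z) hz
    change c.multiphaseHomeo n z = _ at this
    rw [this]
    rfl
  refine (c.contMDiffOn_restrictedHomeo_symm.comp h1 fun z hz => ?_).congr fun z hz => ?_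
  · exact ⟨c.chart.map_source hz, mem_univ _⟩
  · rw [Function.comp_apply, Function.comp_apply, ← h2 z hz]
    exact ((c.restrictedHomeo n).left_inv (x := mu π n z) hz).symm

/-- Points over distinct points of E are separated in E, and points over the same point lie in a
common chart. The Hausdorff property makes compact sets closed, which is what allows flows supported
in a chart to be extended by the identity. -/
instance [T2Space E] : T2Space (RestrictedMultiphaseSpace π n) := by
  refine ⟨fun z z' hne => ?_⟩
  by_cases h : z.pt = z'.pt
  · let c := (adaptedChartAt π z.pt).restrictedHomeo n
    have hz : z ∈ c.source := mem_adaptedChartAt π z.pt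
    have hz' : z' ∈ c.source := by
      change z'.pt ∈ (adaptedChartAt π z.pt).chart.source
      rw [← h]
      exact mem_adaptedChartAt π z.pt
    obtain ⟨u, v, hu, hv, hzu, hzv, huv⟩ := t2_separation (c.injOn.ne hz hz' hne)
    exact ⟨c.source ∩ c ⁻¹' u, c.source ∩ c ⁻¹' v, c.isOpen_inter_preimage hu,
      c.isOpen_inter_preimage hv, ⟨hz, hzu⟩, ⟨hz', hzv⟩,
      (huv.preimage c).mono inter_subset_right inter_subset_right⟩
  · obtain ⟨u, v, hu, hv, hzu, hzv, huv⟩ := t2_separation h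
    have hc : Continuous (RestrictedMultiphaseSpace.pt : RestrictedMultiphaseSpace π n → E) :=
      contMDiff_restricted_pt.continuous
    exact ⟨_, _, hu.preimage hc, hv.preimage hc, hzu, hzv, huv.preimage _⟩

theorem MultiphaseSpace.cov_congr {m m' : MultiphaseSpace π n} (h : m = m') (v : Fin n → G) :
    m.cov.1 v = m'.cov.1 v := by
  subst h
  rfl

theorem theta_apply (m : MultiphaseSpace π n)
    (v : Fin n → TangentSpace 𝓘(ℝ, (A × B) × FibreModel A B n) m) :
    theta π n m v = m.cov.1 (fun i =>
      mfderiv 𝓘(ℝ, (A × B) × FibreModel A B n) 𝓘(ℝ, G) MultiphaseSpace.pt m (v i)) := rfl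

/-- The coordinate expression of the canonical form is tautological. -/
theorem theta_inChart (c : AdaptedChart π) {u : (A × B) × FibreModel A B n}
    (hu : u ∈ (c.multiphaseHomeo n).target) :
    (theta π n).inChart (c.multiphaseHomeo n) u =
      u.2.1.compContinuousLinearMap (ContinuousLinearMap.fst ℝ (A × B) (FibreModel A B n)) := by
  have hu1 : u.1 ∈ c.chart.target := hu.1
  have hs := (c.contMDiffOn_multiphaseHomeo_symm (n := n)).contMDiffAt
    ((c.multiphaseHomeo n).open_target.mem_nhds hu)
  have hpt : MultiphaseSpace.pt ∘ (c.multiphaseHomeo n).symm =ᶠ[𝓝 u]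
      fun u => c.chart.symm u.1 := by
    filter_upwards [(c.multiphaseHomeo n).open_target.mem_nhds hu] with u' hu'
    exact congrArg MultiphaseSpace.pt (c.multiphaseChart_symm_apply n (u := u') hu'.1)
  have h1 := mfderiv_comp u ((contMDiff_multiphase_pt (π := π) (n := n)
    ((c.multiphaseHomeo n).symm u)).mdifferentiableAt (by simp)) (hs.mdifferentiableAt (by simp))
  rw [hpt.mfderiv_eq] at h1
  ext v
  have h3 := MultiphaseSpace.cov_congr (c.multiphaseChart_symm_apply n (u := u) hu1)
    (fun i => mfderiv 𝓘(ℝ, (A × B) × FibreModel A B n) 𝓘(ℝ, G) MultiphaseSpace.pt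
      ((c.multiphaseHomeo n).symm u)
      (mfderiv 𝓘(ℝ, (A × B) × FibreModel A B n) 𝓘(ℝ, (A × B) × FibreModel A B n)
        (c.multiphaseHomeo n).symm u (v i)))
  refine Eq.trans h3 ?_
  change u.2.1 (fun i => c.deriv (c.chart.symm u.1) _) = u.2.1 (fun i => (v i).1)
  congr 1
  funext i
  -- In coordinates `pt` is `c.chart.symm` after the first projection, so its derivative cancels
  -- against the factor `c.deriv` in the coordinate expression of the covector.
  have h4 := DFunLike.congr_fun h1 (v i)
  have h5 := mfderiv_comp_fst (c.mdifferentiable.mdifferentiableAt_symm hu1) (v i)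
  refine (congrArg (c.deriv (c.chart.symm u.1)) (h5.symm.trans h4).symm).trans ?_
  exact DFunLike.congr_fun (c.mdifferentiable.comp_symm_deriv hu1) (v i).1

theorem theta_smoothAt (m : MultiphaseSpace π n) : (theta π n).SmoothAt m := by
  let c := adaptedChartAt π m.pt
  have hm : m ∈ (c.multiphaseHomeo n).source := mem_adaptedChartAt π m.pt
  refine DiffForm.smoothAt_of_forall_apply fun v => ?_
  -- The preferred chart at m is by definition the one induced by c, and there θ is an evaluation of
  -- the fibre coordinate on constant vectors.
  change ContDiffAt ℝ ∞ (fun u => (theta π n).inChart (c.multiphaseHomeo n) u v)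
    (c.multiphaseHomeo n m)
  have h : (fun u => (theta π n).inChart (c.multiphaseHomeo n) u v) =ᶠ[𝓝 (c.multiphaseHomeo n m)]
      fun u => u.2.1 (fun i => (v i).1) := by
    filter_upwards [(c.multiphaseHomeo n).open_target.mem_nhds
      ((c.multiphaseHomeo n).map_source hm)] with u hu
    rw [theta_inChart c hu]
    rfl
  refine ContDiffAt.congr_of_eventuallyEq ?_ h
  exact (contDiff_coe_form_snd_apply _).contDiffAt

end BundleMaps

/-! ### The exterior derivative of a decomposed form -/

section Decomposition

/-- The Leibniz rule d(fζ) = df ∧ ζ + f dζ at a zero of f: the second term drops out and ζ is never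
differentiated. -/
theorem extDeriv_fun_smul_of_eq_zero {V : Type*} [NormedAddCommGroup V] [NormedSpace ℝ V] {k : ℕ}
    {f : V → ℝ} {ζ : V → V [⋀^Fin k]→L[ℝ] ℝ} {x : V} (hf : DifferentiableAt ℝ f x)
    (hζ : DifferentiableAt ℝ ζ x) (h0 : f x = 0) (v : Fin (k + 1) → V) :
    extDeriv (fun y => f y • ζ y) x v =
      ∑ i, (-1) ^ i.val * (fderiv ℝ f x (v i) * ζ x (i.removeNth v)) := by
  rw [extDeriv_apply (show DifferentiableAt ℝ (fun y => f y • ζ y) x from hf.smul hζ)]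
  refine Finset.sum_congr rfl fun i _ => ?_
  have h1 : HasFDerivAt (fun y => f y * ζ y (i.removeNth v)) (ζ x (i.removeNth v) • fderiv ℝ f x) x := by
    have hζ' : DifferentiableAt ℝ (fun y => ζ y (i.removeNth v)) x :=
      hζ.continuousAlternatingMap_apply_const _
    have := hf.hasFDerivAt.mul hζ'.hasFDerivAt
    rwa [h0, zero_smul, zero_add] at this
  have h2 : (fun y => (f y • ζ y) (i.removeNth v)) = fun y => f y * ζ y (i.removeNth v) := rfl
  rw [h2, h1.fderiv]
  simp [zsmul_eq_mul, mul_comm]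

variable {V V' A M P S : Type*} [NormedAddCommGroup V] [NormedSpace ℝ V] [FiniteDimensional ℝ V]
  [NormedAddCommGroup V'] [NormedSpace ℝ V']
  [NormedAddCommGroup A] [NormedSpace ℝ A]
  [TopologicalSpace M] [ChartedSpace V M] [IsManifold 𝓘(ℝ, V) ∞ M]
  [TopologicalSpace P] [ChartedSpace V' P] [IsManifold 𝓘(ℝ, V') ∞ P]
  [TopologicalSpace S] [ChartedSpace A S] [IsManifold 𝓘(ℝ, A) ∞ S] {n : ℕ}

/-- If `θ = μ^* Θ - H p^* vol` and `Ψ` is a section of `p` along which `H` vanishes, then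
`ι_{Ψ_* γ} dθ` and `ι_{Ψ_* γ} μ^* dΘ` differ by `dH`. -/
theorem d_apply_of_decomposition [FiniteDimensional ℝ V'] [FiniteDimensional ℝ A]
    {θ : DiffForm V M n} {Θ : DiffForm V' P n} {vol : DiffForm A S n}
    {μ : M → P} {p : M → S} {H : M → ℝ} {Ψ : S → M} {x : S}
    (hθ : θ.SmoothAt (Ψ x)) (hΘ : Θ.SmoothAt (μ (Ψ x))) (hvol : vol.SmoothAt x)
    (hμ : ContMDiffAt 𝓘(ℝ, V) 𝓘(ℝ, V') ∞ μ (Ψ x)) (hp : ContMDiffAt 𝓘(ℝ, V) 𝓘(ℝ, A) ∞ p (Ψ x))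
    (hΨ : MDifferentiableAt 𝓘(ℝ, A) 𝓘(ℝ, V) Ψ x)
    (hdec : ∀ m (v : Fin n → TangentSpace 𝓘(ℝ, V) m),
      θ m v = Θ.pullback μ m v - H m * vol.pullback p m v)
    (hH : ∀ᶠ y in 𝓝 x, H (Ψ y) = 0) (hsec : ∀ᶠ y in 𝓝 x, p (Ψ y) = y)
    {b : Fin n → TangentSpace 𝓘(ℝ, A) x} (hb : vol x b ≠ 0) (w : TangentSpace 𝓘(ℝ, V) (Ψ x)) :
    θ.d (Ψ x) (Fin.snoc (α := fun _ => V) (fun i => mfderiv 𝓘(ℝ, A) 𝓘(ℝ, V) Ψ x (b i)) w) =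
      Θ.d (μ (Ψ x)) (fun i => mfderiv 𝓘(ℝ, V) 𝓘(ℝ, V') μ (Ψ x)
        (Fin.snoc (α := fun _ => V) (fun i => mfderiv 𝓘(ℝ, A) 𝓘(ℝ, V) Ψ x (b i)) w i)) -
      (-1) ^ n * (differential (V := V) H (Ψ x) w * vol x b) := by
  have := isManifold_one_of_infty V M
  have hpx : p (Ψ x) = x := hsec.self_of_nhds
  set e := chartAt V (Ψ x) with he
  have hx : Ψ x ∈ e.source := mem_chart_source V (Ψ x)
  have hu : e (Ψ x) ∈ e.target := e.map_source hx
  have hed := mdifferentiable_chart (I := 𝓘(ℝ, V)) (Ψ x)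
  have hl : e.symm (e (Ψ x)) = Ψ x := e.left_inv hx
  set L : V →L[ℝ] V := mfderiv 𝓘(ℝ, V) 𝓘(ℝ, V) e (Ψ x) with hL
  set v : Fin n → V := fun i => mfderiv 𝓘(ℝ, A) 𝓘(ℝ, V) Ψ x (b i) with hv
  have hsm1 : (Θ.pullback (V := V) μ).SmoothAt (Ψ x) := hΘ.pullback hμ
  have hsm2 : (vol.pullback (V := V) p).SmoothAt (Ψ x) :=
    DiffForm.SmoothAt.pullback (by rwa [hpx]) hp
  have hα : ContDiffAt ℝ ∞ ((Θ.pullback (V := V) μ).inChart e) (e (Ψ x)) := hsm1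
  have hβ : ContDiffAt ℝ ∞ ((vol.pullback (V := V) p).inChart e) (e (Ψ x)) := hsm2
  have hθ' : ContDiffAt ℝ ∞ (θ.inChart e) (e (Ψ x)) := hθ
  have hdec' : ∀ u (v : Fin n → V), θ.inChart e u v =
      (Θ.pullback (V := V) μ).inChart e u v - H (e.symm u) * (vol.pullback (V := V) p).inChart e u v :=
    fun u v => hdec _ _
  have hLinv : ∀ z : V, mfderiv 𝓘(ℝ, V) 𝓘(ℝ, V) e.symm (e (Ψ x)) (L z) = z := fun z =>
    DFunLike.congr_fun (hed.symm_comp_deriv hx) z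
  -- The chart derivatives cancel, and p_* Ψ_* = id because p ∘ Ψ = id near x.
  have hβb : (vol.pullback (V := V) p).inChart e (e (Ψ x)) (fun i => L (v i)) = vol x b := by
    have h1 : ∀ i, mfderiv 𝓘(ℝ, V) 𝓘(ℝ, A) p (Ψ x) (v i) = b i := by
      intro i
      have h2 := mfderiv_comp x (hp.mdifferentiableAt (by simp)) hΨ
      have h3 : p ∘ Ψ =ᶠ[𝓝 x] id := hsec
      rw [h3.mfderiv_eq, mfderiv_id] at h2
      exact (DFunLike.congr_fun h2 (b i)).symm
    have h4 : (vol.pullback (V := V) p).inChart e (e (Ψ x)) (fun i => L (v i)) =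
        (vol.pullback (V := V) p) (e.symm (e (Ψ x))) v :=
      congrArg ((vol.pullback (V := V) p) (e.symm (e (Ψ x)))) (funext fun i => hLinv (v i))
    rw [h4, DiffForm.congr_base (vol.pullback (V := V) p) hl v]
    exact (DiffForm.congr_base vol hpx _).trans (congrArg (vol x) (funext h1))
  -- Differentiability of H is not among the hypotheses. Evaluated on constant vectors that extend
  -- the frame Ψ_*b, the decomposition can be solved for H: it is (μ^*Θ - θ) / p^*vol, a quotient of
  -- smooth functions with nonvanishing denominator near the point.
  have hHe : DifferentiableAt ℝ (fun u => H (e.symm u)) (e (Ψ x)) := by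
    have hc : ∀ {f : V → V [⋀^Fin n]→L[ℝ] ℝ}, ContDiffAt ℝ ∞ f (e (Ψ x)) →
        ContDiffAt ℝ ∞ (fun u => f u (fun i => L (v i))) (e (Ψ x)) := fun hf =>
      contDiffAt_form_apply hf fun i => contDiffAt_const
    have hne : (vol.pullback (V := V) p).inChart e (e (Ψ x)) (fun i => L (v i)) ≠ 0 := by
      rwa [hβb]
    have h1 := ((hc hα).sub (hc hθ')).div (hc hβ) hne
    refine (ContDiffAt.congr_of_eventuallyEq h1 ?_).differentiableAt (by simp)
    filter_upwards [(hc hβ).continuousAt.eventually_ne hne] with u hu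
    change _ = (_ - θ.inChart e u _) / _
    rw [hdec' u, eq_div_iff hu]
    ring
  have hH0 : H (e.symm (e (Ψ x))) = 0 := by rw [hl]; exact hH.self_of_nhds
  have hHe' : H =ᶠ[𝓝 (Ψ x)] (fun u => H (e.symm u)) ∘ e := by
    filter_upwards [e.open_source.mem_nhds hx] with m hm
    simp [e.left_inv hm]
  have hHd : HasMFDerivAt 𝓘(ℝ, V) 𝓘(ℝ, ℝ) H (Ψ x)
      ((fderiv ℝ (fun u => H (e.symm u)) (e (Ψ x))).comp L) := by
    refine HasMFDerivAt.congr_of_eventuallyEq ?_ hHe'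
    exact hHe.hasFDerivAt.hasMFDerivAt.comp (Ψ x) (hed.mdifferentiableAt hx).hasMFDerivAt
  -- H ∘ Ψ is zero near x, so dH kills all vectors tangent to the image of Ψ.
  have hHΨ : ∀ i, fderiv ℝ (fun u => H (e.symm u)) (e (Ψ x)) (L (v i)) = 0 := by
    intro i
    have h2 := hHd.comp x hΨ.hasMFDerivAt
    have h3 : H ∘ Ψ =ᶠ[𝓝 x] fun _ => 0 := hH
    have h4 := hasMFDerivAt_unique (h2.congr_of_eventuallyEq h3.symm) (hasMFDerivAt_const 0 x)
    exact DFunLike.congr_fun h4 (b i)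
  have hd : ∀ (ζ : DiffForm V M n) (w : Fin (n + 1) → V),
      ζ.d (Ψ x) w = extDeriv (ζ.inChart e) (e (Ψ x)) (fun i => L (w i)) := fun _ _ => rfl
  have hfun : θ.inChart e = fun u => (Θ.pullback (V := V) μ).inChart e u +
      (-H (e.symm u)) • (vol.pullback (V := V) p).inChart e u := by
    funext u
    ext v
    rw [hdec' u v]
    simp only [ContinuousAlternatingMap.add_apply, ContinuousAlternatingMap.smul_apply,
      smul_eq_mul]
    ring
  have hneg : HasFDerivAt (fun u => -H (e.symm u)) (-fderiv ℝ (fun u => H (e.symm u)) (e (Ψ x)))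
      (e (Ψ x)) := hHe.hasFDerivAt.fun_neg
  have hsm : DifferentiableAt ℝ
      (fun u => (-H (e.symm u)) • (vol.pullback (V := V) p).inChart e u) (e (Ψ x)) :=
    hneg.differentiableAt.smul (hβ.differentiableAt (by simp))
  obtain ⟨s, hs⟩ : ∃ s : Fin (n + 1) → V, s = Fin.snoc (α := fun _ => V) v w := ⟨_, rfl⟩
  have hs1 : ∀ i : Fin n, s i.castSucc = v i := fun i => by
    rw [hs]
    exact Fin.snoc_castSucc (α := fun _ => V) _ _ i
  have hs2 : s (Fin.last n) = w := by
    rw [hs]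
    exact Fin.snoc_last (α := fun _ => V) _ _
  rw [← hs]
  have hdμ := DiffForm.d_pullback hΘ hμ s
  -- In the alternating sum for dH ∧ p^*vol every term that feeds some Ψ_*bᵢ to dH vanishes. Only
  -- the term with w, in the last slot, survives, with sign (-1)ⁿ.
  rw [← hdμ, hd, hd, hfun, extDeriv_fun_add (hα.differentiableAt (by simp)) hsm,
    ContinuousAlternatingMap.add_apply,
    extDeriv_fun_smul_of_eq_zero hneg.differentiableAt (hβ.differentiableAt (by simp))
      (by simp [hH0]),
    Fin.sum_univ_castSucc, Finset.sum_eq_zero, hneg.fderiv, differential, hHd.mfderiv]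
  · have h6 : (Fin.last n).removeNth (fun i => L (s i)) = fun i => L (v i) := by
      funext i
      simp [Fin.removeNth, hs1]
    rw [h6, hβb, hs2, sub_eq_add_neg, zero_add, Fin.val_last]
    change _ + (-1) ^ n * (-(fderiv ℝ (fun u => H (e.symm u)) (e (Ψ x)) (L w)) * vol x b) =
      _ + -((-1) ^ n * (fderiv ℝ (fun u => H (e.symm u)) (e (Ψ x)) (L w) * vol x b))
    ring
  · intro i _
    have h7 : fderiv ℝ (fun u => -H (e.symm u)) (e (Ψ x)) (L (s i.castSucc)) = 0 := by
      rw [hneg.fderiv, hs1]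
      change -(fderiv ℝ (fun u => H (e.symm u)) (e (Ψ x)) (L (v i))) = 0
      rw [hHΨ, neg_zero]
    rw [h7, zero_mul, mul_zero]

end Decomposition

/-! ### The measure of a volume form -/

section VolumeMeasure

open MeasureTheory

variable {n : ℕ} {S : Type*} [TopologicalSpace S] [ChartedSpace (EuclideanSpace ℝ (Fin n)) S]
  [IsManifold 𝓘(ℝ, EuclideanSpace ℝ (Fin n)) ∞ S]
  (vol : VolumeForm (EuclideanSpace ℝ (Fin n)) S n)

theorem measurableSet_preimage_chart_symm [MeasurableSpace S] [BorelSpace S] (x : S) {s : Set S}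
    (hs : MeasurableSet s) :
    MeasurableSet ((chartAt (EuclideanSpace ℝ (Fin n)) x).target ∩
      (chartAt (EuclideanSpace ℝ (Fin n)) x).symm ⁻¹' s) := by
  set e := chartAt (EuclideanSpace ℝ (Fin n)) x
  have h1 : Measurable (fun u : e.target => e.symm u) :=
    (continuousOn_iff_continuous_domRestrict.1 e.continuousOn_symm).measurable
  have h2 := (MeasurableEmbedding.subtype_coe e.open_target.measurableSet).measurableSet_image.2
    (h1 hs)
  convert h2 using 1
  ext u
  simp [and_comm]

namespace VolumeForm

/-- The coefficient of a volume form in the preferred chart at `x`. -/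
def density (x : S) (u : EuclideanSpace ℝ (Fin n)) : ℝ :=
  vol.form.inChart (chartAt (EuclideanSpace ℝ (Fin n)) x) u (stdFrame n)

theorem contDiffOn_inChart (x : S) :
    ContDiffOn ℝ ∞ (vol.form.inChart (chartAt (EuclideanSpace ℝ (Fin n)) x))
      (chartAt (EuclideanSpace ℝ (Fin n)) x).target :=
  vol.smooth _ (chart_mem_atlas _ x)

theorem smoothAt (x : S) : vol.form.SmoothAt x :=
  (vol.contDiffOn_inChart x).contDiffAt
    ((chartAt (EuclideanSpace ℝ (Fin n)) x).open_target.mem_nhds (mem_chart_target _ x))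

theorem contDiffAt_density (x : S) {u : EuclideanSpace ℝ (Fin n)}
    (hu : u ∈ (chartAt (EuclideanSpace ℝ (Fin n)) x).target) :
    ContDiffAt ℝ ∞ (vol.density x) u :=
  contDiffAt_form_apply ((vol.contDiffOn_inChart x).contDiffAt
    ((chartAt (EuclideanSpace ℝ (Fin n)) x).open_target.mem_nhds hu)) fun _ => contDiffAt_const

theorem apply_stdFrame_ne_zero (x : S) : vol.form x (stdFrame n) ≠ 0 := by
  rw [← coe_stdBasis]
  exact top_form_ne_zero (W := EuclideanSpace ℝ (Fin n)) (stdBasis n) (vol.ne_zero x)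

/-- The derivative of the inverse chart is onto, so the standard frame at the image point comes from
vectors w; a zero of the density would make the form vanish on w, hence vol on the standard frame.
-/
theorem density_ne_zero (x : S) {u : EuclideanSpace ℝ (Fin n)}
    (hu : u ∈ (chartAt (EuclideanSpace ℝ (Fin n)) x).target) : vol.density x u ≠ 0 := by
  have := isManifold_one_of_infty (EuclideanSpace ℝ (Fin n)) S
  intro h0
  apply vol.apply_stdFrame_ne_zero ((chartAt (EuclideanSpace ℝ (Fin n)) x).symm u)
  have hd := mdifferentiable_chart (I := 𝓘(ℝ, EuclideanSpace ℝ (Fin n))) x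
  have h1 : vol.form.inChart (chartAt (EuclideanSpace ℝ (Fin n)) x) u = 0 := by
    by_contra hne
    refine top_form_ne_zero (stdBasis n) hne ?_
    rw [coe_stdBasis]
    exact h0
  choose w hw using fun i => hd.symm.mfderiv_surjective hu (stdFrame n i)
  have h2 : vol.form.inChart (chartAt (EuclideanSpace ℝ (Fin n)) x) u w = 0 := by rw [h1]; rfl
  rw [← h2]
  exact congrArg (vol.form _) (funext fun i => (hw i).symm)

/-- Densities change by the Jacobian determinant, precisely the factor produced by the change of
variables in Lebesgue integrals. -/
theorem density_transition (x y : S) {u : EuclideanSpace ℝ (Fin n)}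
    (hu : u ∈ (chartAt (EuclideanSpace ℝ (Fin n)) x).target)
    (hy : (chartAt (EuclideanSpace ℝ (Fin n)) x).symm u ∈
      (chartAt (EuclideanSpace ℝ (Fin n)) y).source) :
    vol.density x u =
      (fderiv ℝ (chartAt (EuclideanSpace ℝ (Fin n)) y ∘
        (chartAt (EuclideanSpace ℝ (Fin n)) x).symm) u).det *
      vol.density y (chartAt (EuclideanSpace ℝ (Fin n)) y
        ((chartAt (EuclideanSpace ℝ (Fin n)) x).symm u)) := by
  have hg := (contMDiffOn_chart_symm (I := 𝓘(ℝ, EuclideanSpace ℝ (Fin n))) (n := ∞)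
    (x := x)).contMDiffAt ((chartAt (EuclideanSpace ℝ (Fin n)) x).open_target.mem_nhds hu)
  have h1 := (vol.form.localForm_eventuallyEq hg hy).eq_of_nhds
  have h2 := DFunLike.congr_fun h1 (stdFrame n)
  refine Eq.trans h2 ?_
  rw [ContinuousAlternatingMap.compContinuousLinearMap_apply,
    top_form_apply (stdBasis n), coe_stdBasis, mul_comm]
  congr 1
  have h3 := (stdBasis n).det_comp (fderiv ℝ (chartAt (EuclideanSpace ℝ (Fin n)) y ∘
    (chartAt (EuclideanSpace ℝ (Fin n)) x).symm) u : _ →ₗ[ℝ] _) (stdBasis n)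
  rw [Module.Basis.det_self, mul_one] at h3
  rw [← coe_stdBasis]
  exact h3

variable [MeasurableSpace S] [BorelSpace S]

theorem aemeasurable_density (x : S) :
    AEMeasurable (fun u => ENNReal.ofReal |vol.density x u|)
      (volume.restrict (chartAt (EuclideanSpace ℝ (Fin n)) x).target) := by
  refine ContinuousOn.aemeasurable (fun u hu => ?_)
    (chartAt (EuclideanSpace ℝ (Fin n)) x).open_target.measurableSet
  have h := (vol.contDiffAt_density x hu).continuousAt.continuousWithinAt
    (s := (chartAt (EuclideanSpace ℝ (Fin n)) x).target)
  exact ENNReal.continuous_ofReal.continuousAt.comp_continuousWithinAt h.abs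

theorem aemeasurable_chart_symm (x : S) :
    AEMeasurable (chartAt (EuclideanSpace ℝ (Fin n)) x).symm
      ((volume.restrict (chartAt (EuclideanSpace ℝ (Fin n)) x).target).withDensity
        fun u => ENNReal.ofReal |vol.density x u|) :=
  ((chartAt (EuclideanSpace ℝ (Fin n)) x).continuousOn_symm.aemeasurable
    (chartAt (EuclideanSpace ℝ (Fin n)) x).open_target.measurableSet).mono_ac
    (withDensity_absolutelyContinuous _ _)

theorem chartMeasure_apply (x : S) {s : Set S} (hs : MeasurableSet s) :
    vol.chartMeasure x s = ∫⁻ u in (chartAt (EuclideanSpace ℝ (Fin n)) x).target ∩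
      (chartAt (EuclideanSpace ℝ (Fin n)) x).symm ⁻¹' s, ENNReal.ofReal |vol.density x u| := by
  have h := measurableSet_preimage_chart_symm (n := n) x hs
  set e := chartAt (EuclideanSpace ℝ (Fin n)) x with he
  have hnull : NullMeasurableSet (e.symm ⁻¹' s) ((volume.restrict e.target).withDensity
      fun u => ENNReal.ofReal |vol.density x u|) :=
    (vol.aemeasurable_chart_symm x).nullMeasurable hs
  have hnull' : NullMeasurableSet (e.symm ⁻¹' s) (volume.restrict e.target) :=
    (e.continuousOn_symm.aemeasurable e.open_target.measurableSet).nullMeasurable hs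
  change Measure.map e.symm ((volume.restrict e.target).withDensity
      fun u => ENNReal.ofReal |vol.density x u|) s = _
  rw [Measure.map_apply_of_aemeasurable (vol.aemeasurable_chart_symm x) hs,
    withDensity_apply₀ _ hnull', Measure.restrict_restrict₀ hnull', inter_comm]

theorem chartMeasure_inter_source (x : S) {s : Set S} (hs : MeasurableSet s) :
    vol.chartMeasure x (s ∩ (chartAt (EuclideanSpace ℝ (Fin n)) x).source) =
      vol.chartMeasure x s := by
  rw [vol.chartMeasure_apply x hs,
    vol.chartMeasure_apply x (hs.inter (chartAt _ x).open_source.measurableSet)]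
  congr 2
  ext u
  constructor
  · rintro ⟨h1, h2⟩
    exact ⟨h1, h2.1⟩
  · rintro ⟨h1, h2⟩
    exact ⟨h1, h2, (chartAt (EuclideanSpace ℝ (Fin n)) x).map_target h1⟩

/-- The measures of the charts agree on overlaps. -/
theorem chartMeasure_eq (x y : S) {s : Set S} (hs : MeasurableSet s)
    (hsx : s ⊆ (chartAt (EuclideanSpace ℝ (Fin n)) x).source)
    (hsy : s ⊆ (chartAt (EuclideanSpace ℝ (Fin n)) y).source) :
    vol.chartMeasure x s = vol.chartMeasure y s := by
  rw [vol.chartMeasure_apply x hs, vol.chartMeasure_apply y hs]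
  have hT := measurableSet_preimage_chart_symm (n := n) x hs
  set e := chartAt (EuclideanSpace ℝ (Fin n)) x with he
  set e' := chartAt (EuclideanSpace ℝ (Fin n)) y with he'
  have himage : (e' ∘ e.symm) '' (e.target ∩ e.symm ⁻¹' s) = e'.target ∩ e'.symm ⁻¹' s := by
    ext u
    constructor
    · rintro ⟨w, ⟨h1, h2⟩, rfl⟩
      refine ⟨e'.map_source (hsy h2), ?_⟩
      change e'.symm (e' (e.symm w)) ∈ s
      rwa [e'.left_inv (hsy h2)]
    · rintro ⟨h1, h2⟩
      refine ⟨e (e'.symm u), ⟨e.map_source (hsx h2), ?_⟩, ?_⟩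
      · change e.symm (e (e'.symm u)) ∈ s
        rwa [e.left_inv (hsx h2)]
      · change e' (e.symm (e (e'.symm u))) = u
        rw [e.left_inv (hsx h2), e'.right_inv h1]
  have hder : ∀ u ∈ e.target ∩ e.symm ⁻¹' s, HasFDerivWithinAt (e' ∘ e.symm)
      (fderiv ℝ (e' ∘ e.symm) u) (e.target ∩ e.symm ⁻¹' s) u := by
    rintro u ⟨h1, h2⟩
    have hg := (contMDiffOn_chart_symm (I := 𝓘(ℝ, EuclideanSpace ℝ (Fin n))) (n := ∞)
      (x := x)).contMDiffAt (e.open_target.mem_nhds h1)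
    exact ((contDiffAt_chart_comp hg (hsy h2)).differentiableAt
      (by simp)).hasFDerivAt.hasFDerivWithinAt
  have hinj : InjOn (e' ∘ e.symm) (e.target ∩ e.symm ⁻¹' s) := by
    rintro u ⟨h1, h2⟩ w ⟨h3, h4⟩ h
    exact e.symm.injOn h1 h3 (e'.injOn (hsy h2) (hsy h4) h)
  -- Change of variables along the coordinate change; its |det| is absorbed by `density_transition`.
  rw [← himage, lintegral_image_eq_lintegral_abs_det_fderiv_mul volume hT hder hinj]
  refine setLIntegral_congr_fun hT ?_
  rintro u ⟨h1, h2⟩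
  change ENNReal.ofReal |vol.density x u| = _
  rw [vol.density_transition x y h1 (hsy h2), abs_mul, ENNReal.ofReal_mul (abs_nonneg _)]
  rfl

theorem chartMeasure_le_measure (x : S) : vol.chartMeasure x ≤ vol.measure :=
  le_iSup vol.chartMeasure x

variable [SecondCountableTopology S]

/-- A supremum of measures is not the setwise supremum, so an upper bound for it has to be exhibited
as a measure. One is glued from the chart measures along a countable disjoint decomposition; it
dominates every chart measure and agrees with each of them on its chart domain. -/
theorem measure_apply_of_subset_source (x : S) {s : Set S} (hs : MeasurableSet s)
    (hsx : s ⊆ (chartAt (EuclideanSpace ℝ (Fin n)) x).source) :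
    vol.measure s = vol.chartMeasure x s := by
  refine le_antisymm ?_ (vol.chartMeasure_le_measure x s)
  obtain ⟨c, hc, hcov⟩ := TopologicalSpace.countable_cover_nhds
    (fun x : S => (chartAt (EuclideanSpace ℝ (Fin n)) x).open_source.mem_nhds (mem_chart_source _ x))
  obtain ⟨f, hf⟩ : ∃ f : ℕ → S, ∀ y : S, ∃ k,
      y ∈ (chartAt (EuclideanSpace ℝ (Fin n)) (f k)).source := by
    have hne : c.Nonempty := by
      obtain ⟨i, hi, -⟩ := mem_iUnion₂.1 (hcov.symm ▸ mem_univ x : x ∈ ⋃ y ∈ c, _)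
      exact ⟨i, hi⟩
    obtain ⟨f, hf⟩ := hc.exists_eq_range hne
    refine ⟨f, fun y => ?_⟩
    obtain ⟨i, hi, hy⟩ := mem_iUnion₂.1 (hcov.symm ▸ mem_univ y : y ∈ ⋃ y ∈ c, _)
    rw [hf] at hi
    obtain ⟨k, rfl⟩ := hi
    exact ⟨k, hy⟩
  let D := disjointed fun k => (chartAt (EuclideanSpace ℝ (Fin n)) (f k)).source
  have hDm : ∀ k, MeasurableSet (D k) := fun k =>
    MeasurableSet.disjointed (fun k => (chartAt _ (f k)).open_source.measurableSet) k
  have hDsub : ∀ k, D k ⊆ (chartAt (EuclideanSpace ℝ (Fin n)) (f k)).source := disjointed_subset _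
  have hDdisj : Pairwise (Function.onFun Disjoint D) := disjoint_disjointed _
  have hDU : ⋃ k, D k = univ := by
    refine (iUnion_disjointed).trans (eq_univ_of_forall fun y => mem_iUnion.2 (hf y))
  -- On each piece D k any chart measure whose domain contains the set may be used, because chart
  -- measures agree on overlaps.
  let ν : Measure S := Measure.sum fun k => (vol.chartMeasure (f k)).restrict (D k)
  have hν : ∀ y {t : Set S}, MeasurableSet t →
      t ⊆ (chartAt (EuclideanSpace ℝ (Fin n)) y).source → ν t = vol.chartMeasure y t := by
    intro y t ht hty
    have h1 : ∀ k, (vol.chartMeasure (f k)).restrict (D k) t = vol.chartMeasure y (t ∩ D k) := by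
      intro k
      rw [Measure.restrict_apply ht]
      exact vol.chartMeasure_eq _ _ (ht.inter (hDm k)) (inter_subset_right.trans (hDsub k))
        (inter_subset_left.trans hty)
    rw [Measure.sum_apply _ ht]
    simp_rw [h1]
    rw [← measure_iUnion (fun i j hij => (hDdisj hij).mono inter_subset_right inter_subset_right)
      (fun k => ht.inter (hDm k)), ← inter_iUnion, hDU, inter_univ]
  rw [← hν x hs hsx]
  -- The chart measure at y lives on the chart domain at y, where it equals ν; hence ν is an upper
  -- bound of all chart measures.
  have hle : vol.measure ≤ ν := by
    refine iSup_le fun y => Measure.le_iff.2 fun t ht => ?_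
    have hy := (chartAt (EuclideanSpace ℝ (Fin n)) y).open_source.measurableSet
    rw [← vol.chartMeasure_inter_source y ht, ← hν y (ht.inter hy) inter_subset_right]
    exact measure_mono inter_subset_left
  exact hle s

theorem measure_restrict_source (x : S) :
    vol.measure.restrict (chartAt (EuclideanSpace ℝ (Fin n)) x).source = vol.chartMeasure x := by
  ext s hs
  have hm := (chartAt (EuclideanSpace ℝ (Fin n)) x).open_source.measurableSet
  rw [Measure.restrict_apply hs, vol.measure_apply_of_subset_source x (hs.inter hm)
    inter_subset_right, vol.chartMeasure_inter_source x hs]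

theorem setIntegral_source (x : S) {f : S → ℝ}
    (hf : ContinuousOn f (chartAt (EuclideanSpace ℝ (Fin n)) x).source) :
    ∫ y in (chartAt (EuclideanSpace ℝ (Fin n)) x).source, f y ∂vol.measure =
      ∫ u in (chartAt (EuclideanSpace ℝ (Fin n)) x).target,
        |vol.density x u| * f ((chartAt (EuclideanSpace ℝ (Fin n)) x).symm u) := by
  have hm := (chartAt (EuclideanSpace ℝ (Fin n)) x).open_source.measurableSet
  have h1 := hf.aestronglyMeasurable (μ := vol.measure) hm
  rw [vol.measure_restrict_source x] at h1 ⊢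
  refine (integral_map (vol.aemeasurable_chart_symm x) h1).trans ?_
  rw [integral_withDensity_eq_integral_toReal_smul₀ (vol.aemeasurable_density x) (by simp)]
  simp

/-- In a chart the density is continuous, hence bounded on a small closed ball, which has finite
Lebesgue measure. -/
instance : IsLocallyFiniteMeasure vol.measure := by
  refine ⟨fun x => ?_⟩
  set e := chartAt (EuclideanSpace ℝ (Fin n)) x with he
  have hx := mem_chart_target (EuclideanSpace ℝ (Fin n)) x
  obtain ⟨r, hr, hball⟩ := Metric.nhds_basis_closedBall.mem_iff.1 (e.open_target.mem_nhds hx)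
  have hcont : ContinuousOn (fun u => |vol.density x u|) (Metric.closedBall (e x) r) := fun u hu =>
    (vol.contDiffAt_density x (hball hu)).continuousAt.continuousWithinAt.abs
  obtain ⟨C, hC⟩ := (isCompact_closedBall (e x) r).bddAbove_image hcont
  have hO : IsOpen (e.source ∩ e ⁻¹' Metric.ball (e x) r) :=
    e.isOpen_inter_preimage Metric.isOpen_ball
  refine ⟨_, hO.mem_nhds ⟨mem_chart_source _ x, Metric.mem_ball_self hr⟩, ?_⟩
  rw [vol.measure_apply_of_subset_source x hO.measurableSet inter_subset_left,
    vol.chartMeasure_apply x hO.measurableSet]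
  calc _ ≤ ∫⁻ u in Metric.closedBall (e x) r, ENNReal.ofReal |vol.density x u| := by
        refine lintegral_mono_set ?_
        rintro u ⟨h1, h2, h3⟩
        have h3 : e (e.symm u) ∈ Metric.ball (e x) r := h3
        rw [e.right_inv h1] at h3
        exact Metric.ball_subset_closedBall h3
    _ ≤ ∫⁻ _u in Metric.closedBall (e x) r, ENNReal.ofReal C := by
        refine setLIntegral_mono measurable_const fun u hu => ?_
        exact ENNReal.ofReal_le_ofReal (hC ⟨u, hu, rfl⟩)
    _ < ⊤ := by
        rw [setLIntegral_const]
        exact ENNReal.mul_lt_top ENNReal.ofReal_lt_top (isCompact_closedBall _ _).measure_lt_top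

/-- The density has no zeros, so a null open set would have a Lebesgue null open image in a chart.
This is what upgrades "zero almost everywhere" to "zero" for continuous functions. -/
instance : vol.measure.IsOpenPosMeasure := by
  refine ⟨fun O hO ⟨x, hx⟩ h0 => ?_⟩
  set e := chartAt (EuclideanSpace ℝ (Fin n)) x with he
  have h1 : vol.chartMeasure x O = 0 :=
    le_antisymm ((vol.chartMeasure_le_measure x O).trans h0.le) (by simp)
  have hO' : IsOpen (e.target ∩ e.symm ⁻¹' O) := e.symm.isOpen_inter_preimage hO
  rw [vol.chartMeasure_apply x hO.measurableSet, lintegral_eq_zero_iff'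
    ((vol.aemeasurable_density x).mono_measure (Measure.restrict_mono inter_subset_left le_rfl)),
    Filter.EventuallyEq, ae_restrict_iff' hO'.measurableSet] at h1
  have h2 : volume (e.target ∩ e.symm ⁻¹' O) = 0 := by
    refine measure_mono_null (fun u hu => ?_) h1
    have := vol.density_ne_zero x hu.1
    have h3 : e.symm u ∈ O := hu.2
    simpa [hu.1, h3] using this
  refine hO'.measure_ne_zero volume ⟨e x, mem_chart_target _ x, ?_⟩ h2
  change e.symm (e x) ∈ O
  rwa [e.left_inv (mem_chart_source _ x)]

end VolumeForm

end VolumeMeasure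

/-! ### Stokes' theorem for compactly supported forms -/

section Stokes

open MeasureTheory

theorem ContDiffAt.extDeriv_infty {V : Type*} [NormedAddCommGroup V] [NormedSpace ℝ V] {k : ℕ}
    {f : V → V [⋀^Fin k]→L[ℝ] ℝ} {x : V} (hf : ContDiffAt ℝ ∞ f x) :
    ContDiffAt ℝ ∞ (extDeriv f) x := by
  have h : IsBoundedLinearMap ℝ (fun g : V →L[ℝ] V [⋀^Fin k]→L[ℝ] ℝ =>
      ContinuousAlternatingMap.alternatizeUncurryFin g) :=
    { map_add := ContinuousAlternatingMap.alternatizeUncurryFin_add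
      map_smul := ContinuousAlternatingMap.alternatizeUncurryFin_smul
      bound := ⟨k + 1, by positivity, ContinuousAlternatingMap.norm_alternatizeUncurryFin_le⟩ }
  exact (h.contDiff (n := ∞)).contDiffAt.comp x (hf.fderiv_right (m := ∞) (by simp))

theorem extDeriv_fun_zero {V : Type*} [NormedAddCommGroup V] [NormedSpace ℝ V] {k : ℕ} (x : V) :
    extDeriv (fun _ : V => (0 : V [⋀^Fin k]→L[ℝ] ℝ)) x = 0 := by
  rw [extDeriv, fderiv_fun_const]
  exact map_zero (ContinuousAlternatingMap.alternatizeUncurryFinCLM ℝ V ℝ (n := k))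

/-- Integration by parts against the constant function 1. -/
theorem integral_fderiv_eq_zero {V : Type*} [NormedAddCommGroup V] [NormedSpace ℝ V]
    [FiniteDimensional ℝ V] [MeasurableSpace V] [BorelSpace V] (μ : Measure V) [μ.IsAddHaarMeasure]
    {f : V → ℝ} (hf : ContDiff ℝ 1 f) (hc : HasCompactSupport f) (v : V) :
    ∫ u, fderiv ℝ f u v ∂μ = 0 := by
  have h1 : Integrable f μ := hf.continuous.integrable_of_hasCompactSupport hc
  have h2 : Integrable (fun u => fderiv ℝ f u v) μ :=
    ((hf.continuous_fderiv (by simp)).clm_apply continuous_const).integrable_of_hasCompactSupport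
      (hc.fderiv_apply ℝ v)
  have h := integral_mul_fderiv_eq_neg_fderiv_mul_of_integrable (μ := μ) (𝕜 := ℝ) (v := v)
    (f := fun _ => (1 : ℝ)) (g := f) (by simp) (by simpa using h2) (by simpa using h1)
    (fun _ _ => differentiableAt_const _) (fun u _ => hf.differentiable (by simp) u)
  simpa using h

/-- On constant vectors the exterior derivative is an alternating sum of directional derivatives of
compactly supported functions. -/
theorem integral_extDeriv_eq_zero {V : Type*} [NormedAddCommGroup V] [NormedSpace ℝ V]
    [FiniteDimensional ℝ V] [MeasurableSpace V] [BorelSpace V] (μ : Measure V) [μ.IsAddHaarMeasure]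
    {m : ℕ} {f : V → V [⋀^Fin m]→L[ℝ] ℝ} (hf : ContDiff ℝ 1 f) (hc : HasCompactSupport f)
    (v : Fin (m + 1) → V) : ∫ u, extDeriv f u v ∂μ = 0 := by
  have h1 : ∀ w : Fin m → V, ContDiff ℝ 1 (fun u => f u w) := fun w =>
    (ContinuousAlternatingMap.apply ℝ V ℝ w).contDiff.comp hf
  have h2 : ∀ w : Fin m → V, HasCompactSupport (fun u => f u w) := fun w =>
    hc.comp_left (g := fun ζ : V [⋀^Fin m]→L[ℝ] ℝ => ζ w) rfl
  have h3 : ∀ u, extDeriv f u v =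
      ∑ i : Fin (m + 1), (-1 : ℝ) ^ i.val * fderiv ℝ (fun u => f u (i.removeNth v)) u (v i) :=
    fun u => by simpa [zsmul_eq_mul] using extDeriv_apply (hf.differentiable (by simp) u) v
  simp_rw [h3]
  rw [integral_finsetSum]
  · refine Finset.sum_eq_zero fun i _ => ?_
    rw [integral_const_mul, integral_fderiv_eq_zero μ (h1 _) (h2 _), mul_zero]
  · intro i _
    exact ((((h1 _).continuous_fderiv (by simp)).clm_apply
      continuous_const).integrable_of_hasCompactSupport ((h2 _).fderiv_apply ℝ _)).const_mul _

variable {n : ℕ} {S : Type*} [TopologicalSpace S] [ChartedSpace (EuclideanSpace ℝ (Fin n)) S]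
  [IsManifold 𝓘(ℝ, EuclideanSpace ℝ (Fin n)) ∞ S]

/-- The quotient of a form of top degree by a volume form, computed in a chart. -/
theorem VolumeForm.div_eq_inChart (vol : VolumeForm (EuclideanSpace ℝ (Fin n)) S n)
    (α : DiffForm (EuclideanSpace ℝ (Fin n)) S n) (x : S) {u : EuclideanSpace ℝ (Fin n)}
    (hu : u ∈ (chartAt (EuclideanSpace ℝ (Fin n)) x).target) :
    α ((chartAt (EuclideanSpace ℝ (Fin n)) x).symm u) (stdFrame n) /
        vol.form ((chartAt (EuclideanSpace ℝ (Fin n)) x).symm u) (stdFrame n) =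
      α.inChart (chartAt (EuclideanSpace ℝ (Fin n)) x) u (stdFrame n) / vol.density x u := by
  rw [div_eq_div_iff (vol.apply_stdFrame_ne_zero _) (vol.density_ne_zero x hu)]
  have h := top_form_mul (W := EuclideanSpace ℝ (Fin n)) (stdBasis n)
    (α ((chartAt (EuclideanSpace ℝ (Fin n)) x).symm u))
    (vol.form ((chartAt (EuclideanSpace ℝ (Fin n)) x).symm u)) (stdFrame n)
    (fun i => mfderiv 𝓘(ℝ, EuclideanSpace ℝ (Fin n)) 𝓘(ℝ, EuclideanSpace ℝ (Fin n))
      (chartAt (EuclideanSpace ℝ (Fin n)) x).symm u (stdFrame n i))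
  exact h

theorem DiffForm.SmoothAt.contDiffAt_inChart {V X : Type*} [NormedAddCommGroup V]
    [NormedSpace ℝ V] [FiniteDimensional ℝ V] [TopologicalSpace X] [ChartedSpace V X]
    [IsManifold 𝓘(ℝ, V) ∞ X] {k : ℕ} {α : DiffForm V X k} {x : X} {u : V}
    (hu : u ∈ (chartAt V x).target) (hα : α.SmoothAt ((chartAt V x).symm u)) :
    ContDiffAt ℝ ∞ (α.inChart (chartAt V x)) u :=
  DiffForm.contDiffAt_localForm hα
    (contMDiffOn_chart_symm.contMDiffAt ((chartAt V x).open_target.mem_nhds hu))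

/-- The definition of d changes chart from point to point; here one chart serves all points of its
domain, so that d can be integrated there. -/
theorem DiffForm.SmoothAt.d_inChart {V X : Type*} [NormedAddCommGroup V]
    [NormedSpace ℝ V] [FiniteDimensional ℝ V] [TopologicalSpace X] [ChartedSpace V X]
    [IsManifold 𝓘(ℝ, V) ∞ X] {k : ℕ} {α : DiffForm V X k} {x : X} {u : V}
    (hu : u ∈ (chartAt V x).target) (hα : α.SmoothAt ((chartAt V x).symm u)) :
    α.d.inChart (chartAt V x) u = extDeriv (α.inChart (chartAt V x)) u :=
  (DiffForm.extDeriv_localForm hα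
    (contMDiffOn_chart_symm.contMDiffAt ((chartAt V x).open_target.mem_nhds hu))).symm

theorem DiffForm.d_eq_zero {V X : Type*} [NormedAddCommGroup V]
    [NormedSpace ℝ V] [TopologicalSpace X] [ChartedSpace V X]
    {k : ℕ} {α : DiffForm V X k} {x : X} (hα : ∀ᶠ y in 𝓝 x, α y = 0) : α.d x = 0 := by
  have h1 : Filter.Tendsto (chartAt V x).symm (𝓝 (chartAt V x x)) (𝓝 x) := by
    have := (chartAt V x).continuousAt_symm (mem_chart_target V x)
    rwa [ContinuousAt, (chartAt V x).left_inv (mem_chart_source V x)] at this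
  have h2 : α.inChart (chartAt V x) =ᶠ[𝓝 (chartAt V x x)] fun _ => 0 := by
    filter_upwards [h1.eventually hα] with u hu
    ext v
    change α ((chartAt V x).symm u) _ = 0
    rw [hu]
    rfl
  ext v
  change extDeriv (α.inChart (chartAt V x)) (chartAt V x x) _ = 0
  rw [h2.extDeriv_eq, extDeriv_fun_zero]
  rfl

end Stokes

/-! ### Stokes' theorem on the base manifold -/

section StokesTop

open MeasureTheory

variable {m : ℕ} {S : Type*} [TopologicalSpace S]
  [ChartedSpace (EuclideanSpace ℝ (Fin (m + 1))) S]
  [IsManifold 𝓘(ℝ, EuclideanSpace ℝ (Fin (m + 1))) ∞ S]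
  (vol : VolumeForm (EuclideanSpace ℝ (Fin (m + 1))) S (m + 1))

/-- The quotient of the differential of a form by a volume form. -/
def VolumeForm.divergence (β : DiffForm (EuclideanSpace ℝ (Fin (m + 1))) S m) (x : S) : ℝ :=
  β.d x (stdFrame (m + 1)) / vol.form x (stdFrame (m + 1))

theorem VolumeForm.divergence_eq {β : DiffForm (EuclideanSpace ℝ (Fin (m + 1))) S m}
    (x : S) {u : EuclideanSpace ℝ (Fin (m + 1))}
    (hu : u ∈ (chartAt (EuclideanSpace ℝ (Fin (m + 1))) x).target)
    (hβ : β.SmoothAt ((chartAt (EuclideanSpace ℝ (Fin (m + 1))) x).symm u)) :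
    vol.divergence β ((chartAt (EuclideanSpace ℝ (Fin (m + 1))) x).symm u) =
      extDeriv (β.inChart (chartAt (EuclideanSpace ℝ (Fin (m + 1))) x)) u (stdFrame (m + 1)) /
        vol.density x u := by
  rw [VolumeForm.divergence, vol.div_eq_inChart β.d x hu, hβ.d_inChart hu]

theorem VolumeForm.continuous_divergence {β : DiffForm (EuclideanSpace ℝ (Fin (m + 1))) S m}
    (hβ : ∀ x, β.SmoothAt x) : Continuous (vol.divergence β) := by
  rw [continuous_iff_continuousAt]
  intro x
  set e := chartAt (EuclideanSpace ℝ (Fin (m + 1))) x with he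
  have hx : x ∈ e.source := mem_chart_source _ x
  have h1 : vol.divergence β =ᶠ[𝓝 x]
      (fun u => extDeriv (β.inChart e) u (stdFrame (m + 1)) / vol.density x u) ∘ e := by
    filter_upwards [e.open_source.mem_nhds hx] with y hy
    have h := vol.divergence_eq (β := β) x (e.map_source hy) (hβ _)
    change vol.divergence β (e.symm (e y)) = _ at h
    rw [e.left_inv hy] at h
    exact h
  refine ContinuousAt.congr ?_ h1.symm
  refine ContinuousAt.comp ?_ (e.continuousAt hx)
  have h2 : ContDiffAt ℝ ∞ (β.inChart e) (e x) := hβ x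
  exact (contDiffAt_form_apply (ContDiffAt.extDeriv_infty h2)
    fun _ => contDiffAt_const).continuousAt.div
    (vol.contDiffAt_density x (e.map_source hx)).continuousAt
    (vol.density_ne_zero x (e.map_source hx))

theorem VolumeForm.divergence_eq_zero {β : DiffForm (EuclideanSpace ℝ (Fin (m + 1))) S m} {x : S}
    (hβ : ∀ᶠ y in 𝓝 x, β y = 0) : vol.divergence β x = 0 := by
  rw [VolumeForm.divergence, DiffForm.d_eq_zero hβ]
  exact zero_div _

variable [MeasurableSpace S] [BorelSpace S] [SecondCountableTopology S] [T2Space S]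

/-- Stokes' theorem for a form with compact support in a chart domain. -/
theorem VolumeForm.integral_divergence_of_subset_source
    {β : DiffForm (EuclideanSpace ℝ (Fin (m + 1))) S m} (hβ : ∀ x, β.SmoothAt x) {K : Set S}
    (hK : IsCompact K) (hβK : ∀ x ∉ K, β x = 0) (x : S)
    (hKx : K ⊆ (chartAt (EuclideanSpace ℝ (Fin (m + 1))) x).source) :
    ∫ y, vol.divergence β y ∂vol.measure = 0 := by
  set e := chartAt (EuclideanSpace ℝ (Fin (m + 1))) x with he
  have hzero : ∀ y ∉ e.source, vol.divergence β y = 0 := by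
    intro y hy
    refine vol.divergence_eq_zero ?_
    filter_upwards [hK.isClosed.isOpen_compl.mem_nhds fun h => hy (hKx h)] with z hz
    exact hβK z hz
  rw [← setIntegral_eq_integral_of_forall_compl_eq_zero hzero,
    vol.setIntegral_source x (vol.continuous_divergence hβ).continuousOn]
  have hKc : IsCompact (e '' K) := hK.image_of_continuousOn (e.continuousOn.mono hKx)
  classical
  -- The measure involves |density| while the quotient by vol involves the density itself, so the
  -- coordinate integrand is the sign of the density times dβ. The sign, which records whether the
  -- chart is compatible with the orientation, is put into the form before it is extended by zero.
  let B : EuclideanSpace ℝ (Fin (m + 1)) → EuclideanSpace ℝ (Fin (m + 1)) [⋀^Fin m]→L[ℝ] ℝ :=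
    fun u => if u ∈ e.target then (|vol.density x u| / vol.density x u) • β.inChart e u else 0
  have hB0 : ∀ u ∉ e '' K, B u = 0 := by
    intro u hu
    by_cases hut : u ∈ e.target
    · have h1 : e.symm u ∉ K := fun h => hu ⟨_, h, e.right_inv hut⟩
      have h2 : β.inChart e u = 0 := by
        ext v
        change β (e.symm u) _ = 0
        rw [hβK _ h1]
        rfl
      simp only [B, h2, smul_zero, ite_self]
    · simp only [B, if_neg hut]
  -- The density is continuous without zeros, so its sign is locally constant and commutes with d.
  have hBt : ∀ u ∈ e.target, ∃ c : ℝ, c = |vol.density x u| / vol.density x u ∧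
      B =ᶠ[𝓝 u] fun w => c • β.inChart e w := by
    intro u hu
    have hc := (vol.contDiffAt_density x hu).continuousAt
    rcases lt_or_gt_of_ne (vol.density_ne_zero x hu) with h | h
    · refine ⟨-1, by rw [abs_of_neg h, neg_div, div_self h.ne], ?_⟩
      filter_upwards [hc.eventually_lt_const h, e.open_target.mem_nhds hu] with w hw hwt
      simp only [B, if_pos hwt]
      rw [abs_of_neg hw, neg_div, div_self hw.ne]
    · refine ⟨1, by rw [abs_of_pos h, div_self h.ne'], ?_⟩
      filter_upwards [hc.eventually_const_lt h, e.open_target.mem_nhds hu] with w hw hwt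
      simp only [B, if_pos hwt]
      rw [abs_of_pos hw, div_self hw.ne']
  have hBs : ContDiff ℝ 1 B := by
    rw [contDiff_iff_contDiffAt]
    intro u
    by_cases hu : u ∈ e.target
    · obtain ⟨c, -, hcu⟩ := hBt u hu
      refine ContDiffAt.congr_of_eventuallyEq ?_ hcu
      have h1 : ContDiffAt ℝ ∞ (β.inChart e) u := (hβ _).contDiffAt_inChart hu
      exact (h1.of_le (by simp)).const_smul c
    · have hu' : u ∉ e '' K := by
        rintro ⟨y, hy, rfl⟩
        exact hu (e.map_source (hKx hy))
      refine (contDiffAt_const (c := (0 : EuclideanSpace ℝ (Fin (m + 1)) [⋀^Fin m]→L[ℝ] ℝ))).congr_of_eventuallyEq ?_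
      filter_upwards [hKc.isClosed.isOpen_compl.mem_nhds hu'] with w hw
      exact hB0 w hw
  have hBc : HasCompactSupport B := HasCompactSupport.intro hKc hB0
  have h0 := integral_extDeriv_eq_zero volume hBs hBc (stdFrame (m + 1))
  have h1 : ∫ u in e.target, extDeriv B u (stdFrame (m + 1)) =
      ∫ u, extDeriv B u (stdFrame (m + 1)) := by
    refine setIntegral_eq_integral_of_forall_compl_eq_zero fun u hu => ?_
    have hu' : u ∉ e '' K := by
      rintro ⟨y, hy, rfl⟩
      exact hu (e.map_source (hKx hy))
    have h1 : B =ᶠ[𝓝 u] fun _ => 0 := by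
      filter_upwards [hKc.isClosed.isOpen_compl.mem_nhds hu'] with w hw
      exact hB0 w hw
    rw [h1.extDeriv_eq, extDeriv_fun_zero]
    rfl
  rw [← h0, ← h1]
  refine setIntegral_congr_fun e.open_target.measurableSet fun u hu => ?_
  obtain ⟨c, hc, hcu⟩ := hBt u hu
  change |vol.density x u| * vol.divergence β (e.symm u) = extDeriv B u (stdFrame (m + 1))
  have h2 : extDeriv (fun w => c • β.inChart e w) u = c • extDeriv (β.inChart e) u :=
    extDeriv_smul c _
  rw [vol.divergence_eq x hu (hβ _), hcu.extDeriv_eq, h2,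
    ContinuousAlternatingMap.smul_apply, hc, smul_eq_mul]
  ring

theorem DiffForm.SmoothAt.smul {V X : Type*} [NormedAddCommGroup V]
    [NormedSpace ℝ V] [TopologicalSpace X] [ChartedSpace V X] [IsManifold 𝓘(ℝ, V) ∞ X]
    {k : ℕ} {f : X → ℝ} {β : DiffForm V X k} {x : X} (hf : ContMDiffAt 𝓘(ℝ, V) 𝓘(ℝ) ∞ f x)
    (hβ : β.SmoothAt x) : DiffForm.SmoothAt (fun y => f y • β y) x := by
  have h1 : ContDiffAt ℝ ∞ (f ∘ (chartAt V x).symm) (chartAt V x x) := by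
    refine (ContMDiffAt.comp _ ?_ (contMDiffAt_chart_symm x)).contDiffAt
    rwa [(chartAt V x).left_inv (mem_chart_source V x)]
  exact ContDiffAt.smul h1 hβ

theorem DiffForm.SmoothAt.d_add {V X : Type*} [NormedAddCommGroup V]
    [NormedSpace ℝ V] [TopologicalSpace X] [ChartedSpace V X]
    {k : ℕ} {α β : DiffForm V X k} {x : X} (hα : α.SmoothAt x) (hβ : β.SmoothAt x)
    (v : Fin (k + 1) → V) :
    DiffForm.d (fun y => α y + β y) x v = α.d x v + β.d x v := by
  have h : extDeriv (DiffForm.inChart (fun y => α y + β y) (chartAt V x)) (chartAt V x x) =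
      extDeriv (α.inChart (chartAt V x)) (chartAt V x x) +
        extDeriv (β.inChart (chartAt V x)) (chartAt V x x) :=
    extDeriv_fun_add (ContDiffAt.differentiableAt hα (by simp))
      (ContDiffAt.differentiableAt hβ (by simp))
  change extDeriv (DiffForm.inChart (fun y => α y + β y) (chartAt V x)) (chartAt V x x) _ = _
  rw [h]
  rfl

theorem VolumeForm.divergence_add {α β : DiffForm (EuclideanSpace ℝ (Fin (m + 1))) S m}
    (hα : ∀ x, α.SmoothAt x) (hβ : ∀ x, β.SmoothAt x) (x : S) :
    vol.divergence (fun y => α y + β y) x = vol.divergence α x + vol.divergence β x := by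
  rw [divergence, (hα x).d_add (hβ x), add_div]
  rfl

theorem VolumeForm.integrable_divergence
    {β : DiffForm (EuclideanSpace ℝ (Fin (m + 1))) S m} (hβ : ∀ x, β.SmoothAt x) {K : Set S}
    (hK : IsCompact K) (hβK : ∀ x ∉ K, β x = 0) : Integrable (vol.divergence β) vol.measure := by
  refine (vol.continuous_divergence hβ).integrable_of_hasCompactSupport
    (HasCompactSupport.intro hK fun x hx => vol.divergence_eq_zero ?_)
  filter_upwards [hK.isClosed.isOpen_compl.mem_nhds hx] with z hz
  exact hβK z hz

/-- Stokes' theorem for compactly supported forms. -/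
theorem VolumeForm.integral_divergence
    {β : DiffForm (EuclideanSpace ℝ (Fin (m + 1))) S m} (hβ : ∀ x, β.SmoothAt x) {K : Set S}
    (hK : IsCompact K) (hβK : ∀ x ∉ K, β x = 0) :
    ∫ y, vol.divergence β y ∂vol.measure = 0 := by
  have : LocallyCompactSpace S :=
    ChartedSpace.locallyCompactSpace (EuclideanSpace ℝ (Fin (m + 1))) S
  -- A partition of unity subordinate to the chart domains reduces the claim to forms supported in
  -- one chart; only finitely many of its members meet K.
  obtain ⟨ρ, hρ⟩ := SmoothPartitionOfUnity.exists_isSubordinate_chartAt_source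
    𝓘(ℝ, EuclideanSpace ℝ (Fin (m + 1))) S
  have hfin := ρ.locallyFinite.finite_nonempty_inter_compact hK
  have hsm : ∀ (F : Finset S), ∀ x, DiffForm.SmoothAt (fun y => (∑ i ∈ F, ρ i y) • β y) x :=
    fun F x => DiffForm.SmoothAt.smul
      ((contMDiff_finsetSum fun i _ => (ρ i).contMDiff).contMDiffAt) (hβ x)
  have hsupp : ∀ (F : Finset S), ∀ x ∉ K, (∑ i ∈ F, ρ i x) • β x = 0 := fun F x hx => by
    rw [hβK x hx, smul_zero]
  have key : ∀ F : Finset S,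
      ∫ y, vol.divergence (fun y => (∑ i ∈ F, ρ i y) • β y) y ∂vol.measure = 0 := by
    classical
    intro F
    induction F using Finset.induction_on with
    | empty =>
      refine integral_eq_zero_of_ae (Filter.Eventually.of_forall fun y => ?_)
      refine vol.divergence_eq_zero (Filter.Eventually.of_forall fun z => ?_)
      simp
    | insert i F hi ih =>
      have hsm1 : ∀ x, DiffForm.SmoothAt (fun y => ρ i y • β y) x := fun x =>
        DiffForm.SmoothAt.smul (ρ i).contMDiff.contMDiffAt (hβ x)
      have hsupp1 : ∀ x ∉ K ∩ tsupport (ρ i), ρ i x • β x = 0 := by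
        intro x hx
        by_cases h : x ∈ K
        · rw [image_eq_zero_of_notMem_tsupport fun h' => hx ⟨h, h'⟩, zero_smul]
        · rw [hβK x h, smul_zero]
      have hK1 : IsCompact (K ∩ tsupport (ρ i)) := hK.inter_right (isClosed_tsupport _)
      have h1 : (fun y => (∑ j ∈ insert i F, ρ j y) • β y) =
          fun y => ρ i y • β y + (∑ j ∈ F, ρ j y) • β y := by
        funext y
        rw [Finset.sum_insert hi, add_smul]
      rw [h1]
      simp_rw [vol.divergence_add hsm1 (hsm F)]
      rw [integral_add (vol.integrable_divergence hsm1 hK1 hsupp1)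
        (vol.integrable_divergence (hsm F) hK (hsupp F)), ih, add_zero]
      exact vol.integral_divergence_of_subset_source hsm1 hK1 hsupp1 i
        (inter_subset_right.trans (hρ i))
  have h := key hfin.toFinset
  -- On K the finite sum is the full sum, which is 1; off K both sides vanish.
  have h2 : (fun y => (∑ i ∈ hfin.toFinset, ρ i y) • β y) = β := by
    funext y
    by_cases hy : y ∈ K
    · have h3 : ∑ i ∈ hfin.toFinset, ρ i y = ∑ᶠ i, ρ i y := by
        refine (finsum_eq_sum_of_support_subset _ fun i hi => ?_).symm
        exact hfin.mem_toFinset.2 ⟨y, hi, hy⟩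
      rw [h3, ρ.sum_eq_one (mem_univ y), one_smul]
    · rw [hβK y hy, smul_zero]
  rwa [h2] at h

end StokesTop

/-! ### The first variation -/

section Parametric

open MeasureTheory

/-- Differentiation under the integral: on the compact set [-1, 1] × K the derivative is bounded by
a constant, which is integrable because K has finite measure. -/
theorem hasDerivAt_setIntegral_of_continuousOn {S : Type*} [TopologicalSpace S] [T2Space S]
    [MeasurableSpace S] [BorelSpace S] (μ : Measure S) [IsLocallyFiniteMeasure μ]
    {q q' : ℝ → S → ℝ} {K : Set S} (hK : IsCompact K)
    (hq : ∀ ε, ContinuousOn (q ε) K)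
    (hq' : ContinuousOn (Function.uncurry q') (univ ×ˢ K))
    (hd : ∀ ε, ∀ y ∈ K, HasDerivAt (fun ε => q ε y) (q' ε y) ε) :
    HasDerivAt (fun ε => ∫ y in K, q ε y ∂μ) (∫ y in K, q' 0 y ∂μ) 0 := by
  obtain ⟨C, hC⟩ := (isCompact_Icc (a := (-1 : ℝ)) (b := 1)).prod hK
    |>.exists_bound_of_continuousOn (hq'.mono (prod_mono_left (subset_univ _)))
  have hm := hK.isClosed.measurableSet
  have hKm : μ K ≠ ⊤ := hK.measure_lt_top.ne
  refine (hasDerivAt_integral_of_dominated_loc_of_deriv_le (μ := μ.restrict K)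
    (F := q) (F' := q') (bound := fun _ => C) (s := Ioo (-1) 1) (Ioo_mem_nhds (by simp) (by simp))
    ?_ ?_ ?_ ?_ ?_ ?_).2
  · exact Filter.Eventually.of_forall fun ε => (hq ε).aestronglyMeasurable hm
  · exact (hq 0).integrableOn_compact hK
  · refine ContinuousOn.aestronglyMeasurable ?_ hm
    exact hq'.comp (f := fun y : S => ((0 : ℝ), y)) (by fun_prop) fun y hy => ⟨mem_univ _, hy⟩
  · filter_upwards [ae_restrict_mem hm] with y hy ε hε
    exact hC (ε, y) ⟨Ioo_subset_Icc_self hε, hy⟩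
  · exact integrableOn_const hKm
  · filter_upwards [ae_restrict_mem hm] with y hy ε hε
    exact hd ε y hy

end Parametric

/-! ### The density of the deformed section as a smooth function of the parameter and the base point
-/

section Variation

open MeasureTheory

variable {m : ℕ} {S : Type*} [TopologicalSpace S]
  [ChartedSpace (EuclideanSpace ℝ (Fin (m + 1))) S]
  [IsManifold 𝓘(ℝ, EuclideanSpace ℝ (Fin (m + 1))) ∞ S]
  {V P : Type*} [NormedAddCommGroup V] [NormedSpace ℝ V] [FiniteDimensional ℝ V]
  [TopologicalSpace P] [ChartedSpace V P] [IsManifold 𝓘(ℝ, V) ∞ P]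

/-- The deformation `σ_ε ∘ Ψ` of a map `Ψ`, in the chart of the source at `x`. -/
def deformation (σ : ℝ → P → P) (Ψ : S → P) (x : S)
    (z : ℝ × EuclideanSpace ℝ (Fin (m + 1))) : P :=
  σ z.1 (Ψ ((chartAt (EuclideanSpace ℝ (Fin (m + 1))) x).symm z.2))

variable {σ : ℝ → P → P} {Ψ : S → P} {U : Set S} {X : ∀ z : P, TangentSpace 𝓘(ℝ, V) z}
  {Θ : DiffForm V P (m + 1)}

theorem contMDiffAt_deformation
    (hσ : ContMDiff (𝓘(ℝ, ℝ).prod 𝓘(ℝ, V)) 𝓘(ℝ, V) ∞ (Function.uncurry σ)) (hU : IsOpen U)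
    (hΨ : ContMDiffOn 𝓘(ℝ, EuclideanSpace ℝ (Fin (m + 1))) 𝓘(ℝ, V) ∞ Ψ U) (x : S)
    {z : ℝ × EuclideanSpace ℝ (Fin (m + 1))}
    (hz : z.2 ∈ (chartAt (EuclideanSpace ℝ (Fin (m + 1))) x).target)
    (hzU : (chartAt (EuclideanSpace ℝ (Fin (m + 1))) x).symm z.2 ∈ U) :
    ContMDiffAt 𝓘(ℝ, ℝ × EuclideanSpace ℝ (Fin (m + 1))) 𝓘(ℝ, V) ∞ (deformation σ Ψ x) z := by
  have h1 : ContMDiffAt 𝓘(ℝ, EuclideanSpace ℝ (Fin (m + 1))) 𝓘(ℝ, V) ∞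
      (Ψ ∘ (chartAt (EuclideanSpace ℝ (Fin (m + 1))) x).symm) z.2 :=
    (hΨ.contMDiffAt (hU.mem_nhds hzU)).comp _ (contMDiffOn_chart_symm.contMDiffAt
      ((chartAt (EuclideanSpace ℝ (Fin (m + 1))) x).open_target.mem_nhds hz))
  have h2 : ContMDiffAt 𝓘(ℝ, ℝ × EuclideanSpace ℝ (Fin (m + 1))) 𝓘(ℝ, V) ∞
      (fun z : ℝ × EuclideanSpace ℝ (Fin (m + 1)) =>
        Ψ ((chartAt (EuclideanSpace ℝ (Fin (m + 1))) x).symm z.2)) z :=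
    h1.comp (f := Prod.snd) z contDiff_snd.contMDiff.contMDiffAt
  exact hσ.contMDiffAt.comp z ((contDiff_fst.contMDiff.contMDiffAt).prodMk h2)

variable (hσ : ContMDiff (𝓘(ℝ, ℝ).prod 𝓘(ℝ, V)) 𝓘(ℝ, V) ∞ (Function.uncurry σ)) (hU : IsOpen U)
  (hΨ : ContMDiffOn 𝓘(ℝ, EuclideanSpace ℝ (Fin (m + 1))) 𝓘(ℝ, V) ∞ Ψ U)

include hσ hU hΨ

theorem mfderiv_deformation_snd (x : S) (ε : ℝ) {u : EuclideanSpace ℝ (Fin (m + 1))}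
    (hu : u ∈ (chartAt (EuclideanSpace ℝ (Fin (m + 1))) x).target)
    (huU : (chartAt (EuclideanSpace ℝ (Fin (m + 1))) x).symm u ∈ U)
    (v : EuclideanSpace ℝ (Fin (m + 1))) :
    (mfderiv 𝓘(ℝ, ℝ × EuclideanSpace ℝ (Fin (m + 1))) 𝓘(ℝ, V) (deformation σ Ψ x) (ε, u) (0, v) :
        V) =
      mfderiv 𝓘(ℝ, EuclideanSpace ℝ (Fin (m + 1))) 𝓘(ℝ, V)
        ((σ ε ∘ Ψ) ∘ (chartAt (EuclideanSpace ℝ (Fin (m + 1))) x).symm) u v := by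
  have hg := (contMDiffAt_deformation hσ hU hΨ x (z := (ε, u)) hu huU).mdifferentiableAt (by simp)
  have hi : HasFDerivAt (fun u : EuclideanSpace ℝ (Fin (m + 1)) => (ε, u))
      (ContinuousLinearMap.inr ℝ ℝ (EuclideanSpace ℝ (Fin (m + 1)))) u := hasFDerivAt_prodMk_right ε u
  have h := hg.hasMFDerivAt.comp u hi.hasMFDerivAt
  exact (DFunLike.congr_fun h.mfderiv v).symm

/-- The parameter derivative of the deformation at ε = 0 is X along Ψ; later it identifies the
contraction with ∂_ε as the contraction with X. -/
theorem mfderiv_deformation_fst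
    (hX : ∀ z, HasMFDerivAt 𝓘(ℝ, ℝ) 𝓘(ℝ, V) (fun t => σ t z) 0
      ((1 : ℝ →L[ℝ] ℝ).smulRight (X z) : ℝ →L[ℝ] V)) (x : S)
    {u : EuclideanSpace ℝ (Fin (m + 1))}
    (hu : u ∈ (chartAt (EuclideanSpace ℝ (Fin (m + 1))) x).target)
    (huU : (chartAt (EuclideanSpace ℝ (Fin (m + 1))) x).symm u ∈ U) :
    (mfderiv 𝓘(ℝ, ℝ × EuclideanSpace ℝ (Fin (m + 1))) 𝓘(ℝ, V) (deformation σ Ψ x) (0, u) (1, 0) :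
        V) = X (Ψ ((chartAt (EuclideanSpace ℝ (Fin (m + 1))) x).symm u)) := by
  have hg := (contMDiffAt_deformation hσ hU hΨ x (z := (0, u)) hu huU).mdifferentiableAt (by simp)
  have hi : HasFDerivAt (fun t : ℝ => (t, u))
      (ContinuousLinearMap.inl ℝ ℝ (EuclideanSpace ℝ (Fin (m + 1)))) 0 := hasFDerivAt_prodMk_left 0 u
  have h := hg.hasMFDerivAt.comp (0 : ℝ) hi.hasMFDerivAt
  have h2 := (hX (Ψ ((chartAt (EuclideanSpace ℝ (Fin (m + 1))) x).symm u))).mfderiv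
  have h3 := DFunLike.congr_fun (h.mfderiv.symm.trans h2) (1 : ℝ)
  refine Eq.trans h3 ?_
  exact one_smul ℝ (X (Ψ ((chartAt (EuclideanSpace ℝ (Fin (m + 1))) x).symm u)) : V)

omit hσ hU hΨ

/-- The density of `(σ_ε ∘ Ψ)^* Θ` with respect to a volume form. -/
def pullbackDensity (vol : VolumeForm (EuclideanSpace ℝ (Fin (m + 1))) S (m + 1))
    (σ : ℝ → P → P) (Ψ : S → P) (Θ : DiffForm V P (m + 1)) (ε : ℝ) (y : S) : ℝ :=
  Θ.pullback (V := EuclideanSpace ℝ (Fin (m + 1))) (σ ε ∘ Ψ) y (stdFrame (m + 1)) /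
    vol.form y (stdFrame (m + 1))

/-- The density of `(σ_ε ∘ Ψ)^* Θ` with respect to a volume form, in the chart at `x`. -/
def chartDensity (vol : VolumeForm (EuclideanSpace ℝ (Fin (m + 1))) S (m + 1))
    (σ : ℝ → P → P) (Ψ : S → P) (Θ : DiffForm V P (m + 1)) (x : S)
    (z : ℝ × EuclideanSpace ℝ (Fin (m + 1))) : ℝ :=
  Θ.localForm (deformation σ Ψ x) z (fun i => (0, stdFrame (m + 1) i)) / vol.density x z.2

include hσ hU hΨ

theorem contDiffAt_chartDensity (vol : VolumeForm (EuclideanSpace ℝ (Fin (m + 1))) S (m + 1))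
    (hΘ : ∀ z, Θ.SmoothAt z) (x : S) {z : ℝ × EuclideanSpace ℝ (Fin (m + 1))}
    (hz : z.2 ∈ (chartAt (EuclideanSpace ℝ (Fin (m + 1))) x).target)
    (hzU : (chartAt (EuclideanSpace ℝ (Fin (m + 1))) x).symm z.2 ∈ U) :
    ContDiffAt ℝ ∞ (chartDensity vol σ Ψ Θ x) z := by
  have h1 := DiffForm.contDiffAt_localForm (hΘ _) (contMDiffAt_deformation hσ hU hΨ x hz hzU)
  have h2 : ContDiffAt ℝ ∞ (fun z : ℝ × EuclideanSpace ℝ (Fin (m + 1)) => vol.density x z.2) z :=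
    (vol.contDiffAt_density x hz).comp z contDiffAt_snd
  exact (contDiffAt_form_apply h1 fun _ => contDiffAt_const).div h2 (vol.density_ne_zero x hz)

/-- The pullbacks for all ε are restrictions to slices of one form on the product of ℝ with the
coordinate space, which makes the density jointly smooth in ε and u. -/
theorem pullbackDensity_eq (vol : VolumeForm (EuclideanSpace ℝ (Fin (m + 1))) S (m + 1))
    (x : S) (ε : ℝ) {u : EuclideanSpace ℝ (Fin (m + 1))}
    (hu : u ∈ (chartAt (EuclideanSpace ℝ (Fin (m + 1))) x).target)
    (huU : (chartAt (EuclideanSpace ℝ (Fin (m + 1))) x).symm u ∈ U) :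
    pullbackDensity vol σ Ψ Θ ε ((chartAt (EuclideanSpace ℝ (Fin (m + 1))) x).symm u) =
      chartDensity vol σ Ψ Θ x (ε, u) := by
  rw [pullbackDensity, vol.div_eq_inChart _ x hu, chartDensity]
  have h1 : MDifferentiableAt 𝓘(ℝ, EuclideanSpace ℝ (Fin (m + 1)))
      𝓘(ℝ, EuclideanSpace ℝ (Fin (m + 1)))
      (chartAt (EuclideanSpace ℝ (Fin (m + 1))) x).symm u :=
    (contMDiffOn_chart_symm.contMDiffAt ((chartAt (EuclideanSpace ℝ (Fin (m + 1))) x).open_target.mem_nhds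
      hu)).mdifferentiableAt (n := ∞) (by simp)
  have hσε : ContMDiff 𝓘(ℝ, V) 𝓘(ℝ, V) ∞ (σ ε) :=
    hσ.comp (contMDiff_const.prodMk contMDiff_id)
  have h2 : MDifferentiableAt 𝓘(ℝ, EuclideanSpace ℝ (Fin (m + 1))) 𝓘(ℝ, V) (σ ε ∘ Ψ)
      ((chartAt (EuclideanSpace ℝ (Fin (m + 1))) x).symm u) :=
    (hσε.contMDiffAt.comp _ (hΨ.contMDiffAt (hU.mem_nhds huU))).mdifferentiableAt (by simp)
  have h3 := DiffForm.localForm_pullback Θ h2 h1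
  rw [DiffForm.inChart_eq_localForm, h3, DiffForm.localForm_apply, DiffForm.localForm_apply]
  congr 1
  refine congrArg (Θ _) ?_
  funext i
  exact (mfderiv_deformation_snd hσ hU hΨ x ε hu huU _).symm

theorem pullbackDensity_eventuallyEq (vol : VolumeForm (EuclideanSpace ℝ (Fin (m + 1))) S (m + 1))
    {x : S} (hx : x ∈ U) : ∀ᶠ y in 𝓝 x, ∀ ε, pullbackDensity vol σ Ψ Θ ε y =
      chartDensity vol σ Ψ Θ x (ε, chartAt (EuclideanSpace ℝ (Fin (m + 1))) x y) := by
  filter_upwards [hU.mem_nhds hx, (chartAt (EuclideanSpace ℝ (Fin (m + 1))) x).open_source.mem_nhds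
    (mem_chart_source _ x)] with y hy hys ε
  have h := pullbackDensity_eq (Θ := Θ) hσ hU hΨ vol x ε
    ((chartAt (EuclideanSpace ℝ (Fin (m + 1))) x).map_source hys)
    (by rwa [(chartAt (EuclideanSpace ℝ (Fin (m + 1))) x).left_inv hys])
  rwa [(chartAt (EuclideanSpace ℝ (Fin (m + 1))) x).left_inv hys] at h

theorem continuousOn_pullbackDensity
    (vol : VolumeForm (EuclideanSpace ℝ (Fin (m + 1))) S (m + 1)) (hΘ : ∀ z, Θ.SmoothAt z) (ε : ℝ) :
    ContinuousOn (pullbackDensity vol σ Ψ Θ ε) U := by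
  intro x hx
  refine ContinuousAt.continuousWithinAt ?_
  have h := pullbackDensity_eventuallyEq (Θ := Θ) hσ hU hΨ vol hx
  refine ContinuousAt.congr ?_ (h.mono fun y hy => (hy ε).symm)
  have hxs := mem_chart_source (EuclideanSpace ℝ (Fin (m + 1))) x
  refine ContinuousAt.comp (g := chartDensity vol σ Ψ Θ x)
    (f := fun y => (ε, chartAt (EuclideanSpace ℝ (Fin (m + 1))) x y)) ?_ ?_
  · refine (contDiffAt_chartDensity hσ hU hΨ vol hΘ x (z := (ε, _)) (mem_chart_target _ x)
      ?_).continuousAt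
    change (chartAt (EuclideanSpace ℝ (Fin (m + 1))) x).symm
      (chartAt (EuclideanSpace ℝ (Fin (m + 1))) x x) ∈ U
    rwa [(chartAt (EuclideanSpace ℝ (Fin (m + 1))) x).left_inv hxs]
  · exact continuousAt_const.prodMk
      ((chartAt (EuclideanSpace ℝ (Fin (m + 1))) x).continuousAt hxs)

theorem hasDerivAt_pullbackDensity_of_chart
    (vol : VolumeForm (EuclideanSpace ℝ (Fin (m + 1))) S (m + 1)) (hΘ : ∀ z, Θ.SmoothAt z)
    (x : S) (ε : ℝ) {u : EuclideanSpace ℝ (Fin (m + 1))}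
    (hu : u ∈ (chartAt (EuclideanSpace ℝ (Fin (m + 1))) x).target)
    (huU : (chartAt (EuclideanSpace ℝ (Fin (m + 1))) x).symm u ∈ U) :
    HasDerivAt (fun ε => pullbackDensity vol σ Ψ Θ ε
        ((chartAt (EuclideanSpace ℝ (Fin (m + 1))) x).symm u))
      (fderiv ℝ (chartDensity vol σ Ψ Θ x) (ε, u) (1, 0)) ε := by
  have h1 : (fun ε => pullbackDensity vol σ Ψ Θ ε
      ((chartAt (EuclideanSpace ℝ (Fin (m + 1))) x).symm u)) =
      fun ε => chartDensity vol σ Ψ Θ x (ε, u) := by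
    funext ε
    exact pullbackDensity_eq (Θ := Θ) hσ hU hΨ vol x ε hu huU
  rw [h1]
  have h2 := ((contDiffAt_chartDensity hσ hU hΨ vol hΘ x (z := (ε, u)) hu huU).differentiableAt
    (by simp)).hasFDerivAt
  exact h2.comp_hasDerivAt (f := fun ε : ℝ => (ε, u)) ε
    ((hasDerivAt_id ε).prodMk (hasDerivAt_const ε u))

theorem hasDerivAt_pullbackDensity
    (vol : VolumeForm (EuclideanSpace ℝ (Fin (m + 1))) S (m + 1)) (hΘ : ∀ z, Θ.SmoothAt z)
    (ε : ℝ) {y : S} (hy : y ∈ U) :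
    HasDerivAt (fun ε => pullbackDensity vol σ Ψ Θ ε y)
      (deriv (fun ε => pullbackDensity vol σ Ψ Θ ε y) ε) ε := by
  have hys := mem_chart_source (EuclideanSpace ℝ (Fin (m + 1))) y
  have hl := (chartAt (EuclideanSpace ℝ (Fin (m + 1))) y).left_inv hys
  have h := hasDerivAt_pullbackDensity_of_chart (Θ := Θ) hσ hU hΨ vol hΘ y ε
    (mem_chart_target _ y) (by rwa [hl])
  rw [hl] at h
  exact h.differentiableAt.hasDerivAt

/-- Joint continuity in ε and y supplies the uniform bound required to differentiate under the
integral. -/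
theorem continuousOn_deriv_pullbackDensity
    (vol : VolumeForm (EuclideanSpace ℝ (Fin (m + 1))) S (m + 1)) (hΘ : ∀ z, Θ.SmoothAt z) :
    ContinuousOn (Function.uncurry fun ε y => deriv (fun ε => pullbackDensity vol σ Ψ Θ ε y) ε)
      (univ ×ˢ U) := by
  rintro ⟨ε, x⟩ ⟨-, hx⟩
  refine ContinuousAt.continuousWithinAt ?_
  have hxs := mem_chart_source (EuclideanSpace ℝ (Fin (m + 1))) x
  have hl := (chartAt (EuclideanSpace ℝ (Fin (m + 1))) x).left_inv hxs
  have h1 : ∀ᶠ p : ℝ × S in 𝓝 (ε, x), Function.uncurry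
      (fun ε y => deriv (fun ε => pullbackDensity vol σ Ψ Θ ε y) ε) p =
      fderiv ℝ (chartDensity vol σ Ψ Θ x)
        (p.1, chartAt (EuclideanSpace ℝ (Fin (m + 1))) x p.2) (1, 0) := by
    filter_upwards [continuousAt_snd.eventually (hU.mem_nhds hx), continuousAt_snd.eventually
      ((chartAt (EuclideanSpace ℝ (Fin (m + 1))) x).open_source.mem_nhds hxs)] with p hp hps
    have hlp := (chartAt (EuclideanSpace ℝ (Fin (m + 1))) x).left_inv hps
    have h := hasDerivAt_pullbackDensity_of_chart (Θ := Θ) hσ hU hΨ vol hΘ x p.1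
      ((chartAt (EuclideanSpace ℝ (Fin (m + 1))) x).map_source hps) (by rwa [hlp])
    rw [hlp] at h
    exact h.deriv
  refine ContinuousAt.congr ?_ (h1.mono fun _ h => h.symm)
  have h2 := contDiffAt_chartDensity hσ hU hΨ vol hΘ x
    (z := (ε, chartAt (EuclideanSpace ℝ (Fin (m + 1))) x x)) (mem_chart_target _ x)
    (by simpa only [hl] using hx)
  have h3 : ContinuousAt (fderiv ℝ (chartDensity vol σ Ψ Θ x))
      (ε, chartAt (EuclideanSpace ℝ (Fin (m + 1))) x x) :=
    (h2.fderiv_right (m := ∞) (by simp)).continuousAt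
  have h4 : ContinuousAt (fun p : ℝ × S =>
      (p.1, chartAt (EuclideanSpace ℝ (Fin (m + 1))) x p.2)) (ε, x) :=
    continuousAt_fst.prodMk
      (((chartAt (EuclideanSpace ℝ (Fin (m + 1))) x).continuousAt hxs).comp continuousAt_snd)
  exact (ContinuousAt.comp (x := (ε, x)) h3 h4).clm_apply continuousAt_const

theorem hasDerivAt_integral_pullback [T2Space S] [SecondCountableTopology S] [MeasurableSpace S]
    [BorelSpace S] (vol : VolumeForm (EuclideanSpace ℝ (Fin (m + 1))) S (m + 1))
    (hΘ : ∀ z, Θ.SmoothAt z) {K : Set S} (hK : IsCompact K) (hKU : K ⊆ U) :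
    HasDerivAt (fun ε => vol.integral K (Θ.pullback (σ ε ∘ Ψ)))
      (∫ y in K, deriv (fun ε => pullbackDensity vol σ Ψ Θ ε y) 0 ∂vol.measure) 0 :=
  hasDerivAt_setIntegral_of_continuousOn vol.measure
    (q := fun ε y => pullbackDensity vol σ Ψ Θ ε y) hK
    (fun ε => (continuousOn_pullbackDensity hσ hU hΨ vol hΘ ε).mono hKU)
    ((continuousOn_deriv_pullbackDensity hσ hU hΨ vol hΘ).mono (prod_mono_right hKU))
    (fun ε _ hy => hasDerivAt_pullbackDensity hσ hU hΨ vol hΘ ε (hKU hy))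

end Variation

/-! ### The first variation formula -/

section FirstVariation

open MeasureTheory

variable {m : ℕ} {S : Type*} [TopologicalSpace S]
  [ChartedSpace (EuclideanSpace ℝ (Fin (m + 1))) S]
  [IsManifold 𝓘(ℝ, EuclideanSpace ℝ (Fin (m + 1))) ∞ S]
  {V P : Type*} [NormedAddCommGroup V] [NormedSpace ℝ V] [FiniteDimensional ℝ V]
  [TopologicalSpace P] [ChartedSpace V P] [IsManifold 𝓘(ℝ, V) ∞ P]

/-- The form `Ψ^*(ι_X Ω)`. -/
def insertPullback {k : ℕ} (X : ∀ z : P, TangentSpace 𝓘(ℝ, V) z) (Ω : DiffForm V P (k + 1))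
    (Ψ : S → P) : DiffForm (EuclideanSpace ℝ (Fin (m + 1))) S k := fun y =>
  (ContinuousAlternatingMap.curryLeft (E := V) (Ω (Ψ y)) (X (Ψ y))).compContinuousLinearMap
    (mfderiv 𝓘(ℝ, EuclideanSpace ℝ (Fin (m + 1))) 𝓘(ℝ, V) Ψ y :
      EuclideanSpace ℝ (Fin (m + 1)) →L[ℝ] V)

open Classical in
/-- The form `Ψ^*(ι_X Θ)` on the domain `U` of `Ψ`, extended by zero. -/
def extendedInsertPullback {k : ℕ} (U : Set S) (X : ∀ z : P, TangentSpace 𝓘(ℝ, V) z)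
    (Ω : DiffForm V P (k + 1)) (Ψ : S → P) : DiffForm (EuclideanSpace ℝ (Fin (m + 1))) S k :=
  fun y => if y ∈ U then insertPullback X Ω Ψ y else 0

/-- The density of `Ψ^*(ι_X dΘ)` with respect to a volume form. -/
def variationDensity (vol : VolumeForm (EuclideanSpace ℝ (Fin (m + 1))) S (m + 1))
    (X : ∀ z : P, TangentSpace 𝓘(ℝ, V) z) (Θ : DiffForm V P (m + 1)) (Ψ : S → P) (y : S) : ℝ :=
  insertPullback X Θ.d Ψ y (stdFrame (m + 1)) / vol.form y (stdFrame (m + 1))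

/-- Expansion of the exterior derivative of a form on `ℝ × W` along `∂_t` and vectors in `W`. -/
theorem extDeriv_apply_cons_inl {W : Type*} [NormedAddCommGroup W] [NormedSpace ℝ W]
    {α : ℝ × W → (ℝ × W) [⋀^Fin (m + 1)]→L[ℝ] ℝ} {β : W → W [⋀^Fin m]→L[ℝ] ℝ} {t : ℝ} {u : W}
    (hα : DifferentiableAt ℝ α (t, u)) (hβ : DifferentiableAt ℝ β u)
    (hαβ : ∀ᶠ w in 𝓝 u, ∀ v : Fin m → W,
      β w v = α (t, w) (Fin.cons (α := fun _ => ℝ × W) (1, 0) fun i => (0, v i)))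
    (b : Fin (m + 1) → W) :
    extDeriv α (t, u) (Fin.cons (α := fun _ => ℝ × W) (1, 0) fun i => (0, b i)) =
      fderiv ℝ (fun z => α z fun i => (0, b i)) (t, u) (1, 0) - extDeriv β u b := by
  -- Cartan's formula for the constant field ∂_t. The term of index 0 is the derivative in t; the
  -- term of index j + 1 is the j-th term of dβ, and the shift of the index produces the minus sign.
  rw [extDeriv_apply hα, extDeriv_apply hβ, Fin.sum_univ_succ, sub_eq_add_neg,
    ← Finset.sum_neg_distrib]
  congr 1
  · have h : (0 : Fin (m + 1 + 1)).removeNth (α := fun _ => ℝ × W)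
        (Fin.cons (α := fun _ => ℝ × W) (1, 0) fun i => (0, b i)) = fun i => (0, b i) := by
      funext i
      simp [Fin.removeNth]
    rw [h]
    simp
  · refine Finset.sum_congr rfl fun j _ => ?_
    have h : j.succ.removeNth (α := fun _ => ℝ × W)
        (Fin.cons (α := fun _ => ℝ × W) (1, 0) fun i => (0, b i)) =
        Fin.cons (α := fun _ => ℝ × W) (1, 0) fun i => (0, j.removeNth b i) := by
      funext i
      refine Fin.cases ?_ (fun i => ?_) i
      · simp [Fin.removeNth]
      · simp [Fin.removeNth]
    rw [h, Fin.cons_succ]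
    have h1 : (fun w => β w (j.removeNth b)) =ᶠ[𝓝 u] (fun z => α z
        (Fin.cons (α := fun _ => ℝ × W) (1, 0) fun i => (0, j.removeNth b i))) ∘ fun w => (t, w) := by
      filter_upwards [hαβ] with w hw
      exact hw _
    have h2 : DifferentiableAt ℝ (fun z => α z
        (Fin.cons (α := fun _ => ℝ × W) (1, 0) fun i => (0, j.removeNth b i))) (t, u) :=
      (ContinuousAlternatingMap.apply ℝ (ℝ × W) ℝ _).differentiableAt.comp (f := α) _ hα
    rw [h1.fderiv_eq, (h2.hasFDerivAt.comp u (hasFDerivAt_prodMk_right t u)).fderiv]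
    simp [pow_succ]

variable {σ : ℝ → P → P} {Ψ : S → P} {U : Set S} {X : ∀ z : P, TangentSpace 𝓘(ℝ, V) z}
  {Θ : DiffForm V P (m + 1)}
  (hσ : ContMDiff (𝓘(ℝ, ℝ).prod 𝓘(ℝ, V)) 𝓘(ℝ, V) ∞ (Function.uncurry σ)) (hU : IsOpen U)
  (hΨ : ContMDiffOn 𝓘(ℝ, EuclideanSpace ℝ (Fin (m + 1))) 𝓘(ℝ, V) ∞ Ψ U)
  (hσ0 : ∀ z, σ 0 z = z)
  (hX : ∀ z, HasMFDerivAt 𝓘(ℝ, ℝ) 𝓘(ℝ, V) (fun t => σ t z) 0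
      ((1 : ℝ →L[ℝ] ℝ).smulRight (X z) : ℝ →L[ℝ] V))

include hσ hU hΨ hσ0 hX

/-- At ε = 0 the deformation sends ∂_ε to X and the base vectors to their images under Ψ, so
contracting the pulled back form with ∂_ε amounts to pulling back ι_X Ω. -/
theorem inChart_insertPullback {k : ℕ} (Ω : DiffForm V P (k + 1)) (x : S)
    {u : EuclideanSpace ℝ (Fin (m + 1))}
    (hu : u ∈ (chartAt (EuclideanSpace ℝ (Fin (m + 1))) x).target)
    (huU : (chartAt (EuclideanSpace ℝ (Fin (m + 1))) x).symm u ∈ U)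
    (v : Fin k → EuclideanSpace ℝ (Fin (m + 1))) :
    (insertPullback X Ω Ψ).inChart (chartAt (EuclideanSpace ℝ (Fin (m + 1))) x) u v =
      Ω.localForm (deformation σ Ψ x) (0, u)
        (Fin.cons (α := fun _ => ℝ × EuclideanSpace ℝ (Fin (m + 1))) (1, 0) fun i => (0, v i)) := by
  have h1 : MDifferentiableAt 𝓘(ℝ, EuclideanSpace ℝ (Fin (m + 1)))
      𝓘(ℝ, EuclideanSpace ℝ (Fin (m + 1)))
      (chartAt (EuclideanSpace ℝ (Fin (m + 1))) x).symm u :=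
    (contMDiffOn_chart_symm.contMDiffAt ((chartAt (EuclideanSpace ℝ (Fin (m + 1))) x).open_target.mem_nhds
      hu)).mdifferentiableAt (n := ∞) (by simp)
  have h2 : MDifferentiableAt 𝓘(ℝ, EuclideanSpace ℝ (Fin (m + 1))) 𝓘(ℝ, V) Ψ
      ((chartAt (EuclideanSpace ℝ (Fin (m + 1))) x).symm u) :=
    (hΨ.contMDiffAt (hU.mem_nhds huU)).mdifferentiableAt (by simp)
  have hid : σ 0 ∘ Ψ = Ψ := funext fun y => hσ0 _
  have hb : Ψ ((chartAt (EuclideanSpace ℝ (Fin (m + 1))) x).symm u) =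
      deformation σ Ψ x (0, u) := (hσ0 _).symm
  rw [DiffForm.localForm_apply]
  refine (congrArg (Ω (Ψ ((chartAt (EuclideanSpace ℝ (Fin (m + 1))) x).symm u))) ?_).trans
    (Ω.congr_base hb _)
  funext i
  refine Fin.cases ?_ (fun i => ?_) i
  · exact (mfderiv_deformation_fst hσ hU hΨ hX x hu huU).symm
  · have h3 := mfderiv_deformation_snd hσ hU hΨ x 0 hu huU (v i)
    rw [hid, mfderiv_comp u h2 h1] at h3
    exact h3.symm

/-- Cartan's formula for the pullback along the deformation: the first summand becomes Ψ^*(ι_X dΘ),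
the second is the exact term d Ψ^*(ι_X Θ). The density of vol does not depend on ε and only divides.
Smoothness of Ψ^*(ι_X Θ) is part of the same statement because that form is a slice of the smooth
form on the product. -/
theorem deriv_pullbackDensity_of_chart
    (vol : VolumeForm (EuclideanSpace ℝ (Fin (m + 1))) S (m + 1)) (hΘ : ∀ z, Θ.SmoothAt z)
    (x : S) {u : EuclideanSpace ℝ (Fin (m + 1))}
    (hu : u ∈ (chartAt (EuclideanSpace ℝ (Fin (m + 1))) x).target)
    (huU : (chartAt (EuclideanSpace ℝ (Fin (m + 1))) x).symm u ∈ U) :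
    ContDiffAt ℝ ∞ ((extendedInsertPullback U X Θ Ψ).inChart
      (chartAt (EuclideanSpace ℝ (Fin (m + 1))) x)) u ∧
    deriv (fun ε => pullbackDensity vol σ Ψ Θ ε
        ((chartAt (EuclideanSpace ℝ (Fin (m + 1))) x).symm u)) 0 =
      extDeriv (Θ.localForm (deformation σ Ψ x)) (0, u)
        (Fin.cons (α := fun _ => ℝ × EuclideanSpace ℝ (Fin (m + 1))) (1, 0)
          fun i => (0, stdFrame (m + 1) i)) / vol.density x u +
      extDeriv ((extendedInsertPullback U X Θ Ψ).inChart
        (chartAt (EuclideanSpace ℝ (Fin (m + 1))) x)) u (stdFrame (m + 1)) / vol.density x u := by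
  set e := chartAt (EuclideanSpace ℝ (Fin (m + 1))) x with he
  have hα := DiffForm.contDiffAt_localForm (hΘ _) (contMDiffAt_deformation hσ hU hΨ x
    (z := (0, u)) hu huU)
  have hev : ∀ᶠ w in 𝓝 u, ∀ v : Fin m → EuclideanSpace ℝ (Fin (m + 1)),
      (extendedInsertPullback U X Θ Ψ).inChart e w v =
        Θ.localForm (deformation σ Ψ x) (0, w)
          (Fin.cons (α := fun _ => ℝ × EuclideanSpace ℝ (Fin (m + 1))) (1, 0)
            fun i => (0, v i)) := by
    filter_upwards [e.open_target.mem_nhds hu, (e.continuousAt_symm hu).eventually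
      (hU.mem_nhds huU)] with w hw hwU v
    rw [← inChart_insertPullback hσ hU hΨ hσ0 hX Θ x hw hwU]
    change extendedInsertPullback U X Θ Ψ (e.symm w) _ = insertPullback X Θ Ψ (e.symm w) _
    have hwU' : e.symm w ∈ U := hwU
    rw [extendedInsertPullback, if_pos hwU']
  have hβ : ContDiffAt ℝ ∞ ((extendedInsertPullback U X Θ Ψ).inChart e) u := by
    refine contDiffAt_of_forall_apply fun v => ContDiffAt.congr_of_eventuallyEq ?_
      (hev.mono fun w hw => hw v)
    exact contDiffAt_form_apply (f := fun w => Θ.localForm (deformation σ Ψ x) (0, w))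
      (v := fun i _ => Fin.cons (α := fun _ => ℝ × EuclideanSpace ℝ (Fin (m + 1))) (1, 0)
        (fun i => (0, v i)) i) (hα.comp u (contDiffAt_const.prodMk contDiffAt_id))
      fun _ => contDiffAt_const
  refine ⟨hβ, ?_⟩
  rw [(hasDerivAt_pullbackDensity_of_chart (Θ := Θ) hσ hU hΨ vol hΘ x 0 hu huU).deriv,
    extDeriv_apply_cons_inl (hα.differentiableAt (by simp)) (hβ.differentiableAt (by simp)) hev,
    ← add_div, sub_add_cancel]
  have h1 : DifferentiableAt ℝ (fun z => Θ.localForm (deformation σ Ψ x) z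
      (fun i => (0, stdFrame (m + 1) i))) (0, u) :=
    (ContinuousAlternatingMap.apply ℝ (ℝ × EuclideanSpace ℝ (Fin (m + 1))) ℝ
      _).differentiableAt.comp (f := Θ.localForm (deformation σ Ψ x)) _
      (hα.differentiableAt (by simp))
  have h2 := h1.hasFDerivAt.comp_hasDerivAt (f := fun ε : ℝ => (ε, u)) 0
    ((hasDerivAt_id (0 : ℝ)).prodMk (hasDerivAt_const (0 : ℝ) u))
  have h3 := (hasDerivAt_pullbackDensity_of_chart (Θ := Θ) hσ hU hΨ vol hΘ x 0 hu huU).deriv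
  rw [← h3, ← (h2.div_const (vol.density x u)).deriv]
  congr 1
  funext ε
  exact pullbackDensity_eq (Θ := Θ) hσ hU hΨ vol x ε hu huU

omit hσ hU hΨ hσ0 hX in
theorem extendedInsertPullback_eq_zero {K : Set S} (hXK : ∀ y ∈ U, y ∉ K → X (Ψ y) = 0) {y : S}
    (hy : y ∉ K) : extendedInsertPullback (m := m) U X Θ Ψ y = 0 := by
  by_cases hyU : y ∈ U
  · rw [extendedInsertPullback, if_pos hyU]
    ext v
    change ContinuousAlternatingMap.curryLeft (E := V) (Θ (Ψ y)) (X (Ψ y)) _ = 0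
    exact ContinuousAlternatingMap.map_coord_zero (Θ (Ψ y)) (0 : Fin (m + 1)) (hXK y hyU hy)
  · rw [extendedInsertPullback, if_neg hyU]

/-- The extension by zero causes no break at the boundary of U: the form already vanishes off the
closed set K, and every point outside U has a neighbourhood that avoids K. -/
theorem smoothAt_extendedInsertPullback
    (vol : VolumeForm (EuclideanSpace ℝ (Fin (m + 1))) S (m + 1)) (hΘ : ∀ z, Θ.SmoothAt z)
    {K : Set S} (hK : IsClosed K)
    (hKU : K ⊆ U) (hXK : ∀ y ∈ U, y ∉ K → X (Ψ y) = 0) (x : S) :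
    DiffForm.SmoothAt (V := EuclideanSpace ℝ (Fin (m + 1)))
      (extendedInsertPullback U X Θ Ψ) x := by
  have hl := (chartAt (EuclideanSpace ℝ (Fin (m + 1))) x).left_inv (mem_chart_source _ x)
  by_cases hx : x ∈ U
  · exact (deriv_pullbackDensity_of_chart hσ hU hΨ hσ0 hX vol hΘ x (mem_chart_target _ x)
      (by rwa [hl])).1
  · have hxK : x ∈ Kᶜ := fun h => hx (hKU h)
    have h1 : ContinuousAt (chartAt (EuclideanSpace ℝ (Fin (m + 1))) x).symm
        (chartAt (EuclideanSpace ℝ (Fin (m + 1))) x x) :=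
      (chartAt (EuclideanSpace ℝ (Fin (m + 1))) x).continuousAt_symm (mem_chart_target _ x)
    refine (contDiffAt_const (c := (0 : EuclideanSpace ℝ (Fin (m + 1)) [⋀^Fin m]→L[ℝ] ℝ))
      ).congr_of_eventuallyEq ?_
    filter_upwards [h1.eventually (hK.isOpen_compl.mem_nhds (by rwa [hl]))] with u hu
    ext v
    change extendedInsertPullback U X Θ Ψ
      ((chartAt (EuclideanSpace ℝ (Fin (m + 1))) x).symm u) _ = 0
    rw [extendedInsertPullback_eq_zero hXK hu]
    rfl

/-- d commutes with the pullback along the deformation, so dΘ contracted with X is d of the pulled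
back form contracted with ∂_ε. -/
theorem variationDensity_eq_of_chart
    (vol : VolumeForm (EuclideanSpace ℝ (Fin (m + 1))) S (m + 1)) (hΘ : ∀ z, Θ.SmoothAt z)
    (x : S) {u : EuclideanSpace ℝ (Fin (m + 1))}
    (hu : u ∈ (chartAt (EuclideanSpace ℝ (Fin (m + 1))) x).target)
    (huU : (chartAt (EuclideanSpace ℝ (Fin (m + 1))) x).symm u ∈ U) :
    variationDensity vol X Θ Ψ ((chartAt (EuclideanSpace ℝ (Fin (m + 1))) x).symm u) =
      extDeriv (Θ.localForm (deformation σ Ψ x)) (0, u)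
        (Fin.cons (α := fun _ => ℝ × EuclideanSpace ℝ (Fin (m + 1))) (1, 0)
          fun i => (0, stdFrame (m + 1) i)) / vol.density x u := by
  rw [variationDensity, vol.div_eq_inChart _ x hu,
    inChart_insertPullback hσ hU hΨ hσ0 hX Θ.d x hu huU,
    DiffForm.extDeriv_localForm (hΘ _) (contMDiffAt_deformation hσ hU hΨ x (z := (0, u)) hu huU)]

theorem continuousOn_variationDensity
    (vol : VolumeForm (EuclideanSpace ℝ (Fin (m + 1))) S (m + 1)) (hΘ : ∀ z, Θ.SmoothAt z) :
    ContinuousOn (variationDensity vol X Θ Ψ) U := by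
  intro x hx
  refine ContinuousAt.continuousWithinAt ?_
  set e := chartAt (EuclideanSpace ℝ (Fin (m + 1))) x with he
  have hxs : x ∈ e.source := mem_chart_source _ x
  have hl := e.left_inv hxs
  have h1 : variationDensity vol X Θ Ψ =ᶠ[𝓝 x] (fun u =>
      extDeriv (Θ.localForm (deformation σ Ψ x)) (0, u)
        (Fin.cons (α := fun _ => ℝ × EuclideanSpace ℝ (Fin (m + 1))) (1, 0)
          fun i => (0, stdFrame (m + 1) i)) / vol.density x u) ∘ e := by
    filter_upwards [hU.mem_nhds hx, e.open_source.mem_nhds hxs] with y hy hys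
    have h := variationDensity_eq_of_chart hσ hU hΨ hσ0 hX vol hΘ x (e.map_source hys)
      (by rwa [e.left_inv hys])
    rwa [e.left_inv hys] at h
  refine ContinuousAt.congr ?_ h1.symm
  refine ContinuousAt.comp ?_ (e.continuousAt hxs)
  have hα := DiffForm.contDiffAt_localForm (hΘ _) (contMDiffAt_deformation hσ hU hΨ x
    (z := (0, e x)) (e.map_source hxs) (by rwa [hl]))
  have h2 : ContDiffAt ℝ ∞ (fun u => extDeriv (Θ.localForm (deformation σ Ψ x)) (0, u)) (e x) :=
    (ContDiffAt.extDeriv_infty hα).comp (e x) (contDiffAt_const.prodMk contDiffAt_id)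
  exact (contDiffAt_form_apply (v := fun i _ =>
      Fin.cons (α := fun _ => ℝ × EuclideanSpace ℝ (Fin (m + 1))) (1, 0)
        (fun i => (0, stdFrame (m + 1) i)) i) h2 fun _ => contDiffAt_const).continuousAt.div
    (vol.contDiffAt_density x (e.map_source hxs)).continuousAt
    (vol.density_ne_zero x (e.map_source hxs))

/-- The first variation formula. -/
theorem hasDerivAt_integral_pullback_of_support [T2Space S] [SecondCountableTopology S]
    [MeasurableSpace S] [BorelSpace S]
    (vol : VolumeForm (EuclideanSpace ℝ (Fin (m + 1))) S (m + 1)) (hΘ : ∀ z, Θ.SmoothAt z)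
    {K K' : Set S} (hK : IsCompact K) (hKU : K ⊆ U) (hK' : IsCompact K') (hKK' : K' ⊆ K)
    (hXK : ∀ y ∈ U, y ∉ K' → X (Ψ y) = 0) :
    HasDerivAt (fun ε => vol.integral K (Θ.pullback (σ ε ∘ Ψ)))
      (∫ y in K, variationDensity vol X Θ Ψ y ∂vol.measure) 0 := by
  have h := hasDerivAt_integral_pullback hσ hU hΨ vol hΘ hK hKU
  convert h using 1
  have hβ := smoothAt_extendedInsertPullback hσ hU hΨ hσ0 hX vol hΘ hK'.isClosed
    (hKK'.trans hKU) hXK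
  have hβK : ∀ y ∉ K', extendedInsertPullback U X Θ Ψ y = 0 := fun y hy =>
    extendedInsertPullback_eq_zero hXK hy
  -- The form is supported in K', inside K, so the integral over K is the integral over the whole
  -- base, and Stokes applies without a boundary term.
  have h0 : ∫ y in K, vol.divergence (extendedInsertPullback U X Θ Ψ) y ∂vol.measure = 0 := by
    rw [setIntegral_eq_integral_of_forall_compl_eq_zero, vol.integral_divergence hβ hK' hβK]
    intro y hy
    refine vol.divergence_eq_zero ?_
    filter_upwards [hK'.isClosed.isOpen_compl.mem_nhds fun h => hy (hKK' h)] with z hz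
    exact hβK z hz
  have h1 : ∀ y ∈ K, deriv (fun ε => pullbackDensity vol σ Ψ Θ ε y) 0 =
      variationDensity vol X Θ Ψ y + vol.divergence (extendedInsertPullback U X Θ Ψ) y := by
    intro y hy
    have hys := mem_chart_source (EuclideanSpace ℝ (Fin (m + 1))) y
    have hl := (chartAt (EuclideanSpace ℝ (Fin (m + 1))) y).left_inv hys
    have hyU : (chartAt (EuclideanSpace ℝ (Fin (m + 1))) y).symm
        (chartAt (EuclideanSpace ℝ (Fin (m + 1))) y y) ∈ U := by
      rw [hl]
      exact hKU hy
    have h2 := (deriv_pullbackDensity_of_chart hσ hU hΨ hσ0 hX vol hΘ y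
      (mem_chart_target _ y) hyU).2
    rw [← variationDensity_eq_of_chart hσ hU hΨ hσ0 hX vol hΘ y (mem_chart_target _ y) hyU,
      ← vol.divergence_eq y (mem_chart_target _ y) (hβ _), hl] at h2
    exact h2
  rw [setIntegral_congr_fun hK.isClosed.measurableSet h1, integral_add, h0, add_zero]
  · exact ((continuousOn_variationDensity hσ hU hΨ hσ0 hX vol hΘ).mono
      hKU).integrableOn_compact hK
  · exact ((vol.continuous_divergence hβ).continuousOn).integrableOn_compact hK

end FirstVariation

/-! ### Compactly supported one-parameter groups in coordinates -/

section Rotation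

variable {Y : Type*} [NormedAddCommGroup Y] [InnerProductSpace ℝ Y]

/-- The rotation by the angle `θ` in the plane spanned by two orthonormal vectors. -/
def planeRotation (e v : Y) (θ : ℝ) (y : Y) : Y :=
  y + (inner ℝ e y * (Real.cos θ - 1) - inner ℝ v y * Real.sin θ) • e +
    (inner ℝ e y * Real.sin θ + inner ℝ v y * (Real.cos θ - 1)) • v

theorem planeRotation_zero (e v y : Y) : planeRotation e v 0 y = y := by
  simp [planeRotation]

variable {e v : Y} (he : inner ℝ e e = (1 : ℝ)) (hv : inner ℝ v v = (1 : ℝ))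
  (hev : inner ℝ e v = (0 : ℝ))

include he hv hev

theorem inner_planeRotation_left (θ : ℝ) (y : Y) : inner ℝ e (planeRotation e v θ y) =
    inner ℝ e y * Real.cos θ - inner ℝ v y * Real.sin θ := by
  simp only [planeRotation, inner_add_right, real_inner_smul_right, he, hev]
  ring

theorem inner_planeRotation_right (θ : ℝ) (y : Y) : inner ℝ v (planeRotation e v θ y) =
    inner ℝ e y * Real.sin θ + inner ℝ v y * Real.cos θ := by
  have hve : inner ℝ v e = (0 : ℝ) := by rw [real_inner_comm, hev]
  simp only [planeRotation, inner_add_right, real_inner_smul_right, hv, hve]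
  ring

/-- The addition theorems for sine and cosine, applied to the components along e and v. -/
theorem planeRotation_add (s t : ℝ) (y : Y) :
    planeRotation e v (s + t) y = planeRotation e v s (planeRotation e v t y) := by
  conv_rhs => rw [planeRotation, inner_planeRotation_left he hv hev,
    inner_planeRotation_right he hv hev, planeRotation]
  rw [planeRotation, Real.cos_add, Real.sin_add]
  module

/-- Invariance of the norm makes any angular speed that is a function of the norm constant along
orbits, so that the group law survives the modulation by a bump function. -/
theorem norm_planeRotation (θ : ℝ) (y : Y) : ‖planeRotation e v θ y‖ ^ 2 = ‖y‖ ^ 2 := by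
  have hy : ∀ z, inner ℝ (planeRotation e v θ y) z = inner ℝ y z +
      (inner ℝ e y * (Real.cos θ - 1) - inner ℝ v y * Real.sin θ) * inner ℝ e z +
      (inner ℝ e y * Real.sin θ + inner ℝ v y * (Real.cos θ - 1)) * inner ℝ v z := fun z => by
    simp only [planeRotation, inner_add_left, real_inner_smul_left]
  rw [← real_inner_self_eq_norm_sq, ← real_inner_self_eq_norm_sq, hy,
    inner_planeRotation_left he hv hev, inner_planeRotation_right he hv hev, real_inner_comm, hy]
  have h := Real.sin_sq_add_cos_sq θ
  linear_combination ((inner ℝ e y) ^ 2 + (inner ℝ v y) ^ 2) * h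

omit he hv hev

theorem contDiff_planeRotation (e v : Y) :
    ContDiff ℝ ∞ (fun p : ℝ × Y => planeRotation e v p.1 p.2) := by
  unfold planeRotation
  have h1 : ContDiff ℝ ∞ (fun p : ℝ × Y => (inner ℝ e p.2 : ℝ)) :=
    contDiff_const.inner ℝ contDiff_snd
  have h2 : ContDiff ℝ ∞ (fun p : ℝ × Y => (inner ℝ v p.2 : ℝ)) :=
    contDiff_const.inner ℝ contDiff_snd
  have h3 : ContDiff ℝ ∞ (fun p : ℝ × Y => Real.cos p.1) := Real.contDiff_cos.comp contDiff_fst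
  have h4 : ContDiff ℝ ∞ (fun p : ℝ × Y => Real.sin p.1) := Real.contDiff_sin.comp contDiff_fst
  exact (contDiff_snd.add (((h1.mul (h3.sub contDiff_const)).sub (h2.mul h4)).smul
    contDiff_const)).add (((h1.mul h4).add (h2.mul (h3.sub contDiff_const))).smul contDiff_const)

include he hev in
theorem hasDerivAt_planeRotation (c r : ℝ) :
    HasDerivAt (fun t : ℝ => planeRotation e v (t * c) (r • e)) ((r * c) • v) 0 := by
  have hve : inner ℝ v e = (0 : ℝ) := by rw [real_inner_comm, hev]
  simp only [planeRotation, real_inner_smul_right, he, hve, mul_one, mul_zero, zero_mul, sub_zero,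
    add_zero]
  have h0 : HasDerivAt (fun t : ℝ => t * c) c 0 := by simpa using (hasDerivAt_id (0 : ℝ)).mul_const c
  have h1 := h0.cos
  have h2 := h0.sin
  have h3 := (((hasDerivAt_const (0 : ℝ) (r • e)).add
    (((h1.sub_const 1).const_mul r).smul_const e))).add ((h2.const_mul r).smul_const v)
  exact h3.congr_deriv (by simp)

end Rotation

/-! ### Compactly supported one-parameter groups with prescribed velocity at a point -/

section ModelFlow

/-- A smooth one-parameter group of transformations of `V` that is the identity off `C`. -/
structure IsCompactFlow {V : Type*} [NormedAddCommGroup V] [NormedSpace ℝ V] (C : Set V)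
    (R : ℝ → V → V) : Prop where
  isCompact : IsCompact C
  contDiff : ContDiff ℝ ∞ (fun p : ℝ × V => R p.1 p.2)
  zero : ∀ p, R 0 p = p
  add : ∀ s t p, R (s + t) p = R s (R t p)
  eq_self : ∀ t, ∀ p ∉ C, R t p = p

/-- A point that left C would be fixed by all transformations, in particular by the inverse one, and
so could not have come from C. -/
theorem IsCompactFlow.mem {V : Type*} [NormedAddCommGroup V] [NormedSpace ℝ V] {C : Set V}
    {R : ℝ → V → V} (hR : IsCompactFlow C R) (t : ℝ) {p : V} (hp : p ∈ C) : R t p ∈ C := by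
  by_contra h
  have h1 := hR.eq_self (-t) _ h
  rw [← hR.add, neg_add_cancel, hR.zero] at h1
  rw [← h1] at h
  exact h hp

/-- Choose a unit vector e orthogonal to w, which exists in dimension at least 2, and rotate about c
= y₀ - r e in the plane of e and w. The point y₀ is at distance r from c in the direction e, so
angular speed ‖w‖ / r gives it exactly the velocity w. Bump functions of the A-coordinate and of the
distance to c localise the speed without destroying the group law. -/
theorem exists_compactFlow_inner {A Y : Type*} [NormedAddCommGroup A] [InnerProductSpace ℝ A]
    [FiniteDimensional ℝ A] [NormedAddCommGroup Y] [InnerProductSpace ℝ Y] [FiniteDimensional ℝ Y]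
    (hY : 2 ≤ Module.finrank ℝ Y) {O : Set (A × Y)} (hO : IsOpen O) {p₀ : A × Y} (hp₀ : p₀ ∈ O)
    {w : Y} (hw : w ≠ 0) :
    ∃ (C : Set (A × Y)) (R : ℝ → A × Y → A × Y), C ⊆ O ∧ IsCompactFlow C R ∧
      (∀ t p, (R t p).1 = p.1) ∧ HasDerivAt (fun t => R t p₀) (0, w) 0 := by
  obtain ⟨a₀, y₀⟩ := p₀
  -- The support will be a ball of radius 2r about c, and c is at distance r from y₀; hence the room
  -- of 3r.
  obtain ⟨r, hr, hrO⟩ : ∃ r : ℝ, 0 < r ∧ Metric.closedBall a₀ r ×ˢ Metric.closedBall y₀ (3 * r) ⊆ O := by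
    obtain ⟨δ, hδ, h⟩ := Metric.isOpen_iff.1 hO _ hp₀
    refine ⟨δ / 4, by positivity, fun p hp => h ?_⟩
    rw [Metric.mem_ball, Prod.dist_eq, max_lt_iff]
    have h1 := Metric.mem_closedBall.1 hp.1
    have h2 := Metric.mem_closedBall.1 hp.2
    exact ⟨by linarith, by linarith⟩
  obtain ⟨e, he, hew⟩ : ∃ e : Y, inner ℝ e e = (1 : ℝ) ∧ inner ℝ e w = (0 : ℝ) := by
    have h1 := Submodule.finrank_add_finrank_orthogonal (ℝ ∙ w)
    rw [finrank_span_singleton hw] at h1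
    have h2 : (ℝ ∙ w)ᗮ ≠ ⊥ := by
      intro h
      rw [h, finrank_bot] at h1
      omega
    obtain ⟨e, he, he0⟩ := Submodule.exists_mem_ne_zero_of_ne_bot h2
    have hn : ‖e‖ ≠ 0 := norm_ne_zero_iff.2 he0
    refine ⟨‖e‖⁻¹ • e, ?_, ?_⟩
    · rw [real_inner_smul_left, real_inner_smul_right, real_inner_self_eq_norm_sq]
      field_simp
    · rw [real_inner_smul_left, Submodule.mem_orthogonal_singleton_iff_inner_left.1 he, mul_zero]
  have hwn : ‖w‖ ≠ 0 := norm_ne_zero_iff.2 hw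
  set v : Y := ‖w‖⁻¹ • w with hvdef
  have hv : inner ℝ v v = (1 : ℝ) := by
    rw [hvdef, real_inner_smul_left, real_inner_smul_right, real_inner_self_eq_norm_sq]
    field_simp
  have hev : inner ℝ e v = (0 : ℝ) := by rw [hvdef, real_inner_smul_right, hew, mul_zero]
  have hen : ‖e‖ = 1 := by
    rw [real_inner_self_eq_norm_sq] at he
    nlinarith [norm_nonneg e]
  set c : Y := y₀ - r • e with hc
  let κ : ContDiffBump a₀ := ⟨r / 2, r, by positivity, by linarith⟩
  -- A function of the squared distance, for smoothness at the centre: it is 1 at r², the value at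
  -- y₀, and vanishes from 2r² on, in particular outside the ball of radius 2r.
  let ρ : ContDiffBump (r ^ 2) := ⟨r ^ 2 / 2, r ^ 2, by positivity, by nlinarith⟩
  let speed : A × Y → ℝ := fun p => (‖w‖ / r) * (κ p.1 * ρ (‖p.2 - c‖ ^ 2))
  let R : ℝ → A × Y → A × Y := fun t p =>
    (p.1, c + planeRotation e v (t * speed p) (p.2 - c))
  -- Orbits keep the A-coordinate and the distance to c, on which alone the speed depends.
  have hspeed : ∀ t p, speed (R t p) = speed p := by
    intro t p
    simp only [speed, R, add_sub_cancel_left, norm_planeRotation he hv hev]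
  have hy₀ : y₀ - c = r • e := by rw [hc]; abel
  refine ⟨Metric.closedBall a₀ r ×ˢ Metric.closedBall c (2 * r), R, ?_, ⟨?_, ?_, ?_, ?_, ?_⟩, ?_, ?_⟩
  · refine Subset.trans (prod_mono_right (Metric.closedBall_subset_closedBall' ?_)) hrO
    rw [dist_comm, dist_eq_norm, hy₀, norm_smul, hen, Real.norm_of_nonneg hr.le]
    linarith
  · exact (isCompact_closedBall _ _).prod (isCompact_closedBall _ _)
  · have h1 : ContDiff ℝ ∞ speed := by
      refine contDiff_const.mul ((κ.contDiff.comp contDiff_fst).mul (ρ.contDiff.comp ?_))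
      exact (contDiff_snd.sub contDiff_const).norm_sq ℝ
    refine (contDiff_fst.comp contDiff_snd).prodMk (contDiff_const.add ?_)
    exact (contDiff_planeRotation e v).comp
      ((contDiff_fst.mul (h1.comp contDiff_snd)).prodMk
        ((contDiff_snd.comp contDiff_snd).sub contDiff_const))
  · intro p
    simp [R, planeRotation_zero]
  · intro s t p
    have h1 : R s (R t p) = (p.1, c + planeRotation e v (s * speed (R t p)) ((R t p).2 - c)) := rfl
    rw [h1, hspeed]
    simp only [R, add_sub_cancel_left, add_mul, planeRotation_add he hv hev]
  · intro t p hp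
    have h0 : speed p = 0 := by
      rw [mem_prod, not_and_or] at hp
      rcases hp with hp | hp
      · have h2 : κ p.1 = 0 := κ.zero_of_le_dist (not_le.1 hp).le
        simp only [speed, h2, zero_mul, mul_zero]
      · have h3 : 2 * r < ‖p.2 - c‖ := by
          rw [← dist_eq_norm]
          exact not_le.1 hp
        have h2 : ρ (‖p.2 - c‖ ^ 2) = 0 := by
          refine ρ.zero_of_le_dist ?_
          change r ^ 2 ≤ _
          rw [Real.dist_eq, abs_of_nonneg (by nlinarith)]
          nlinarith
        simp only [speed, h2, mul_zero]
    simp [R, h0, planeRotation_zero]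
  · intro t p
    rfl
  · have h0 : speed (a₀, y₀) = ‖w‖ / r := by
      have h1 : κ a₀ = 1 := κ.one_of_mem_closedBall (Metric.mem_closedBall_self (by positivity))
      have h2 : ρ (r ^ 2) = 1 := ρ.one_of_mem_closedBall (Metric.mem_closedBall_self (by positivity))
      have h3 : ‖y₀ - c‖ ^ 2 = r ^ 2 := by
        rw [hy₀, norm_smul, hen, Real.norm_of_nonneg hr.le, mul_one]
      simp only [speed, h1, h3, h2, mul_one]
    have h1 := (hasDerivAt_planeRotation he hev (‖w‖ / r) r).const_add c
    have h2 := (hasDerivAt_const (0 : ℝ) a₀).prodMk h1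
    have h3 : (r * (‖w‖ / r)) • v = w := by
      rw [hvdef, smul_smul]
      have : r * (‖w‖ / r) * ‖w‖⁻¹ = 1 := by field_simp
      rw [this, one_smul]
    rw [h3] at h2
    simpa only [R, h0, hy₀] using h2

/-- Transport along a linear isomorphism of B × F with a Euclidean space. The A-coordinate is
untouched, which is why w must have none. -/
theorem exists_compactFlow {A B F : Type*} [NormedAddCommGroup A] [InnerProductSpace ℝ A]
    [FiniteDimensional ℝ A] [NormedAddCommGroup B] [NormedSpace ℝ B] [FiniteDimensional ℝ B]
    [NormedAddCommGroup F] [NormedSpace ℝ F] [FiniteDimensional ℝ F]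
    (hd : 2 ≤ Module.finrank ℝ B + Module.finrank ℝ F) {O : Set ((A × B) × F)} (hO : IsOpen O)
    {p₀ : (A × B) × F} (hp₀ : p₀ ∈ O) {w : (A × B) × F} (hw : w ≠ 0) (hw1 : w.1.1 = 0) :
    ∃ (C : Set ((A × B) × F)) (R : ℝ → (A × B) × F → (A × B) × F), C ⊆ O ∧ IsCompactFlow C R ∧
      (∀ t p, (R t p).1.1 = p.1.1) ∧ HasDerivAt (fun t => R t p₀) w 0 := by
  let d := Module.finrank ℝ (B × F)
  have hd' : d = Module.finrank ℝ B + Module.finrank ℝ F := Module.finrank_prod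
  let L : (B × F) ≃L[ℝ] EuclideanSpace ℝ (Fin d) :=
    ContinuousLinearEquiv.ofFinrankEq (by simp [d])
  let T : ((A × B) × F) ≃L[ℝ] A × EuclideanSpace ℝ (Fin d) :=
    (ContinuousLinearEquiv.prodAssoc ℝ A B F).trans
      ((ContinuousLinearEquiv.refl ℝ A).prodCongr L)
  have hT1 : ∀ p, (T p).1 = p.1.1 := fun p => rfl
  have hTs1 : ∀ q, (T.symm q).1.1 = q.1 := fun q => by
    rw [← hT1, T.apply_symm_apply]
  have hTw : (T w).2 ≠ 0 := by
    intro h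
    apply hw
    have : T w = 0 := Prod.ext (by rw [hT1, hw1]; rfl) h
    exact (map_eq_zero_iff T T.injective).1 this
  obtain ⟨C, R, hCO, hR, hR1, hR'⟩ := exists_compactFlow_inner (A := A)
    (Y := EuclideanSpace ℝ (Fin d)) (by rw [finrank_euclideanSpace_fin]; omega)
    (hO.preimage T.symm.continuous) (p₀ := T p₀) (by simpa using hp₀) hTw
  refine ⟨T.symm '' C, fun t p => T.symm (R t (T p)), ?_, ⟨?_, ?_, ?_, ?_, ?_⟩, ?_, ?_⟩
  · rintro _ ⟨q, hq, rfl⟩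
    exact hCO hq
  · exact hR.isCompact.image T.symm.continuous
  · exact T.symm.contDiff.comp (hR.contDiff.comp
      (contDiff_fst.prodMk (T.contDiff.comp contDiff_snd)))
  · intro p
    simp [hR.zero]
  · intro s t p
    simp [hR.add]
  · intro t p hp
    have h1 : T p ∉ C := fun h => hp ⟨T p, h, T.symm_apply_apply p⟩
    simp [hR.eq_self t _ h1]
  · intro t p
    rw [hTs1, hR1, hT1]
  · have h1 := (T.symm : _ →L[ℝ] (A × B) × F).hasFDerivAt.comp_hasDerivAt (0 : ℝ) hR'
    have h2 : T.symm (0, (T w).2) = w := by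
      rw [← T.symm_apply_apply w]
      congr 1
      rw [T.apply_symm_apply]
      exact Prod.ext (by rw [hT1, hw1]) rfl
    exact h2 ▸ h1

end ModelFlow

/-! ### Compactly supported vertical flows on manifolds -/

section ManifoldFlow

variable {A V : Type*} [NormedAddCommGroup A] [NormedSpace ℝ A]
  [NormedAddCommGroup V] [NormedSpace ℝ V] {S P : Type*} [TopologicalSpace S] [ChartedSpace A S]
  [TopologicalSpace P] [ChartedSpace V P] [IsManifold 𝓘(ℝ, V) ∞ P]

variable (A V) in
/-- A smooth one-parameter group of transformations of `P` that preserves the fibres of a map `τ`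
and is the identity off a compact set `C`. -/
structure IsVerticalFlow (τ : P → S) (C : Set P) (σ : ℝ → P → P) : Prop where
  isCompact : IsCompact C
  contMDiff : ContMDiff (𝓘(ℝ, ℝ).prod 𝓘(ℝ, V)) 𝓘(ℝ, V) ∞ (Function.uncurry σ)
  zero : ∀ z, σ 0 z = z
  add : ∀ s t z, σ (s + t) z = σ s (σ t z)
  eq_self : ∀ t, ∀ z ∉ C, σ t z = z
  tau : ∀ t z, τ (σ t z) = τ z

variable (V) in
/-- The vector field generated by a family of transformations. -/
def velocity (σ : ℝ → P → P) (z : P) : TangentSpace 𝓘(ℝ, V) z :=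
  (mfderiv 𝓘(ℝ, ℝ) 𝓘(ℝ, V) (fun t => σ t z) 0 (1 : ℝ) : V)

omit [IsManifold 𝓘(ℝ, V) ∞ P] in
theorem tangentBundle_mk_congr {z z' : P} (h : z = z') {v v' : V} (hv : v = v') :
    (⟨z, v⟩ : TangentBundle 𝓘(ℝ, V) P) = ⟨z', v'⟩ := by
  subst h hv
  rfl

variable {τ : P → S} {C : Set P} {σ : ℝ → P → P}

namespace IsVerticalFlow

theorem mdifferentiableAt (hσ : IsVerticalFlow V τ C σ) (z : P) (t : ℝ) :
    MDifferentiableAt 𝓘(ℝ, ℝ) 𝓘(ℝ, V) (fun t => σ t z) t :=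
  (hσ.contMDiff.comp (contMDiff_id.prodMk (contMDiff_const (c := z)))).mdifferentiableAt
    (n := ∞) (by simp)

theorem hasMFDerivAt_zero (hσ : IsVerticalFlow V τ C σ) (z : P) :
    HasMFDerivAt 𝓘(ℝ, ℝ) 𝓘(ℝ, V) (fun t => σ t z) 0
      ((1 : ℝ →L[ℝ] ℝ).smulRight (velocity V σ z) : ℝ →L[ℝ] V) := by
  have h := (hσ.mdifferentiableAt z 0).hasMFDerivAt
  refine h.congr_mfderiv ?_
  apply ContinuousLinearMap.ext_ring
  exact (one_smul ℝ (velocity V σ z : V)).symm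

/-- By the group law the curve near time t is the orbit of σ_t(z) near time 0, so the velocity at
time 0 determines all others. -/
theorem isMIntegralCurve (hσ : IsVerticalFlow V τ C σ) (z : P) :
    IsMIntegralCurve (I := 𝓘(ℝ, V)) (fun t => σ t z) (velocity V σ) := by
  intro t
  have h1 : (fun s => σ s z) = (fun s => σ s (σ t z)) ∘ fun s => s - t := by
    funext s
    simp [← hσ.add]
  have h2 : HasFDerivAt (fun s : ℝ => s - t) (ContinuousLinearMap.id ℝ ℝ) t :=
    (hasFDerivAt_id t).sub_const t
  have h3 : HasMFDerivAt 𝓘(ℝ, ℝ) 𝓘(ℝ, V) (fun s => σ s (σ t z)) ((fun s => s - t) t)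
      ((1 : ℝ →L[ℝ] ℝ).smulRight (velocity V σ (σ t z)) : ℝ →L[ℝ] V) := by
    rw [show (fun s : ℝ => s - t) t = 0 from sub_self t]
    exact hσ.hasMFDerivAt_zero (σ t z)
  have h4 := HasMFDerivAt.comp (f := fun s : ℝ => s - t) t h3 h2.hasMFDerivAt
  rw [← h1] at h4
  exact h4

/-- The generator is the tangent map of the smooth map (t, z) ↦ σ_t(z) applied to ∂_t at t = 0 and
the zero vector at z. -/
theorem contMDiff_velocity (hσ : IsVerticalFlow V τ C σ) :
    ContMDiff 𝓘(ℝ, V) 𝓘(ℝ, V).tangent ∞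
      (fun z => (⟨z, velocity V σ z⟩ : TangentBundle 𝓘(ℝ, V) P)) := by
  have h1 : ContMDiff (𝓘(ℝ, ℝ).prod 𝓘(ℝ, V)).tangent 𝓘(ℝ, V).tangent ∞
      (tangentMap (𝓘(ℝ, ℝ).prod 𝓘(ℝ, V)) 𝓘(ℝ, V) (Function.uncurry σ)) :=
    hσ.contMDiff.contMDiff_tangentMap (by simp)
  have h2 : ContMDiff 𝓘(ℝ, V) (𝓘(ℝ, ℝ).tangent.prod 𝓘(ℝ, V).tangent) ∞
      (fun z : P => ((⟨0, (1 : ℝ)⟩ : TangentBundle 𝓘(ℝ, ℝ) ℝ),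
        (⟨z, 0⟩ : TangentBundle 𝓘(ℝ, V) P))) :=
    contMDiff_const.prodMk (Bundle.contMDiff_zeroSection ℝ (TangentSpace 𝓘(ℝ, V) : P → Type _))
  have h3 := h1.comp ((contMDiff_equivTangentBundleProd_symm (I := 𝓘(ℝ, ℝ)) (M := ℝ)
    (I' := 𝓘(ℝ, V)) (M' := P) (n := ∞)).comp h2)
  refine h3.congr fun z => ?_
  have hd : MDifferentiableAt (𝓘(ℝ, ℝ).prod 𝓘(ℝ, V)) 𝓘(ℝ, V) (Function.uncurry σ) ((0 : ℝ), z) :=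
    hσ.contMDiff.mdifferentiableAt (by simp)
  have h4 : (mfderiv (𝓘(ℝ, ℝ).prod 𝓘(ℝ, V)) 𝓘(ℝ, V) (Function.uncurry σ) ((0 : ℝ), z)
      ((1 : ℝ), (0 : V)) : V) = velocity V σ z := by
    have h5 := mfderiv_prod_eq_add_apply (v := ((1 : ℝ), (0 : V))) hd
    refine Eq.trans h5 ?_
    refine (congrArg₂ (· + ·) rfl (map_zero (mfderiv 𝓘(ℝ, V) 𝓘(ℝ, V)
      (fun z' : P => Function.uncurry σ ((0 : ℝ), z')) z))).trans ?_
    exact add_zero (velocity V σ z : V)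
  exact tangentBundle_mk_congr (hσ.zero z).symm h4.symm

theorem velocity_eq_zero (hσ : IsVerticalFlow V τ C σ) {z : P} (hz : z ∉ C) :
    velocity V σ z = 0 := by
  have h : (fun t => σ t z) = fun _ => z := funext fun t => hσ.eq_self t z hz
  change (mfderiv 𝓘(ℝ, ℝ) 𝓘(ℝ, V) (fun t => σ t z) 0 (1 : ℝ) : V) = 0
  rw [h, mfderiv_const]
  rfl

theorem mfderiv_velocity (hσ : IsVerticalFlow V τ C σ)
    (hτ : ContMDiff 𝓘(ℝ, V) 𝓘(ℝ, A) ∞ τ) (z : P) :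
    mfderiv 𝓘(ℝ, V) 𝓘(ℝ, A) τ z (velocity V σ z) = 0 := by
  have h1 : MDifferentiableAt 𝓘(ℝ, V) 𝓘(ℝ, A) τ z := hτ.mdifferentiableAt (by simp)
  have h2 := hσ.hasMFDerivAt_zero z
  have h3 : HasMFDerivAt 𝓘(ℝ, V) 𝓘(ℝ, A) τ (σ 0 z) (mfderiv 𝓘(ℝ, V) 𝓘(ℝ, A) τ z : V →L[ℝ] A) := by
    rw [hσ.zero]
    exact h1.hasMFDerivAt
  have h4 := h3.comp (0 : ℝ) h2
  have h5 : τ ∘ (fun t => σ t z) = fun _ => τ z := funext fun t => hσ.tau t z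
  rw [h5] at h4
  have h6 := hasMFDerivAt_unique h4 (hasMFDerivAt_const (τ z) (0 : ℝ))
  have h7 := DFunLike.congr_fun h6 (1 : ℝ)
  have h8 : (mfderiv 𝓘(ℝ, V) 𝓘(ℝ, A) τ z ((1 : ℝ) • (velocity V σ z : V)) : A) = 0 := h7
  rw [one_smul] at h8
  exact h8

/-- χ ∘ τ is constant along the orbits of a flow that preserves the fibres, so slowing time by this
factor gives a flow again. Its generator is χ ∘ τ times the old one: this realises test functions on
the base by actual flows. -/
theorem scale (hσ : IsVerticalFlow V τ C σ) (hτ : ContMDiff 𝓘(ℝ, V) 𝓘(ℝ, A) ∞ τ) {χ : S → ℝ}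
    (hχ : ContMDiff 𝓘(ℝ, A) 𝓘(ℝ, ℝ) ∞ χ) :
    IsVerticalFlow V τ C (fun t z => σ (t * χ (τ z)) z) where
  isCompact := hσ.isCompact
  contMDiff := by
    refine hσ.contMDiff.comp (ContMDiff.prodMk ?_ contMDiff_snd)
    exact contMDiff_fst.mul ((hχ.comp hτ).comp contMDiff_snd)
  zero z := by simp [hσ.zero]
  add s t z := by
    simp only [hσ.tau]
    rw [← hσ.add, add_mul]
  eq_self t z hz := hσ.eq_self _ z hz
  tau t z := hσ.tau _ z

theorem velocity_scale (hσ : IsVerticalFlow V τ C σ) (χ : S → ℝ) (z : P) :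
    (velocity V (fun t z => σ (t * χ (τ z)) z) z : V) = χ (τ z) • (velocity V σ z : V) := by
  have h1 : HasFDerivAt (fun t : ℝ => t * χ (τ z))
      ((1 : ℝ →L[ℝ] ℝ).smulRight (χ (τ z))) 0 :=
    (by simpa using (hasDerivAt_id (0 : ℝ)).mul_const (χ (τ z)) :
      HasDerivAt (fun t : ℝ => t * χ (τ z)) (χ (τ z)) 0).hasFDerivAt
  have h2 := hσ.hasMFDerivAt_zero z
  rw [← zero_mul (χ (τ z))] at h2
  have h3 := h2.comp (0 : ℝ) h1.hasMFDerivAt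
  have h4 := DFunLike.congr_fun h3.mfderiv (1 : ℝ)
  refine Eq.trans h4 ?_
  change ((1 : ℝ) • χ (τ z)) • (velocity V σ z : V) = _
  rw [one_smul]

end IsVerticalFlow

open Classical in
/-- Transport of a family of transformations from coordinates to a manifold. -/
def chartFlow (Φ : OpenPartialHomeomorph P V) (R : ℝ → V → V) (t : ℝ) (z : P) : P :=
  if z ∈ Φ.source then Φ.symm (R t (Φ z)) else z

theorem chartFlow_of_mem {Φ : OpenPartialHomeomorph P V} {R : ℝ → V → V} (t : ℝ) {z : P}
    (hz : z ∈ Φ.source) : chartFlow Φ R t z = Φ.symm (R t (Φ z)) := if_pos hz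

theorem chartFlow_of_notMem {Φ : OpenPartialHomeomorph P V} {R : ℝ → V → V} (t : ℝ) {z : P}
    (hz : z ∉ Φ.source) : chartFlow Φ R t z = z := if_neg hz

theorem IsCompactFlow.mem_target {Φ : OpenPartialHomeomorph P V} {R : ℝ → V → V} {D : Set V}
    (hR : IsCompactFlow D R) (hD : D ⊆ Φ.target) (t : ℝ) {p : V} (hp : p ∈ Φ.target) :
    R t p ∈ Φ.target := by
  by_cases h : p ∈ D
  · exact hD (hR.mem t h)
  · rwa [hR.eq_self t p h]

theorem IsCompactFlow.chartFlow_eq_self {Φ : OpenPartialHomeomorph P V} {R : ℝ → V → V} {D : Set V}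
    (hR : IsCompactFlow D R) (t : ℝ) {z : P} (hz : z ∉ Φ.symm '' D) : chartFlow Φ R t z = z := by
  by_cases h : z ∈ Φ.source
  · have h1 : Φ z ∉ D := fun h' => hz ⟨_, h', Φ.left_inv h⟩
    rw [chartFlow_of_mem t h, hR.eq_self t _ h1, Φ.left_inv h]
  · exact chartFlow_of_notMem t h

/-- The support is compact, hence closed in the Hausdorff space P. The chart domain and the
complement of the support cover P; the map is smooth on the first by coordinates and on the second
because it is the identity. -/
theorem IsCompactFlow.isVerticalFlow [T2Space P] {Φ : OpenPartialHomeomorph P V}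
    (hΦ : ContMDiffOn 𝓘(ℝ, V) 𝓘(ℝ, V) ∞ Φ Φ.source)
    (hΦ' : ContMDiffOn 𝓘(ℝ, V) 𝓘(ℝ, V) ∞ Φ.symm Φ.target) {R : ℝ → V → V} {D : Set V}
    (hR : IsCompactFlow D R) (hD : D ⊆ Φ.target)
    (hτ : ∀ t, ∀ p ∈ Φ.target, τ (Φ.symm (R t p)) = τ (Φ.symm p)) :
    IsVerticalFlow V τ (Φ.symm '' D) (chartFlow Φ R) where
  isCompact := hR.isCompact.image_of_continuousOn (Φ.continuousOn_symm.mono hD)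
  contMDiff := by
    rintro ⟨t, z⟩
    by_cases hz : z ∈ Φ.source
    · have h1 : ContMDiffAt (𝓘(ℝ, ℝ).prod 𝓘(ℝ, V)) 𝓘(ℝ, V) ∞
          (fun q : ℝ × P => Φ q.2) (t, z) :=
        (hΦ.contMDiffAt (Φ.open_source.mem_nhds hz)).comp (t, z) contMDiffAt_snd
      have h2 : ContMDiffAt (𝓘(ℝ, ℝ).prod 𝓘(ℝ, V)) 𝓘(ℝ, V) ∞
          (fun q : ℝ × P => R q.1 (Φ q.2)) (t, z) :=
        (hR.contDiff.contMDiff.contMDiffAt).comp (t, z)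
          (contMDiffAt_fst.prodMk_space h1)
      have h3 : ContMDiffAt (𝓘(ℝ, ℝ).prod 𝓘(ℝ, V)) 𝓘(ℝ, V) ∞
          (fun q : ℝ × P => Φ.symm (R q.1 (Φ q.2))) (t, z) :=
        (hΦ'.contMDiffAt (Φ.open_target.mem_nhds
          (hR.mem_target hD t (Φ.map_source hz)))).comp (t, z) h2
      refine h3.congr_of_eventuallyEq ?_
      filter_upwards [continuousAt_snd.eventually (Φ.open_source.mem_nhds hz)] with q hq
      exact chartFlow_of_mem q.1 hq
    · have h1 : z ∉ Φ.symm '' D := by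
        rintro ⟨p, hp, rfl⟩
        exact hz (Φ.map_target (hD hp))
      have hc : IsClosed (Φ.symm '' D) :=
        (hR.isCompact.image_of_continuousOn (Φ.continuousOn_symm.mono hD)).isClosed
      refine (contMDiffAt_snd (I := 𝓘(ℝ, ℝ)) (J := 𝓘(ℝ, V)) (n := ∞)
        (p := (t, z))).congr_of_eventuallyEq ?_
      filter_upwards [continuousAt_snd.eventually (hc.isOpen_compl.mem_nhds h1)] with q hq
      exact hR.chartFlow_eq_self q.1 hq
  zero z := by
    by_cases hz : z ∈ Φ.source
    · rw [chartFlow_of_mem 0 hz, hR.zero, Φ.left_inv hz]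
    · exact chartFlow_of_notMem 0 hz
  add s t z := by
    by_cases hz : z ∈ Φ.source
    · have h1 := hR.mem_target hD t (Φ.map_source hz)
      rw [chartFlow_of_mem _ hz, chartFlow_of_mem t hz, chartFlow_of_mem s (Φ.map_target h1),
        Φ.right_inv h1, hR.add]
    · rw [chartFlow_of_notMem _ hz, chartFlow_of_notMem t hz, chartFlow_of_notMem s hz]
  eq_self t z hz := hR.chartFlow_eq_self t hz
  tau t z := by
    by_cases hz : z ∈ Φ.source
    · rw [chartFlow_of_mem t hz, hτ t _ (Φ.map_source hz), Φ.left_inv hz]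
    · rw [chartFlow_of_notMem t hz]

theorem IsCompactFlow.velocity_chartFlow {Φ : OpenPartialHomeomorph P V}
    (hΦ' : ContMDiffOn 𝓘(ℝ, V) 𝓘(ℝ, V) ∞ Φ.symm Φ.target) {R : ℝ → V → V} {D : Set V}
    (hR : IsCompactFlow D R) {z : P} (hz : z ∈ Φ.source) {w : V}
    (hw : HasDerivAt (fun t => R t (Φ z)) w 0) :
    (velocity V (chartFlow Φ R) z : V) = mfderiv 𝓘(ℝ, V) 𝓘(ℝ, V) Φ.symm (Φ z) w := by
  have h1 : MDifferentiableAt 𝓘(ℝ, V) 𝓘(ℝ, V) Φ.symm (Φ z) :=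
    (hΦ'.contMDiffAt (Φ.open_target.mem_nhds (Φ.map_source hz))).mdifferentiableAt (by simp)
  have h2 : HasMFDerivAt 𝓘(ℝ, V) 𝓘(ℝ, V) Φ.symm (R 0 (Φ z))
      (mfderiv 𝓘(ℝ, V) 𝓘(ℝ, V) Φ.symm (Φ z) : V →L[ℝ] V) := by
    rw [hR.zero]
    exact h1.hasMFDerivAt
  have h3 := h2.comp (0 : ℝ) hw.hasFDerivAt.hasMFDerivAt
  have h4 : (fun t => chartFlow Φ R t z) = Φ.symm ∘ fun t => R t (Φ z) :=
    funext fun t => chartFlow_of_mem t hz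
  change (mfderiv 𝓘(ℝ, ℝ) 𝓘(ℝ, V) (fun t => chartFlow Φ R t z) 0 (1 : ℝ) : V) = _
  rw [h4]
  refine (DFunLike.congr_fun h3.mfderiv (1 : ℝ)).trans ?_
  change (mfderiv 𝓘(ℝ, V) 𝓘(ℝ, V) Φ.symm (Φ z) ((1 : ℝ) • w) : V) = _
  rw [one_smul]

end ManifoldFlow

/-! ### Criticality and the field equations on the space of values -/

section FieldEquations

open MeasureTheory

variable {m : ℕ} {S : Type*} [TopologicalSpace S]
  [ChartedSpace (EuclideanSpace ℝ (Fin (m + 1))) S]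
  [IsManifold 𝓘(ℝ, EuclideanSpace ℝ (Fin (m + 1))) ∞ S]
  [T2Space S] [SecondCountableTopology S] [MeasurableSpace S] [BorelSpace S]
  {V P : Type*} [NormedAddCommGroup V] [NormedSpace ℝ V] [FiniteDimensional ℝ V]
  [TopologicalSpace P] [ChartedSpace V P] [IsManifold 𝓘(ℝ, V) ∞ P]
  (vol : VolumeForm (EuclideanSpace ℝ (Fin (m + 1))) S (m + 1))
  {Ψ : S → P} {U : Set S} {Θ : DiffForm V P (m + 1)} {τ : P → S}

theorem insertPullback_apply {k : ℕ} (X : ∀ z : P, TangentSpace 𝓘(ℝ, V) z)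
    (Ω : DiffForm V P (k + 1)) (y : S) (b : Fin k → EuclideanSpace ℝ (Fin (m + 1))) :
    insertPullback X Ω Ψ y b = Ω (Ψ y) (Matrix.vecCons (α := V) (X (Ψ y)) fun i =>
      (mfderiv 𝓘(ℝ, EuclideanSpace ℝ (Fin (m + 1))) 𝓘(ℝ, V) Ψ y (b i) : V)) := rfl

/-- Solutions of the field equations are critical. -/
theorem hasDerivAt_integral_of_field_equations (hU : IsOpen U)
    (hΨ : ContMDiffOn 𝓘(ℝ, EuclideanSpace ℝ (Fin (m + 1))) 𝓘(ℝ, V) ∞ Ψ U)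
    (hΘ : ∀ z, Θ.SmoothAt z) (hτ : Continuous τ) (hsec : ∀ x ∈ U, τ (Ψ x) = x)
    (hfield : ∀ x ∈ U, ∀ v : V, Θ.d (Ψ x) (Matrix.vecCons (α := V) v fun i =>
      (mfderiv 𝓘(ℝ, EuclideanSpace ℝ (Fin (m + 1))) 𝓘(ℝ, V) Ψ x (stdFrame (m + 1) i) : V)) = 0)
    {X : ∀ z : P, TangentSpace 𝓘(ℝ, V) z} (hc : IsCompact (closure {z | X z ≠ 0}))
    {σ : ℝ → P → P}
    (hσ : ContMDiff (𝓘(ℝ, ℝ).prod 𝓘(ℝ, V)) 𝓘(ℝ, V) ∞ (Function.uncurry σ))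
    (hσ0 : ∀ z, σ 0 z = z)
    (hσX : ∀ z, IsMIntegralCurve (I := 𝓘(ℝ, V)) (fun t => σ t z) X)
    {K : Set S} (hK : IsCompact K) (hKU : K ⊆ U) (hXK : τ '' closure {z | X z ≠ 0} ⊆ K) :
    HasDerivAt (fun ε : ℝ => vol.integral K (DiffForm.pullback (σ ε ∘ Ψ) Θ)) 0 0 := by
  have hX : ∀ z, HasMFDerivAt 𝓘(ℝ, ℝ) 𝓘(ℝ, V) (fun t => σ t z) 0
      ((1 : ℝ →L[ℝ] ℝ).smulRight (X z) : ℝ →L[ℝ] V) := by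
    intro z
    have h := hσX z 0
    refine h.congr_mfderiv ?_
    change ((1 : ℝ →L[ℝ] ℝ).smulRight (X (σ 0 z) : V) : ℝ →L[ℝ] V) = _
    rw [hσ0]
  -- If X is nonzero at Ψ(y), then y = τ(Ψ(y)) lies in the image of the support; this image, which
  -- is compact, serves as the smaller compact set K'.
  have h := hasDerivAt_integral_pullback_of_support hσ hU hΨ hσ0 hX vol hΘ hK hKU
    (hc.image hτ) hXK fun y hy hyK => by
      by_contra hne
      exact hyK ⟨Ψ y, subset_closure hne, hsec y hy⟩
  convert h using 1
  rw [setIntegral_congr_fun (g := fun _ => (0 : ℝ)) hK.isClosed.measurableSet]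
  · simp
  · intro y hy
    have h1 := hfield y (hKU hy) (X (Ψ y))
    change variationDensity vol X Θ Ψ y = 0
    rw [variationDensity, insertPullback_apply, h1, zero_div]

/-- The fundamental lemma of the calculus of variations: criticality for the flow scaled by χ says
that χ times the variation density has integral zero, for every test function χ on U. -/
theorem eq_zero_of_critical_flow [T2Space P] (hU : IsOpen U)
    (hΨ : ContMDiffOn 𝓘(ℝ, EuclideanSpace ℝ (Fin (m + 1))) 𝓘(ℝ, V) ∞ Ψ U)
    (hΘ : ∀ z, Θ.SmoothAt z)
    (hτ : ContMDiff 𝓘(ℝ, V) 𝓘(ℝ, EuclideanSpace ℝ (Fin (m + 1))) ∞ τ)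
    (hsec : ∀ x ∈ U, τ (Ψ x) = x)
    (hcrit : ∀ X : ∀ z : P, TangentSpace 𝓘(ℝ, V) z,
      ContMDiff 𝓘(ℝ, V) 𝓘(ℝ, V).tangent ∞
        (fun z => (⟨z, X z⟩ : TangentBundle 𝓘(ℝ, V) P)) →
      (∀ z, mfderiv 𝓘(ℝ, V) 𝓘(ℝ, EuclideanSpace ℝ (Fin (m + 1))) τ z (X z) = 0) →
      IsCompact (closure {z | X z ≠ 0}) → closure {z | X z ≠ 0} ⊆ τ ⁻¹' U →
      ∀ σ : ℝ → P → P,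
        ContMDiff (𝓘(ℝ, ℝ).prod 𝓘(ℝ, V)) 𝓘(ℝ, V) ∞ (Function.uncurry σ) →
        (∀ z, σ 0 z = z) →
        (∀ z, IsMIntegralCurve (I := 𝓘(ℝ, V)) (fun t => σ t z) X) →
        ∀ K : Set S, IsCompact K → K ⊆ U → τ '' closure {z | X z ≠ 0} ⊆ K →
          HasDerivAt (fun ε : ℝ => vol.integral K (DiffForm.pullback (σ ε ∘ Ψ) Θ)) 0 0)
    {C : Set P} {σ : ℝ → P → P} (hσ : IsVerticalFlow V τ C σ) {x : S} (hx : x ∈ U) :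
    Θ.d (Ψ x) (Matrix.vecCons (α := V) (velocity V σ (Ψ x)) fun i =>
      (mfderiv 𝓘(ℝ, EuclideanSpace ℝ (Fin (m + 1))) 𝓘(ℝ, V) Ψ x (stdFrame (m + 1) i) : V)) =
        0 := by
  have hcont : ContinuousOn (variationDensity vol (velocity V σ) Θ Ψ) U :=
    continuousOn_variationDensity hσ.contMDiff hU hΨ hσ.zero hσ.hasMFDerivAt_zero vol hΘ
  have hint : ∀ χ : S → ℝ, ContMDiff 𝓘(ℝ, EuclideanSpace ℝ (Fin (m + 1))) 𝓘(ℝ, ℝ) ∞ χ →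
      HasCompactSupport χ → tsupport χ ⊆ U →
      ∫ y, χ y • variationDensity vol (velocity V σ) Θ Ψ y ∂vol.measure = 0 := by
    intro χ hχ hχc hχU
    have hs := hσ.scale hτ hχ
    set σ' : ℝ → P → P := fun t z => σ (t * χ (τ z)) z with hσ'
    -- Lying in C makes the support compact, and lying over the support of χ puts it over U; C
    -- itself need not lie over U.
    have hsupp : closure {z | velocity V σ' z ≠ 0} ⊆ C ∩ τ ⁻¹' tsupport χ := by
      refine closure_minimal (fun z hz => ⟨?_, ?_⟩)
        (hσ.isCompact.isClosed.inter ((isClosed_tsupport χ).preimage hτ.continuous))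
      · by_contra h
        exact hz (hs.velocity_eq_zero h)
      · refine subset_closure fun h => hz ?_
        have h1 := hσ.velocity_scale χ z
        rw [h, zero_smul] at h1
        exact h1
    have h1 := hcrit (velocity V σ') hs.contMDiff_velocity (hs.mfderiv_velocity hτ)
      (hσ.isCompact.of_isClosed_subset isClosed_closure (hsupp.trans inter_subset_left))
      (hsupp.trans (inter_subset_right.trans (preimage_mono hχU))) σ' hs.contMDiff hs.zero
      hs.isMIntegralCurve (tsupport χ) hχc hχU
      (image_subset_iff.2 (hsupp.trans inter_subset_right))
    have h2 := hasDerivAt_integral_pullback_of_support hs.contMDiff hU hΨ hs.zero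
      hs.hasMFDerivAt_zero vol hΘ hχc hχU hχc Subset.rfl fun y hy hyK => by
        have h3 := hσ.velocity_scale χ (Ψ y)
        rw [hsec y hy, image_eq_zero_of_notMem_tsupport hyK, zero_smul] at h3
        exact h3
    have h3 := h2.unique h1
    rw [← setIntegral_eq_integral_of_forall_compl_eq_zero (s := tsupport χ), ← h3]
    · refine setIntegral_congr_fun (isClosed_tsupport χ).measurableSet fun y hy => ?_
      have h4 := hσ.velocity_scale χ (Ψ y)
      rw [hsec y (hχU hy)] at h4
      change χ y * variationDensity vol (velocity V σ) Θ Ψ y =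
        variationDensity vol (velocity V σ') Θ Ψ y
      rw [variationDensity, variationDensity, insertPullback_apply, insertPullback_apply, h4,
        ← mul_div_assoc]
      congr 1
      exact (AlternatingMap.map_vecCons_smul (Θ.d (Ψ y)).toAlternatingMap (fun i =>
        (mfderiv 𝓘(ℝ, EuclideanSpace ℝ (Fin (m + 1))) 𝓘(ℝ, V) Ψ y (stdFrame (m + 1) i) : V))
        (χ y) (velocity V σ (Ψ y))).symm
    · intro y hy
      rw [image_eq_zero_of_notMem_tsupport hy, zero_smul]
  have : LocallyCompactSpace S :=
    ChartedSpace.locallyCompactSpace (EuclideanSpace ℝ (Fin (m + 1))) S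
  have hae := hU.ae_eq_zero_of_integral_contMDiff_smul_eq_zero
    𝓘(ℝ, EuclideanSpace ℝ (Fin (m + 1)))
    (hcont.locallyIntegrableOn hU.measurableSet) hint
  -- The density is continuous on U and the measure is positive on open sets, so vanishing almost
  -- everywhere is vanishing everywhere.
  have heq : EqOn (variationDensity vol (velocity V σ) Θ Ψ) (fun _ => 0) U :=
    Measure.eqOn_open_of_ae_eq ((ae_restrict_iff' hU.measurableSet).2 hae) hU hcont
      continuousOn_const
  have h1 : variationDensity vol (velocity V σ) Θ Ψ x = 0 := heq hx
  rw [variationDensity, div_eq_zero_iff] at h1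
  rcases h1 with h1 | h1
  · rwa [insertPullback_apply] at h1
  · exact absurd h1 (vol.apply_stdFrame_ne_zero x)

/-- If the fibres of `τ` have enough compactly supported flows, critical sections solve the field
equations. -/
theorem field_equations_of_critical [T2Space P] (hU : IsOpen U)
    (hΨ : ContMDiffOn 𝓘(ℝ, EuclideanSpace ℝ (Fin (m + 1))) 𝓘(ℝ, V) ∞ Ψ U)
    (hΘ : ∀ z, Θ.SmoothAt z)
    (hτ : ContMDiff 𝓘(ℝ, V) 𝓘(ℝ, EuclideanSpace ℝ (Fin (m + 1))) ∞ τ)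
    (hsec : ∀ x ∈ U, τ (Ψ x) = x)
    (hflow : ∀ (z : P) (v : V),
      (mfderiv 𝓘(ℝ, V) 𝓘(ℝ, EuclideanSpace ℝ (Fin (m + 1))) τ z v :
        EuclideanSpace ℝ (Fin (m + 1))) = 0 →
      v ≠ 0 → ∃ (C : Set P) (σ : ℝ → P → P), IsVerticalFlow V τ C σ ∧ (velocity V σ z : V) = v)
    (hcrit : ∀ X : ∀ z : P, TangentSpace 𝓘(ℝ, V) z,
      ContMDiff 𝓘(ℝ, V) 𝓘(ℝ, V).tangent ∞
        (fun z => (⟨z, X z⟩ : TangentBundle 𝓘(ℝ, V) P)) →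
      (∀ z, mfderiv 𝓘(ℝ, V) 𝓘(ℝ, EuclideanSpace ℝ (Fin (m + 1))) τ z (X z) = 0) →
      IsCompact (closure {z | X z ≠ 0}) → closure {z | X z ≠ 0} ⊆ τ ⁻¹' U →
      ∀ σ : ℝ → P → P,
        ContMDiff (𝓘(ℝ, ℝ).prod 𝓘(ℝ, V)) 𝓘(ℝ, V) ∞ (Function.uncurry σ) →
        (∀ z, σ 0 z = z) →
        (∀ z, IsMIntegralCurve (I := 𝓘(ℝ, V)) (fun t => σ t z) X) →
        ∀ K : Set S, IsCompact K → K ⊆ U → τ '' closure {z | X z ≠ 0} ⊆ K →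
          HasDerivAt (fun ε : ℝ => vol.integral K (DiffForm.pullback (σ ε ∘ Ψ) Θ)) 0 0)
    {x : S} (hx : x ∈ U) (v : V) :
    Θ.d (Ψ x) (Matrix.vecCons (α := V) v fun i =>
      (mfderiv 𝓘(ℝ, EuclideanSpace ℝ (Fin (m + 1))) 𝓘(ℝ, V) Ψ x (stdFrame (m + 1) i) : V)) =
        0 := by
  let L : EuclideanSpace ℝ (Fin (m + 1)) →L[ℝ] V :=
    mfderiv 𝓘(ℝ, EuclideanSpace ℝ (Fin (m + 1))) 𝓘(ℝ, V) Ψ x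
  let T : V →L[ℝ] EuclideanSpace ℝ (Fin (m + 1)) :=
    mfderiv 𝓘(ℝ, V) 𝓘(ℝ, EuclideanSpace ℝ (Fin (m + 1))) τ (Ψ x)
  let Ω : V [⋀^Fin (m + 1 + 1)]→L[ℝ] ℝ := Θ.d (Ψ x)
  have hTL : ∀ a, T (L a) = a := by
    intro a
    have h1 : MDifferentiableAt 𝓘(ℝ, EuclideanSpace ℝ (Fin (m + 1))) 𝓘(ℝ, V) Ψ x :=
      (hΨ.contMDiffAt (hU.mem_nhds hx)).mdifferentiableAt (by simp)
    have h2 : MDifferentiableAt 𝓘(ℝ, V) 𝓘(ℝ, EuclideanSpace ℝ (Fin (m + 1))) τ (Ψ x) :=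
      hτ.mdifferentiableAt (by simp)
    have h3 : τ ∘ Ψ =ᶠ[𝓝 x] id := by
      filter_upwards [hU.mem_nhds hx] with y hy
      exact hsec y hy
    have h4 := mfderiv_comp x h2 h1
    rw [h3.mfderiv_eq, mfderiv_id] at h4
    exact (DFunLike.congr_fun h4 a).symm
  -- v - Ψ_*τ_*v is vertical because τ_*Ψ_* = id, so criticality with a flow of this velocity
  -- applies; flows are only provided for nonzero vectors, and the zero vector is trivial.
  have hvert : Ω (Matrix.vecCons (v - L (T v)) fun i => L (stdFrame (m + 1) i)) = 0 := by
    by_cases h0 : v - L (T v) = 0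
    · rw [h0]
      exact Ω.map_coord_zero 0 rfl
    · obtain ⟨C, σ, hσ, hv⟩ := hflow (Ψ x) (v - L (T v)) (by
        change T (v - L (T v)) = 0
        rw [map_sub, hTL, sub_self]) h0
      have h := eq_zero_of_critical_flow vol hU hΨ hΘ hτ hsec hcrit hσ hx
      rw [hv] at h
      exact h
  -- All n + 1 arguments lie in the image of Ψ_*, so the value is that of an (n+1)-form on the
  -- n-dimensional tangent space of the base.
  have hhor : Ω (Matrix.vecCons (L (T v)) fun i => L (stdFrame (m + 1) i)) = 0 := by
    have h := form_eq_zero_of_finrank_lt (stdBasis (m + 1)) (Ω.compContinuousLinearMap L)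
      (Matrix.vecCons (T v) (stdFrame (m + 1)))
    rw [← h, ContinuousAlternatingMap.compContinuousLinearMap_apply]
    congr 1
    funext i
    refine Fin.cases ?_ (fun i => ?_) i <;> rfl
  change Ω (Matrix.vecCons v fun i => L (stdFrame (m + 1) i)) = 0
  have h : Ω (Matrix.vecCons (v - L (T v) + L (T v)) fun i => L (stdFrame (m + 1) i)) =
      Ω (Matrix.vecCons (v - L (T v)) fun i => L (stdFrame (m + 1) i)) +
        Ω (Matrix.vecCons (L (T v)) fun i => L (stdFrame (m + 1) i)) :=
    Ω.toAlternatingMap.map_vecCons_add _ _ _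
  rwa [sub_add_cancel, hvert, hhor, add_zero] at h

end FieldEquations

/-! ### Vertical flows over adapted charts -/

section VerticalFlows

variable {A B F : Type*} [NormedAddCommGroup A] [InnerProductSpace ℝ A] [FiniteDimensional ℝ A]
  [NormedAddCommGroup B] [NormedSpace ℝ B] [FiniteDimensional ℝ B]
  [NormedAddCommGroup F] [NormedSpace ℝ F] [FiniteDimensional ℝ F]
  {S P : Type*} [TopologicalSpace S] [ChartedSpace A S]
  [TopologicalSpace P] [T2Space P] [ChartedSpace ((A × B) × F) P]
  [IsManifold 𝓘(ℝ, (A × B) × F) ∞ P] {τ : P → S}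

/-- Vertical vectors are generated by compactly supported vertical flows, if the fibres of the
submersion have dimension at least two. -/
theorem exists_isVerticalFlow (hd : 2 ≤ Module.finrank ℝ B + Module.finrank ℝ F)
    {Φ : OpenPartialHomeomorph P ((A × B) × F)}
    (hΦ : ContMDiffOn 𝓘(ℝ, (A × B) × F) 𝓘(ℝ, (A × B) × F) ∞ Φ Φ.source)
    (hΦ' : ContMDiffOn 𝓘(ℝ, (A × B) × F) 𝓘(ℝ, (A × B) × F) ∞ Φ.symm Φ.target)
    {φ : OpenPartialHomeomorph S A} (hφ : ContMDiffOn 𝓘(ℝ, A) 𝓘(ℝ, A) ∞ φ φ.source)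
    (hτ : ContMDiff 𝓘(ℝ, (A × B) × F) 𝓘(ℝ, A) ∞ τ)
    (hτφ : ∀ z ∈ Φ.source, τ z ∈ φ.source ∧ φ (τ z) = (Φ z).1.1)
    {z : P} (hz : z ∈ Φ.source) {v : (A × B) × F} (hv : v ≠ 0)
    (hτv : (mfderiv 𝓘(ℝ, (A × B) × F) 𝓘(ℝ, A) τ z v : A) = 0) :
    ∃ (C : Set P) (σ : ℝ → P → P), IsVerticalFlow ((A × B) × F) τ C σ ∧
      (velocity ((A × B) × F) σ z : (A × B) × F) = v := by
  let w : (A × B) × F := mfderiv 𝓘(ℝ, (A × B) × F) 𝓘(ℝ, (A × B) × F) Φ z v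
  have hd1 : MDifferentiableAt 𝓘(ℝ, (A × B) × F) 𝓘(ℝ, (A × B) × F) Φ z :=
    (hΦ.contMDiffAt (Φ.open_source.mem_nhds hz)).mdifferentiableAt (by simp)
  have hd2 : MDifferentiableAt 𝓘(ℝ, (A × B) × F) 𝓘(ℝ, (A × B) × F) Φ.symm (Φ z) :=
    (hΦ'.contMDiffAt (Φ.open_target.mem_nhds (Φ.map_source hz))).mdifferentiableAt (by simp)
  have hw : (mfderiv 𝓘(ℝ, (A × B) × F) 𝓘(ℝ, (A × B) × F) Φ.symm (Φ z) w : (A × B) × F) = v := by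
    have h1 := mfderiv_comp z hd2 hd1
    have h2 : Φ.symm ∘ Φ =ᶠ[𝓝 z] id := by
      filter_upwards [Φ.open_source.mem_nhds hz] with y hy
      exact Φ.left_inv hy
    rw [h2.mfderiv_eq, mfderiv_id] at h1
    exact (DFunLike.congr_fun h1 v).symm
  have hw0 : w ≠ 0 := by
    intro h
    apply hv
    rw [← hw, h]
    exact map_zero (mfderiv 𝓘(ℝ, (A × B) × F) 𝓘(ℝ, (A × B) × F) Φ.symm (Φ z))
  -- In the charts τ is the first coordinate, so a vector killed by τ_* has no A-component.
  have hw1 : w.1.1 = 0 := by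
    have h1 : φ ∘ τ =ᶠ[𝓝 z] (fun p : (A × B) × F => p.1.1) ∘ Φ := by
      filter_upwards [Φ.open_source.mem_nhds hz] with y hy
      exact (hτφ y hy).2
    have h2 : MDifferentiableAt 𝓘(ℝ, A) 𝓘(ℝ, A) φ (τ z) :=
      (hφ.contMDiffAt (φ.open_source.mem_nhds (hτφ z hz).1)).mdifferentiableAt (by simp)
    have h3 : MDifferentiableAt 𝓘(ℝ, (A × B) × F) 𝓘(ℝ, A) τ z := hτ.mdifferentiableAt (by simp)
    have h4 : HasMFDerivAt 𝓘(ℝ, (A × B) × F) 𝓘(ℝ, A) (fun p : (A × B) × F => p.1.1) (Φ z)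
        ((ContinuousLinearMap.fst ℝ A B).comp (ContinuousLinearMap.fst ℝ (A × B) F)) :=
      ((ContinuousLinearMap.fst ℝ A B).comp
        (ContinuousLinearMap.fst ℝ (A × B) F)).hasFDerivAt.hasMFDerivAt
    have h5 := (h4.comp z hd1.hasMFDerivAt).mfderiv
    rw [← h1.mfderiv_eq, mfderiv_comp z h2 h3] at h5
    have h6 := DFunLike.congr_fun h5 v
    refine Eq.trans h6.symm ?_
    change (mfderiv 𝓘(ℝ, A) 𝓘(ℝ, A) φ (τ z)
      (mfderiv 𝓘(ℝ, (A × B) × F) 𝓘(ℝ, A) τ z v : A) : A) = 0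
    rw [hτv]
    exact map_zero (mfderiv 𝓘(ℝ, A) 𝓘(ℝ, A) φ (τ z))
  obtain ⟨D, R, hD, hR, hR1, hR'⟩ := exists_compactFlow hd Φ.open_target (Φ.map_source hz) hw0 hw1
  -- Within the chart τ is a function of the A-coordinate alone, which R preserves; hence the
  -- transported flow preserves τ.
  have hsymm : ∀ p ∈ Φ.target, τ (Φ.symm p) = φ.symm p.1.1 := by
    intro p hp
    have h1 := hτφ _ (Φ.map_target hp)
    rw [Φ.right_inv hp] at h1
    rw [← h1.2, φ.left_inv h1.1]
  refine ⟨Φ.symm '' D, chartFlow Φ R, hR.isVerticalFlow hΦ hΦ' hD fun t p hp => ?_, ?_⟩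
  · rw [hsymm _ hp, hsymm _ (hR.mem_target hD t hp), hR1]
  · rw [hR.velocity_chartFlow hΦ' hz hR', hw]

end VerticalFlows

/-! ### Existence of a nonzero momentum -/

section Momenta

variable {A B : Type*} [NormedAddCommGroup A] [NormedSpace ℝ A] [NormedAddCommGroup B]
  [NormedSpace ℝ B] {n : ℕ}

theorem form_eq_zero_of_collinear {W : Type*} [AddCommGroup W] [Module ℝ W] [TopologicalSpace W]
    (D : W [⋀^Fin n]→L[ℝ] ℝ) {w : Fin n → W} {i j : Fin n} (hij : i ≠ j) {a c : ℝ} {e : W}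
    (hi : w i = a • e) (hj : w j = c • e) : D w = 0 := by
  classical
  have h1 : w = Function.update w j (c • e) := by rw [← hj, Function.update_eq_self]
  rw [h1, D.map_update_smul]
  have h2 : Function.update w j e = Function.update (Function.update w j e) i (a • e) := by
    refine (Function.update_eq_self_iff.2 ?_).symm
    rw [Function.update_of_ne hij, hi]
  rw [h2, D.map_update_smul, D.map_eq_zero_of_eq _ (i := i) (j := j) ?_ hij, smul_zero, smul_zero]
  rw [Function.update_self, Function.update_of_ne hij.symm, Function.update_self]

/-- The map (a, q) ↦ a + f(q) e sends all vertical vectors to multiples of the single vector e, so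
two vertical arguments become collinear. -/
theorem comp_mem_fibreModel (D : A [⋀^Fin n]→L[ℝ] ℝ) (f : B →L[ℝ] ℝ) (e : A) :
    D.compContinuousLinearMap (ContinuousLinearMap.fst ℝ A B +
      (f.comp (ContinuousLinearMap.snd ℝ A B)).smulRight e) ∈ FieldTheory.FibreModel A B n := by
  rintro v ⟨s, hs, hv⟩
  obtain ⟨i, hi, j, hj, hij⟩ := Finset.one_lt_card.1 (by omega : 1 < s.card)
  have hi1 : (v i).1 = 0 := hv i hi
  have hj1 : (v j).1 = 0 := hv j hj
  refine form_eq_zero_of_collinear D hij (a := f (v i).2) (c := f (v j).2) (e := e) ?_ ?_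
  · change (v i).1 + f (v i).2 • e = _
    rw [hi1, zero_add]
  · change (v j).1 + f (v j).2 • e = _
    rw [hj1, zero_add]

/-- The pullback of D under (a, q) ↦ a + f(q) b₀ is a horizontal form plus a nonzero momentum, and
the momentum is what survives when the horizontal part is dropped. -/
theorem restrictedFibreModel_nontrivial [Nontrivial B] (hn : 1 ≤ n) (b : Module.Basis (Fin n) ℝ A)
    {D : A [⋀^Fin n]→L[ℝ] ℝ} (hD : D ≠ 0) : Nontrivial (RestrictedFibreModel A B n) := by
  obtain ⟨f₀, hf₀⟩ := exists_ne (0 : B)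
  obtain ⟨f, hf⟩ := SeparatingDual.exists_eq_one (R := ℝ) hf₀
  let i₀ : Fin n := ⟨0, hn⟩
  let l : A × B →L[ℝ] A := ContinuousLinearMap.fst ℝ A B +
    (f.comp (ContinuousLinearMap.snd ℝ A B)).smulRight (b i₀)
  have hl : ∀ p, l p = p.1 + f p.2 • b i₀ := fun p => rfl
  let ζ : FibreModel A B n := ⟨D.compContinuousLinearMap l, comp_mem_fibreModel D f (b i₀)⟩
  have hζ : ∀ v, ζ.1 v = D fun i => l (v i) := fun v => rfl
  clear_value ζ
  refine ⟨⟨dropHorizontalAux ζ, 0, fun h => ?_⟩⟩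
  classical
  -- The test vectors are the basis with b₀ replaced by a vertical vector f₀ with f(f₀) = 1: the
  -- full form takes the value D(b) there, and its horizontal part is zero.
  have h1 := DFunLike.congr_fun (congrArg Subtype.val h)
    (fun i => if i = i₀ then ((0 : A), f₀) else (b i, (0 : B)))
  rw [dropHorizontalAux_apply] at h1
  have h2 : ζ.1 (fun i => if i = i₀ then ((0 : A), f₀) else (b i, (0 : B))) = D b := by
    rw [hζ]
    congr 1
    funext i
    by_cases hi : i = i₀
    · rw [if_pos hi, hl, hf, hi]
      simp
    · rw [if_neg hi, hl]
      simp
  have h3 : ζ.1 (fun i => ((if i = i₀ then ((0 : A), f₀) else (b i, (0 : B))).1, (0 : B))) = 0 := by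
    refine ζ.1.map_coord_zero i₀ ?_
    simp
  rw [h2, h3, sub_zero] at h1
  exact top_form_ne_zero b hD h1

end Momenta

/-! ### The canonical form and the Hamiltonian -/

section Decomposition

variable {A B G : Type*} [NormedAddCommGroup A] [NormedSpace ℝ A]
  [NormedAddCommGroup B] [NormedSpace ℝ B] [NormedAddCommGroup G] [NormedSpace ℝ G]
  {S Q E : Type*} [TopologicalSpace S] [ChartedSpace A S]
  [TopologicalSpace Q] [ChartedSpace B Q] [TopologicalSpace E] [ChartedSpace G E]
  {π : SmoothFibreBundle A B G S Q E} {n : ℕ}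
  [FiniteDimensional ℝ A] [FiniteDimensional ℝ B]
  [IsManifold 𝓘(ℝ, A) ∞ S] [IsManifold 𝓘(ℝ, B) ∞ Q]

/-- The projection `M(π) → Σ`. -/
def multiphaseProj (π : SmoothFibreBundle A B G S Q E) (n : ℕ) (m : MultiphaseSpace π n) : S :=
  π.proj m.pt

theorem contMDiff_multiphaseProj :
    ContMDiff 𝓘(ℝ, (A × B) × FibreModel A B n) 𝓘(ℝ, A) ∞ (multiphaseProj π n) :=
  contMDiff_proj.comp contMDiff_multiphase_pt

/-- The defining property of H, unwound: the first component of χ⁻¹ is μ, because χ moves points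
only along the fibres of μ. -/
theorem HamiltonianSection.addVol_hamiltonian (h : HamiltonianSection π n)
    (hn : Module.finrank ℝ A = n) (vol : VolumeForm A S n) (m : MultiphaseSpace π n) :
    addVol vol (h.toFun (mu π n m)) (-h.hamiltonian hn vol m) = m := by
  have h1 : h.chi vol ((Equiv.ofBijective _ (h.chi_bijective hn vol)).symm m) = m :=
    (Equiv.ofBijective _ (h.chi_bijective hn vol)).apply_symm_apply m
  have h2 : mu π n m = ((Equiv.ofBijective _ (h.chi_bijective hn vol)).symm m).1 := by
    conv_lhs => rw [← h1]
    rw [chi, mu_addVol, h.mu_comp]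
  rw [hamiltonian, neg_neg, h2]
  exact h1

theorem HamiltonianSection.hamiltonian_toFun (h : HamiltonianSection π n)
    (hn : Module.finrank ℝ A = n) (vol : VolumeForm A S n) (z : RestrictedMultiphaseSpace π n) :
    h.hamiltonian hn vol (h.toFun z) = 0 := by
  have h1 : h.chi vol (z, 0) = h.toFun z := by
    refine MultiphaseSpace.ext_apply rfl fun v => ?_
    change (h.toFun z).cov.1 v + (0 : ℝ) * _ = _
    rw [zero_mul, add_zero]
  have h2 : (Equiv.ofBijective _ (h.chi_bijective hn vol)).symm (h.toFun z) = (z, 0) :=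
    (Equiv.symm_apply_eq _).2 h1.symm
  rw [hamiltonian, h2, neg_zero]

theorem HamiltonianSection.pt_comp (h : HamiltonianSection π n) (z : RestrictedMultiphaseSpace π n) :
    (h.toFun z).pt = z.pt :=
  congrArg RestrictedMultiphaseSpace.pt (h.mu_comp z)

/-- The canonical form evaluates the covector m on vectors pushed to E. Writing m as h(μ(m)) - H(m)
π^*vol splits this value, and the two parts are pullbacks since the projection to E factors through
h ∘ μ. -/
theorem theta_decomposition (h : HamiltonianSection π n)
    (hn : Module.finrank ℝ A = n) (vol : VolumeForm A S n) (m : MultiphaseSpace π n)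
    (v : Fin n → TangentSpace 𝓘(ℝ, (A × B) × FibreModel A B n) m) :
    theta π n m v = h.theta.pullback (mu π n) m v -
      h.hamiltonian hn vol m * vol.form.pullback (multiphaseProj π n) m v := by
  have hd : MDifferentiableAt 𝓘(ℝ, (A × B) × FibreModel A B n) 𝓘(ℝ, G)
      (MultiphaseSpace.pt : MultiphaseSpace π n → E) m :=
    contMDiff_multiphase_pt.mdifferentiableAt (by simp)
  have hd' : MDifferentiableAt 𝓘(ℝ, (A × B) × FibreModel A B n) 𝓘(ℝ, G)
      (MultiphaseSpace.pt : MultiphaseSpace π n → E) (h.toFun (mu π n m)) :=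
    contMDiff_multiphase_pt.mdifferentiableAt (by simp)
  have hh : MDifferentiableAt 𝓘(ℝ, (A × B) × RestrictedFibreModel A B n)
      𝓘(ℝ, (A × B) × FibreModel A B n) h.toFun (mu π n m) :=
    h.contMDiff.mdifferentiableAt (by simp)
  have hmu : MDifferentiableAt 𝓘(ℝ, (A × B) × FibreModel A B n)
      𝓘(ℝ, (A × B) × RestrictedFibreModel A B n) (mu π n) m :=
    contMDiff_mu.mdifferentiableAt (by simp)
  have hproj : MDifferentiableAt 𝓘(ℝ, G) 𝓘(ℝ, A) π.proj m.pt :=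
    contMDiff_proj.mdifferentiableAt (by simp)
  -- h ∘ μ moves only the covector, never the base point in E.
  have hcomp : (MultiphaseSpace.pt ∘ h.toFun) ∘ mu π n = MultiphaseSpace.pt :=
    funext fun m => h.pt_comp (mu π n m)
  have h1 := mfderiv_comp m (hd'.comp (mu π n m) hh) hmu
  rw [mfderiv_comp (mu π n m) hd' hh, hcomp] at h1
  have h2 := mfderiv_comp m hproj hd
  have key : ∀ u : Fin n → G, m.cov.1 u = (h.toFun (mu π n m)).cov.1 u +
      -h.hamiltonian hn vol m * vol.form (π.proj m.pt)
        (fun i => mfderiv 𝓘(ℝ, G) 𝓘(ℝ, A) π.proj m.pt (u i)) := by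
    intro u
    have h3 := MultiphaseSpace.cov_congr (h.addVol_hamiltonian hn vol m) u
    rw [← h3]
    change (h.toFun (mu π n m)).cov.1 u + _ * vol.form (π.proj (h.toFun (mu π n m)).pt)
      (fun i => (mfderiv 𝓘(ℝ, G) 𝓘(ℝ, A) π.proj (h.toFun (mu π n m)).pt (u i) : A)) = _
    have h4 : ∀ {y y' : E}, y = y' →
        vol.form (π.proj y) (fun i => (mfderiv 𝓘(ℝ, G) 𝓘(ℝ, A) π.proj y (u i) : A)) =
          vol.form (π.proj y') (fun i => (mfderiv 𝓘(ℝ, G) 𝓘(ℝ, A) π.proj y' (u i) : A)) := by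
      rintro y _ rfl
      rfl
    exact congrArg (fun q => (h.toFun (mu π n m)).cov.1 u + -h.hamiltonian hn vol m * q)
      (h4 (h.pt_comp (mu π n m)))
  refine (key _).trans ?_
  rw [neg_mul, ← sub_eq_add_neg]
  congr 1
  · rw [DiffForm.pullback_apply, HamiltonianSection.theta, DiffForm.pullback_apply, theta_apply]
    refine congrArg (h.toFun (mu π n m)).cov.1 ?_
    funext i
    exact DFunLike.congr_fun h1 (v i)
  · congr 1
    rw [DiffForm.pullback_apply]
    refine congrArg (vol.form (π.proj m.pt)) ?_
    funext i
    exact (DFunLike.congr_fun h2 (v i)).symm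

theorem HamiltonianSection.theta_smoothAt (h : HamiltonianSection π n)
    (z : RestrictedMultiphaseSpace π n) : h.theta.SmoothAt z :=
  DiffForm.SmoothAt.pullback (FieldTheory.theta_smoothAt _) h.contMDiff.contMDiffAt

end Decomposition

/-! ### Vertical flows on P(π) -/

section VerticalFlowsMultiphase

variable {n N : ℕ} {S Q E : Type*} [TopologicalSpace S] [ChartedSpace (EuclideanSpace ℝ (Fin n)) S]
  [TopologicalSpace Q] [ChartedSpace (EuclideanSpace ℝ (Fin N)) Q]
  [TopologicalSpace E] [T2Space E] [ChartedSpace (EuclideanSpace ℝ (Fin (n + N))) E]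
  [IsManifold 𝓘(ℝ, EuclideanSpace ℝ (Fin n)) ∞ S]
  [IsManifold 𝓘(ℝ, EuclideanSpace ℝ (Fin N)) ∞ Q]
  {π : SmoothFibreBundle (EuclideanSpace ℝ (Fin n)) (EuclideanSpace ℝ (Fin N))
    (EuclideanSpace ℝ (Fin (n + N))) S Q E}

/-- The fibres of τ have dimension at least 2: one direction from N ≥ 1, and one momentum, which
exists because n ≥ 1 and vol supplies a nonzero n-form. -/
theorem exists_isVerticalFlow_multiphase (hn : 1 ≤ n) (hN : 1 ≤ N)
    (vol : VolumeForm (EuclideanSpace ℝ (Fin n)) S n)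
    (z : RestrictedMultiphaseSpace π n) (v : RestrictedModel n N)
    (hτv : (mfderiv 𝓘(ℝ, RestrictedModel n N) 𝓘(ℝ, EuclideanSpace ℝ (Fin n)) (tau π n) z v :
      EuclideanSpace ℝ (Fin n)) = 0) (hv : v ≠ 0) :
    ∃ (C : Set (RestrictedMultiphaseSpace π n))
      (σ : ℝ → RestrictedMultiphaseSpace π n → RestrictedMultiphaseSpace π n),
      IsVerticalFlow (RestrictedModel n N) (tau π n) C σ ∧
      (velocity (RestrictedModel n N) σ z : RestrictedModel n N) = v := by
  let c := adaptedChartAt π z.pt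
  have : Nonempty (Fin N) := ⟨⟨0, hN⟩⟩
  have hnt : Nontrivial (RestrictedFibreModel (EuclideanSpace ℝ (Fin n))
      (EuclideanSpace ℝ (Fin N)) n) :=
    restrictedFibreModel_nontrivial hn (stdBasis n) (vol.ne_zero (tau π n z))
  have hd : 2 ≤ Module.finrank ℝ (EuclideanSpace ℝ (Fin N)) +
      Module.finrank ℝ (RestrictedFibreModel (EuclideanSpace ℝ (Fin n))
        (EuclideanSpace ℝ (Fin N)) n) := by
    have h1 := Module.finrank_pos (R := ℝ) (M := RestrictedFibreModel (EuclideanSpace ℝ (Fin n))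
      (EuclideanSpace ℝ (Fin N)) n)
    rw [finrank_euclideanSpace_fin]
    omega
  exact exists_isVerticalFlow hd c.contMDiffOn_restrictedHomeo c.contMDiffOn_restrictedHomeo_symm
    c.contMDiffOn_baseChart contMDiff_tau
    (fun y hy => ⟨c.proj_mem _ hy, c.baseChart_proj _ hy⟩) (mem_adaptedChartAt π z.pt) hv hτv

end VerticalFlowsMultiphase

/-! ### The Hamiltonian field equations -/

section FieldEquation

variable {n : ℕ} {A V V' S M P : Type*} [NormedAddCommGroup A] [NormedSpace ℝ A]
  [FiniteDimensional ℝ A] [NormedAddCommGroup V] [NormedSpace ℝ V] [FiniteDimensional ℝ V]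
  [NormedAddCommGroup V'] [NormedSpace ℝ V'] [FiniteDimensional ℝ V']
  [TopologicalSpace S] [ChartedSpace A S] [IsManifold 𝓘(ℝ, A) ∞ S]
  [TopologicalSpace M] [ChartedSpace V M] [IsManifold 𝓘(ℝ, V) ∞ M]
  [TopologicalSpace P] [ChartedSpace V' P] [IsManifold 𝓘(ℝ, V') ∞ P]
  {θ : DiffForm V M n} {Θ : DiffForm V' P n} {vol : DiffForm A S n}
  {μ : M → P} {s : P → M} {p : M → S} {H : M → ℝ} {Ψ : S → P} {x : S}

/-- Differentiating μ ∘ s = id shows that s_*v is a preimage of v. -/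
theorem surjective_mfderiv_of_section (hμ : ContMDiff 𝓘(ℝ, V) 𝓘(ℝ, V') ∞ μ)
    (hs : ContMDiff 𝓘(ℝ, V') 𝓘(ℝ, V) ∞ s) (hμs : ∀ z, μ (s z) = z) (z : P) (v : V') :
    ∃ w : V, (mfderiv 𝓘(ℝ, V) 𝓘(ℝ, V') μ (s z) w : V') = v := by
  have hd2 : MDifferentiableAt 𝓘(ℝ, V') 𝓘(ℝ, V) s z := hs.mdifferentiableAt (by simp)
  have hd3 : MDifferentiableAt 𝓘(ℝ, V) 𝓘(ℝ, V') μ (s z) := hμ.mdifferentiableAt (by simp)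
  have hmu : μ ∘ s = id := funext hμs
  have hc := mfderiv_comp z hd3 hd2
  rw [hmu, mfderiv_id] at hc
  exact ⟨mfderiv 𝓘(ℝ, V') 𝓘(ℝ, V) s z v, (DFunLike.congr_fun hc v).symm⟩

/-- The decomposition formula along s ∘ Ψ, where H vanishes identically; μ ∘ s ∘ Ψ = Ψ then replaces
the frame pushed through M by the frame Ψ_*b. -/
theorem d_apply_of_section (hθ : ∀ m, θ.SmoothAt m) (hΘ : ∀ z, Θ.SmoothAt z)
    (hvol : vol.SmoothAt x) (hμ : ContMDiff 𝓘(ℝ, V) 𝓘(ℝ, V') ∞ μ)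
    (hs : ContMDiff 𝓘(ℝ, V') 𝓘(ℝ, V) ∞ s) (hp : ContMDiff 𝓘(ℝ, V) 𝓘(ℝ, A) ∞ p)
    (hμs : ∀ z, μ (s z) = z)
    (hdec : ∀ m (v : Fin n → TangentSpace 𝓘(ℝ, V) m),
      θ m v = Θ.pullback μ m v - H m * vol.pullback p m v)
    (hH : ∀ z, H (s z) = 0) (hΨ : MDifferentiableAt 𝓘(ℝ, A) 𝓘(ℝ, V') Ψ x)
    (hsec : ∀ᶠ y in 𝓝 x, p (s (Ψ y)) = y)
    {b : Fin n → A} (hb : vol x b ≠ 0) (w : V) :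
    θ.d (s (Ψ x)) (Fin.snoc (α := fun _ => V) (fun i =>
        mfderiv 𝓘(ℝ, A) 𝓘(ℝ, V) (s ∘ Ψ) x (b i)) w) =
      Θ.d (Ψ x) (Fin.snoc (α := fun _ => V') (fun i => mfderiv 𝓘(ℝ, A) 𝓘(ℝ, V') Ψ x (b i))
        (mfderiv 𝓘(ℝ, V) 𝓘(ℝ, V') μ (s (Ψ x)) w)) -
      (-1) ^ n * (differential (V := V) H (s (Ψ x)) w * vol x b) := by
  have hd2 : MDifferentiableAt 𝓘(ℝ, V') 𝓘(ℝ, V) s (Ψ x) := hs.mdifferentiableAt (by simp)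
  have hd3 : MDifferentiableAt 𝓘(ℝ, V) 𝓘(ℝ, V') μ (s (Ψ x)) := hμ.mdifferentiableAt (by simp)
  have hd : MDifferentiableAt 𝓘(ℝ, A) 𝓘(ℝ, V) (s ∘ Ψ) x := hd2.comp x hΨ
  have hmu : μ ∘ (s ∘ Ψ) = Ψ := funext fun y => hμs (Ψ y)
  have hc := mfderiv_comp x (I' := 𝓘(ℝ, V)) hd3 hd
  rw [hmu] at hc
  have key := d_apply_of_decomposition (H := H) (Ψ := s ∘ Ψ) (hθ _) (hΘ _) hvol
    hμ.contMDiffAt hp.contMDiffAt hd hdec (Filter.Eventually.of_forall fun y => hH (Ψ y)) hsec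
    hb w
  refine key.trans ?_
  congr 1
  refine (Θ.d.congr_base (hμs (Ψ x)) _).trans (congrArg (Θ.d (Ψ x)) ?_)
  have hsnoc : ∀ (T : V → V') (u : Fin n → V), (fun i => T (Fin.snoc (α := fun _ => V) u w i)) =
      Fin.snoc (α := fun _ => V') (fun i => T (u i)) (T w) := fun T u => Fin.comp_snoc T u w
  refine (hsnoc (mfderiv 𝓘(ℝ, V) 𝓘(ℝ, V') μ (s (Ψ x))) _).trans
    (congrArg (fun u => Fin.snoc (α := fun _ => V') u _) (funext fun i => ?_))
  exact (DFunLike.congr_fun hc (b i)).symm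

/-- The Hamiltonian field equation at a point, in terms of the reduced form. -/
theorem field_equation_iff (hθ : ∀ m, θ.SmoothAt m) (hΘ : ∀ z, Θ.SmoothAt z)
    (hvol : vol.SmoothAt x) (hμ : ContMDiff 𝓘(ℝ, V) 𝓘(ℝ, V') ∞ μ)
    (hs : ContMDiff 𝓘(ℝ, V') 𝓘(ℝ, V) ∞ s) (hp : ContMDiff 𝓘(ℝ, V) 𝓘(ℝ, A) ∞ p)
    (hμs : ∀ z, μ (s z) = z)
    (hdec : ∀ m (v : Fin n → TangentSpace 𝓘(ℝ, V) m),
      θ m v = Θ.pullback μ m v - H m * vol.pullback p m v)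
    (hH : ∀ z, H (s z) = 0) (hΨ : MDifferentiableAt 𝓘(ℝ, A) 𝓘(ℝ, V') Ψ x)
    (hsec : ∀ᶠ y in 𝓝 x, p (s (Ψ y)) = y)
    (b : Module.Basis (Fin n) ℝ A) (hb : vol x b ≠ 0)
    {Γ : ⋀[ℝ]^n (TangentSpace 𝓘(ℝ, A) x)} (hΓ : pairing Γ (vol x) = 1) :
    (∀ w : TangentSpace 𝓘(ℝ, V) (s (Ψ x)),
      contract (exteriorPower.map n (mfderiv 𝓘(ℝ, A) 𝓘(ℝ, V) (s ∘ Ψ) x).toLinearMap Γ)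
          (-(θ.d (s (Ψ x)))) w =
        (-1) ^ n * differential (V := V) H (s (Ψ x)) w) ↔
    ∀ v : V', Θ.d (Ψ x) (Matrix.vecCons (α := V') v fun i =>
      (mfderiv 𝓘(ℝ, A) 𝓘(ℝ, V') Ψ x (b i) : V')) = 0 := by
  -- The difference of the two sides of the field equation at w is, up to a nonzero factor, dΘ on
  -- μ_*w and the frame: the dH terms cancel exactly for the sign (-1)ⁿ and the normalisation of Γ.
  have h1 : ∀ w : V,
      contract (exteriorPower.map n (mfderiv 𝓘(ℝ, A) 𝓘(ℝ, V) (s ∘ Ψ) x).toLinearMap Γ)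
          (-(θ.d (s (Ψ x)))) w - (-1) ^ n * differential (V := V) H (s (Ψ x)) w =
      -((-1) ^ n * Θ.d (Ψ x) (Matrix.vecCons (α := V')
        (mfderiv 𝓘(ℝ, V) 𝓘(ℝ, V') μ (s (Ψ x)) w) fun i =>
        (mfderiv 𝓘(ℝ, A) 𝓘(ℝ, V') Ψ x (b i) : V'))) / vol x b := by
    intro w
    have h2 := contract_map (W := A) (W' := V) b (vol := vol x) hΓ
      (mfderiv 𝓘(ℝ, A) 𝓘(ℝ, V) (s ∘ Ψ) x).toLinearMap (-(θ.d (s (Ψ x)))) w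
    have h3 := d_apply_of_section hθ hΘ hvol hμ hs hp hμs hdec hH hΨ hsec hb w
    have h4 := form_snoc_eq_cons (W := V') (Θ.d (Ψ x))
      (fun i => (mfderiv 𝓘(ℝ, A) 𝓘(ℝ, V') Ψ x (b i) : V'))
      (mfderiv 𝓘(ℝ, V) 𝓘(ℝ, V') μ (s (Ψ x)) w)
    refine (congrArg (· - _) h2).trans ?_
    have h6 : ∀ {a b c d e p : ℝ}, a = -b → b = c - p * (d * e) → e ≠ 0 →
        a / e - p * d = -c / e := by
      intro a b c d e p h1 h2 he
      rw [h1, h2]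
      field_simp
      ring
    exact (h6 rfl h3 hb).trans (congrArg (fun q => -q / vol x b) h4)
  constructor
  · intro H' v
    obtain ⟨w, hw⟩ := surjective_mfderiv_of_section hμ hs hμs (Ψ x) v
    have h2 := h1 w
    rw [H' w, sub_self, hw, eq_comm, div_eq_zero_iff, neg_eq_zero, mul_eq_zero] at h2
    exact (h2.resolve_right hb).resolve_left (pow_ne_zero _ (by norm_num))
  · intro H' w
    refine sub_eq_zero.1 ((h1 w).trans ?_)
    refine (congrArg (fun q => -((-1) ^ n * q) / vol x b) (H' _)).trans ?_
    rw [mul_zero, neg_zero, zero_div]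

end FieldEquation

/-! ### The field equation of a Hamiltonian section -/

section Hamiltonian

variable {A B G : Type*} [NormedAddCommGroup A] [NormedSpace ℝ A]
  [NormedAddCommGroup B] [NormedSpace ℝ B] [NormedAddCommGroup G] [NormedSpace ℝ G]
  {S Q E : Type*} [TopologicalSpace S] [ChartedSpace A S]
  [TopologicalSpace Q] [ChartedSpace B Q] [TopologicalSpace E] [ChartedSpace G E]
  {π : SmoothFibreBundle A B G S Q E} {n : ℕ}
  [FiniteDimensional ℝ A] [FiniteDimensional ℝ B]
  [IsManifold 𝓘(ℝ, A) ∞ S] [IsManifold 𝓘(ℝ, B) ∞ Q]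

/-- The Hamiltonian field equation at a point, in terms of `dθ_h`. -/
theorem HamiltonianSection.field_equation_iff (h : HamiltonianSection π n)
    (hn : Module.finrank ℝ A = n) (vol : VolumeForm A S n) {x : S} (hvol : vol.form.SmoothAt x)
    {Ψ : S → RestrictedMultiphaseSpace π n}
    (hΨ : MDifferentiableAt 𝓘(ℝ, A) 𝓘(ℝ, (A × B) × RestrictedFibreModel A B n) Ψ x)
    (hsec : ∀ᶠ y in 𝓝 x, tau π n (Ψ y) = y)
    (b : Module.Basis (Fin n) ℝ A)
    {Γ : ⋀[ℝ]^n (TangentSpace 𝓘(ℝ, A) x)} (hΓ : pairing Γ (vol.form x) = 1) :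
    (∀ w : TangentSpace 𝓘(ℝ, (A × B) × FibreModel A B n) (h.toFun (Ψ x)),
      contract (exteriorPower.map n (mfderiv 𝓘(ℝ, A) 𝓘(ℝ, (A × B) × FibreModel A B n)
          (h.toFun ∘ Ψ) x).toLinearMap Γ) (omega π n (h.toFun (Ψ x))) w =
        (-1) ^ n * differential (V := (A × B) × FibreModel A B n) (h.hamiltonian hn vol)
          (h.toFun (Ψ x)) w) ↔
    ∀ v : (A × B) × RestrictedFibreModel A B n,
      h.theta.d (Ψ x) (Matrix.vecCons (α := (A × B) × RestrictedFibreModel A B n) v fun i =>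
        (mfderiv 𝓘(ℝ, A) 𝓘(ℝ, (A × B) × RestrictedFibreModel A B n) Ψ x (b i) :
          (A × B) × RestrictedFibreModel A B n)) = 0 :=
  FieldTheory.field_equation_iff FieldTheory.theta_smoothAt h.theta_smoothAt hvol contMDiff_mu
    h.contMDiff contMDiff_multiphaseProj h.mu_comp (theta_decomposition h hn vol)
    (h.hamiltonian_toFun hn vol) hΨ
    (hsec.mono fun y hy => (congrArg π.proj (h.pt_comp (Ψ y))).trans hy) b
    (top_form_ne_zero b (vol.ne_zero x)) hΓ

end Hamiltonian

end

end FieldTheory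

/-! ### Criticality and the Hamiltonian field equation -/

theorem theorem2 {n N : ℕ} (hn : 1 ≤ n) (hN : 1 ≤ N) {S Q E : Type*}
    [TopologicalSpace S] [T2Space S] [SecondCountableTopology S]
    [ChartedSpace (EuclideanSpace ℝ (Fin n)) S]
    [IsManifold 𝓘(ℝ, EuclideanSpace ℝ (Fin n)) ∞ S] [MeasurableSpace S] [BorelSpace S]
    [TopologicalSpace Q] [T2Space Q] [SecondCountableTopology Q]
    [ChartedSpace (EuclideanSpace ℝ (Fin N)) Q]
    [IsManifold 𝓘(ℝ, EuclideanSpace ℝ (Fin N)) ∞ Q]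
    [TopologicalSpace E] [T2Space E] [SecondCountableTopology E]
    [ChartedSpace (EuclideanSpace ℝ (Fin (n + N))) E]
    [IsManifold 𝓘(ℝ, EuclideanSpace ℝ (Fin (n + N))) ∞ E]
    (π : SmoothFibreBundle (EuclideanSpace ℝ (Fin n)) (EuclideanSpace ℝ (Fin N))
      (EuclideanSpace ℝ (Fin (n + N))) S Q E)
    (vol : VolumeForm (EuclideanSpace ℝ (Fin n)) S n)
    (γ : ∀ x : S, ⋀[ℝ]^n (TangentSpace 𝓘(ℝ, EuclideanSpace ℝ (Fin n)) x))
    (hγ : ∀ x, pairing (γ x) (vol.form x) = 1)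
    (h : HamiltonianSection π n)
    (U : Set S) (hU : IsOpen U) (Ψ : S → RestrictedMultiphaseSpace π n)
    (hΨ : ContMDiffOn 𝓘(ℝ, EuclideanSpace ℝ (Fin n)) 𝓘(ℝ, RestrictedModel n N) ∞ Ψ U)
    (hsec : ∀ x ∈ U, tau π n (Ψ x) = x) :
    IsCritical h vol U Ψ ↔
      ∀ x ∈ U, ∀ w : TangentSpace 𝓘(ℝ, MultiphaseModel n N) (h.toFun (Ψ x)),
        contract
            (exteriorPower.map n
              (mfderiv 𝓘(ℝ, EuclideanSpace ℝ (Fin n)) 𝓘(ℝ, MultiphaseModel n N)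
                (h.toFun ∘ Ψ) x).toLinearMap (γ x))
            (omega π n (h.toFun (Ψ x))) w =
          (-1) ^ n *
            differential (V := MultiphaseModel n N)
              (h.hamiltonian finrank_euclideanSpace_fin vol) (h.toFun (Ψ x)) w := by
  have hfield := fun (x : S) (hx : x ∈ U) =>
    h.field_equation_iff finrank_euclideanSpace_fin vol (vol.smoothAt x)
      ((hΨ.contMDiffAt (hU.mem_nhds hx)).mdifferentiableAt (by simp))
      (Filter.mem_of_superset (hU.mem_nhds hx) hsec) (stdBasis n) (hγ x)
  simp only [coe_stdBasis] at hfield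
  -- The field equation is exchanged for the vanishing of `ι dθ_h` along the section; what remains
  -- concerns P(π) only.
  refine Iff.trans ?_ (forall₂_congr hfield).symm
  -- Stokes' theorem is applied to forms of degree n - 1.
  obtain ⟨m, rfl⟩ : ∃ m, n = m + 1 := ⟨n - 1, by omega⟩
  constructor
  · intro hcrit x hx v
    exact field_equations_of_critical vol hU hΨ h.theta_smoothAt contMDiff_tau hsec
      (exists_isVerticalFlow_multiphase hn hN vol) hcrit hx v
  · intro H X _ _ hc _ σ hσ hσ0 hσX K hK hKU hXK
    exact hasDerivAt_integral_of_field_equations vol hU hΨ h.theta_smoothAt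
      contMDiff_tau.continuous hsec H hc hσ hσ0 hσX hK hKU hXK
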